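/- **Setting.** Thompson's group $V$ is the group of bijections $f$ of the Cantor set $\{0,1\}^{\mathbb N}$ of infinite binary words that act by finitely many prefix replacements: for some $N$, every word $u$ of length $N$ has a word $v$ with $f(uw)=vw$ for all infinite words $w$. All graphs are finite and directed, and may contain free loops (circles without vertices). A *split* is a vertex with one incoming and two outgoing edges, a *merge* a vertex with two incoming edges and one outgoing edge; a cyclic ordering of the three edges at such a vertex amounts to distinguishing the left from the right outgoing (respectively incoming) edge. An *abstract strand diagram* is an acyclic graph with a unique univalent source and a unique univalent sink, all of whose other vertices are splits or merges, together with a cyclic ordering of the edges at each of these vertices. It *represents* $f\in V$ if $f$ is the map computed by sending infinite words from the source to the sink, where a split removes the first letter of the word and sends the rest to the left (letter $0$) or to the right (letter $1$), and a merge puts $0$ or $1$ in front of a word that arrives from the left or from the right, respectively. (For the diagram glued from the two trees of a tree diagram along corresponding leaves, this is the element with that tree diagram.) A *closed strand diagram* is a triple $(D,o,c)$, where $D$ is a graph all of whose vertices are splits or merges, $o$ is a cyclic ordering of the edges at each vertex, and $c\in H^1(D;\mathbb Z)$ (the *cutting class*) satisfies $c(\sigma)>0$ for every directed cycle $\sigma$,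 free loops included. An isomorphism of closed strand diagrams is an isomorphism of directed graphs that preserves the cyclic orderings and pulls the cutting class back to the cutting class. The *closure* of an abstract strand diagram is obtained by gluing the sink to the source and deleting the resulting vertex; its cutting class is represented by the cochain with value $1$ on the edge or free loop that contains the glued point and $0$ on all others. A *reduction* of a closed strand diagram is one of the following moves. * (I) If the output of a merge $m$ is the input of a split $s$, via an edge $e$, delete $m$, $s$ and $e$, and glue the left (right) input of $m$ to the left (right) output of $s$; the cutting class is pulled back along the map from the new graph to the old one that runs through $e$ at each gluing. * (II) If the left (right) output of a split $s$ is the left (right) input of a merge $m$, and $c$ vanishes on the loop spanned by these two parallel edges, replace $s$, $m$ and the two edges by a single strand that joins the input of $s$ to the output of $m$; the cutting class is pulled back along the map that runs through either of the two parallel edges. * (III) If two distinct free loops have the same value of $c$, delete one of them. In (I) and (II), gluing an edge, or a chain of edges, to itself produces a free loop. A closed strand diagram is *reduced* if it admits no reduction; two are *equivalent* if they are connected by a finite sequence of reductions and inverse reductions. A *reduced closed strand diagram of* $f\in V$ is a reduced closed strand diagram that is equivalent to the closure of some abstract strand diagram representing $f$. **Theorem.** Every $f\in V$ has a reduced closed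 strand diagram, and for all $f,g\in V$ and all reduced closed strand diagrams $D$ of $f$ and $E$ of $g$: the elements $f$ and $g$ are conjugate in $V$ if and only if $D$ and $E$ are isomorphic. (In particular, the reduced closed strand diagram of $f$ is unique up to isomorphism.) -/

import Mathlib

namespace Strand

/-! ### Thompson's group `V` -/

/-- `f` acts on infinite binary words by finitely many prefix replacements: for some `N`, on each
of the `2 ^ N` cones of words that begin with a given word `u` of length `N`, the map `f` replaces
the prefix `u` by some word `v`. -/
def IsPrefixReplacement (f : Stream' Bool → Stream' Bool) : Prop :=
  ∃ N : ℕ, ∀ u : List Bool, u.length = N → ∃ v : List Bool, ∀ w : Stream' Bool,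
    f (u ++ₛ w) = v ++ₛ w

theorem isPrefixReplacement_comp {f g : Stream' Bool → Stream' Bool}
    (hg : IsPrefixReplacement g) (hf : IsPrefixReplacement f) :
    IsPrefixReplacement (fun x => g (f x)) := by
  obtain ⟨N, hN⟩ := hf
  obtain ⟨M, hM⟩ := hg
  refine ⟨N + M, fun u hu => ?_⟩
  obtain ⟨v, hv⟩ := hN (u.take N) (by simp [hu])
  have hlen : M ≤ (v ++ u.drop N).length := by simp [hu]
  obtain ⟨v', hv'⟩ := hM ((v ++ u.drop N).take M) (by simp only [List.length_take]; omega)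
  refine ⟨v' ++ (v ++ u.drop N).drop M, fun w => ?_⟩
  have h1 : u ++ₛ w = u.take N ++ₛ (u.drop N ++ₛ w) := by
    rw [← Stream'.append_append_stream, List.take_append_drop]
  have h2 : v ++ₛ (u.drop N ++ₛ w)
      = (v ++ u.drop N).take M ++ₛ ((v ++ u.drop N).drop M ++ₛ w) := by
    rw [← Stream'.append_append_stream, ← Stream'.append_append_stream, List.take_append_drop]
  change g (f (u ++ₛ w)) = _
  rw [h1, hv, h2, hv', Stream'.append_append_stream]

theorem isPrefixReplacement_symm (f : Equiv.Perm (Stream' Bool)) (hf : IsPrefixReplacement f) :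
    IsPrefixReplacement f.symm := by
  obtain ⟨N, hN⟩ := hf
  choose! v hv using hN
  have hfin : {u : List Bool | u.length = N}.Finite := List.finite_length_eq Bool N
  obtain ⟨L, hL⟩ := (hfin.image (fun u => (v u).length)).bddAbove
  refine ⟨L, fun t ht => ?_⟩
  let x := f.symm (t ++ₛ Stream'.const false)
  let u := x.take N
  have hu : u.length = N := Stream'.length_take N x
  have hx : x = u ++ₛ x.drop N := (Stream'.append_take_drop N x).symm
  have hfx : v u ++ₛ x.drop N = t ++ₛ Stream'.const false := by
    rw [← hv u hu, ← hx]; exact f.apply_symm_apply _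
  have hle : (v u).length ≤ t.length := by
    rw [ht]; exact hL ⟨u, hu, rfl⟩
  have hpre : t = v u ++ t.drop (v u).length := by
    have h3 : t.take (v u).length = v u := by
      rw [← Stream'.take_append_of_le_length _ t (Stream'.const false) hle, ← hfx,
        Stream'.take_append_of_le_length _ (v u) _ le_rfl, List.take_length]
    conv_lhs => rw [← List.take_append_drop (v u).length t, h3]
  refine ⟨u ++ t.drop (v u).length, fun w => ?_⟩
  rw [Equiv.symm_apply_eq, Stream'.append_append_stream, hv u hu, ← Stream'.append_append_stream,
    ← hpre]

/-- Thompson's group `V`, as the group of the bijections of the Cantor set of infinite binary words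
that act by finitely many prefix replacements. -/
def ThompsonV : Subgroup (Equiv.Perm (Stream' Bool)) where
  carrier := {f | IsPrefixReplacement f}
  mul_mem' ha hb := isPrefixReplacement_comp ha hb
  one_mem' := ⟨0, fun u _ => ⟨u, fun _ => rfl⟩⟩
  inv_mem' {f} hf := isPrefixReplacement_symm f hf

/-! ### Graphs composed of splits and merges

A split has one incoming edge and two outgoing edges, a merge has two incoming edges and one
outgoing edge.  A cyclic ordering of the three edges at a split (at a merge) amounts to telling
which outgoing (incoming) edge is the left one and which is the right one; here `false` stands for
left and `true` for right. -/

/-- The places where an edge can start: at a source, at the left or right output of a split, or at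
the output of a merge. -/
inductive Tail (I S M : Type) : Type
  | source (i : I) : Tail I S M
  | split (s : S) (b : Bool) : Tail I S M
  | merge (m : M) : Tail I S M

/-- The places where an edge can end: at a sink, at the input of a split, or at the left or right
input of a merge. -/
inductive Head (O S M : Type) : Type
  | sink (o : O) : Head O S M
  | split (s : S) : Head O S M
  | merge (m : M) (b : Bool) : Head O S M

/-- The vertices of a graph with the given sources, sinks, splits and merges. -/
inductive Vertex (I O S M : Type) : Type
  | source (i : I) : Vertex I O S M
  | sink (o : O) : Vertex I O S M
  | split (s : S) : Vertex I O S M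
  | merge (m : M) : Vertex I O S M

def Tail.map {I I' S S' M M' : Type} (i : I' → I) (σ : S' → S) (μ : M' → M) :
    Tail I' S' M' → Tail I S M
  | .source x => .source (i x)
  | .split s b => .split (σ s) b
  | .merge m => .merge (μ m)

def Head.map {O O' S S' M M' : Type} (o : O' → O) (σ : S' → S) (μ : M' → M) :
    Head O' S' M' → Head O S M
  | .sink x => .sink (o x)
  | .split s => .split (σ s)
  | .merge m b => .merge (μ m) b

def Tail.vertex {I S M : Type} (O : Type) : Tail I S M → Vertex I O S M
  | .source x => .source x
  | .split s _ => .split s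
  | .merge m => .merge m

def Head.vertex {O S M : Type} (I : Type) : Head O S M → Vertex I O S M
  | .sink x => .sink x
  | .split s => .split s
  | .merge m _ => .merge m

/-- A finite directed graph with univalent sources indexed by `I`, univalent sinks indexed by `O`,
all of whose other vertices are splits and merges with a cyclic ordering of their edges.  Free
loops, that is, circles without vertices, are allowed. -/
structure StrandGraph (I O : Type) where
  Split : Type
  Merge : Type
  /-- the edges that have end points -/
  Edge : Type
  /-- the free loops -/
  Loop : Type
  finite_split : Finite Split
  finite_merge : Finite Merge
  finite_loop : Finite Loop
  /-- where an edge starts; each starting place belongs to exactly one edge -/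
  tail : Edge ≃ Tail I Split Merge
  /-- where an edge ends; each ending place belongs to exactly one edge -/
  head : Edge ≃ Head O Split Merge

namespace StrandGraph

variable {I O : Type} (G : StrandGraph I O)

/-- The edges and the free loops of a graph. -/
abbrev Strands : Type := G.Edge ⊕ G.Loop

/-- The vertices of a graph. -/
abbrev Vertices : Type := Vertex I O G.Split G.Merge

/-- The vertex where an edge starts. -/
def src (e : G.Edge) : G.Vertices := (G.tail e).vertex O

/-- The vertex where an edge ends. -/
def tgt (e : G.Edge) : G.Vertices := (G.head e).vertex I

/-- `γ 0, …, γ n` are the successive edges of a closed directed path. -/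
def IsDirectedCycle {n : ℕ} (γ : Fin (n + 1) → G.Edge) : Prop :=
  ∀ i, G.tgt (γ i) = G.src (γ (i + 1))

/-- The cellular coboundary map from integral `0`-cochains to integral `1`-cochains; on a free loop,
which has no vertices, a coboundary vanishes. -/
def coboundary : (G.Vertices → ℤ) →+ (G.Strands → ℤ) where
  toFun φ := Sum.elim (fun e => φ (G.tgt e) - φ (G.src e)) (fun _ => 0)
  map_zero' := by
    funext x
    cases x <;> simp
  map_add' φ ψ := by
    funext x
    cases x
    · simp only [Sum.elim_inl, Pi.add_apply]
      ring
    · simp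

/-- The first cohomology group of the graph, with integral coefficients. -/
abbrev H1 : Type := (G.Strands → ℤ) ⧸ G.coboundary.range

/-- A cochain is positive on every directed cycle, be it a closed directed path or a free loop. -/
def PositiveOnCycles (z : G.Strands → ℤ) : Prop :=
  (∀ (n : ℕ) (γ : Fin (n + 1) → G.Edge), G.IsDirectedCycle γ → 0 < ∑ i, z (Sum.inl (γ i))) ∧
    ∀ l : G.Loop, 0 < z (Sum.inr l)

end StrandGraph

/-! ### Abstract strand diagrams and the elements that they represent -/

/-- An abstract strand diagram: a finite acyclic graph with exactly one source and one sink, all of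
whose other vertices are splits and merges, with a cyclic ordering at each vertex. -/
structure AbstractStrandDiagram extends StrandGraph Unit Unit where
  isEmpty_loop : IsEmpty Loop
  acyclic : ∀ (n : ℕ) (γ : Fin (n + 1) → Edge), ¬ toStrandGraph.IsDirectedCycle γ

/-- An abstract strand diagram represents the map `f` on infinite binary words that is computed by
letting a word run through the diagram from the source to the sink: a split removes the first letter
of the word and sends the rest to the left or to the right according to that letter, and a merge
puts the letter of the side from which the word arrives in front of it.  Here `F e w` is the word
that arrives at the sink if `w` is put on the edge `e`.  If the diagram is glued from the two trees
of a tree diagram, then this is the element with that tree diagram. -/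
def AbstractStrandDiagram.Represents (A : AbstractStrandDiagram)
    (f : Stream' Bool → Stream' Bool) : Prop :=
  ∃ F : A.Edge → Stream' Bool → Stream' Bool,
    F (A.tail.symm (.source ())) = f ∧
    (∀ s b w, F (A.head.symm (.split s)) (Stream'.cons b w) = F (A.tail.symm (.split s b)) w) ∧
    (∀ m b w, F (A.head.symm (.merge m b)) w = F (A.tail.symm (.merge m)) (Stream'.cons b w)) ∧
    ∀ w, F (A.head.symm (.sink ())) w = w

/-! ### Closed strand diagrams -/

/-- A closed strand diagram: a finite directed graph composed of splits and merges, with a cyclic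
ordering at each vertex and an integral cohomology class, the cutting class, that is positive on
every directed cycle. -/
structure ClosedStrandDiagram extends StrandGraph Empty Empty where
  cuttingClass : toStrandGraph.H1
  positive : ∀ z : toStrandGraph.Strands → ℤ, (QuotientAddGroup.mk z : toStrandGraph.H1) =
    cuttingClass → toStrandGraph.PositiveOnCycles z

namespace ClosedStrandDiagram

/-- The cochain `z` represents the cutting class. -/
def IsCutting (D : ClosedStrandDiagram) (z : D.Strands → ℤ) : Prop :=
  (QuotientAddGroup.mk z : D.toStrandGraph.H1) = D.cuttingClass

/-- An isomorphism of closed strand diagrams: an isomorphism of directed graphs that preserves the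
cyclic orderings and pulls the cutting class back to the cutting class. -/
structure Iso (D D' : ClosedStrandDiagram) where
  split : D.Split ≃ D'.Split
  merge : D.Merge ≃ D'.Merge
  edge : D.Edge ≃ D'.Edge
  loop : D.Loop ≃ D'.Loop
  tail_edge : ∀ e, D'.tail (edge e) = (D.tail e).map id split merge
  head_edge : ∀ e, D'.head (edge e) = (D.head e).map id split merge
  isCutting : ∀ z, D'.IsCutting z → D.IsCutting (z ∘ Sum.map edge loop)

end ClosedStrandDiagram

/-! ### Erasing vertices and joining the strands that end there -/

/-- `G'` arises from `G` by erasing the splits in `S₀`, the merges in `M₀`, all sources and sinks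
and the strands in `X₀`, and then gluing the end of the remaining edge `a` to the start of the
remaining edge `b` whenever `link a b` holds.  Chains of glued edges become edges, and closed chains
of glued edges become free loops.  The map `q` sends each remaining strand of `G` to the strand of
`G'` of which it is a part. -/
structure Splicing {I O : Type} (G : StrandGraph I O) (G' : StrandGraph Empty Empty)
    (S₀ : Set G.Split) (M₀ : Set G.Merge) (X₀ : Set G.Strands)
    (link : G.Edge → G.Edge → Prop) where
  σ : G'.Split ≃ {s : G.Split // s ∉ S₀}
  μ : G'.Merge ≃ {m : G.Merge // m ∉ M₀}
  q : {x : G.Strands // x ∉ X₀} → G'.Strands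
  q_surjective : Function.Surjective q
  q_eq_iff : ∀ x y, q x = q y ↔ Relation.EqvGen
    (fun x y : {x : G.Strands // x ∉ X₀} => ∃ a b, x.1 = Sum.inl a ∧ y.1 = Sum.inl b ∧ link a b) x y
  q_tail : ∀ (t : Tail Empty G'.Split G'.Merge) (a : G.Edge) (ha : Sum.inl a ∉ X₀),
    G.tail a = t.map Empty.elim (fun s => (σ s).1) (fun m => (μ m).1) →
      q ⟨Sum.inl a, ha⟩ = Sum.inl (G'.tail.symm t)
  q_head : ∀ (h : Head Empty G'.Split G'.Merge) (a : G.Edge) (ha : Sum.inl a ∉ X₀),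
    G.head a = h.map Empty.elim (fun s => (σ s).1) (fun m => (μ m).1) →
      q ⟨Sum.inl a, ha⟩ = Sum.inl (G'.head.symm h)

/-- The cochain on the spliced graph whose value on a strand is the sum of the values of `w` on the
parts of this strand. -/
noncomputable def Splicing.push {I O : Type} {G : StrandGraph I O} {G' : StrandGraph Empty Empty}
    {S₀ : Set G.Split} {M₀ : Set G.Merge} {X₀ : Set G.Strands} {link : G.Edge → G.Edge → Prop}
    (P : Splicing G G' S₀ M₀ X₀ link) (w : G.Strands → ℤ) : G'.Strands → ℤ :=
  fun y => ∑ᶠ (x : {x : G.Strands // x ∉ X₀}) (_ : P.q x = y), w x.1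

open Classical in
/-- The closed strand diagram `D` is obtained from the abstract strand diagram `A` by gluing the sink
to the source and deleting the resulting vertex.  The cutting class is given by the number of cut
points on each strand: the strand that runs through the old sink has one cut point, the other
strands have none. -/
def IsClosureOf (D : ClosedStrandDiagram) (A : AbstractStrandDiagram) : Prop :=
  ∃ P : Splicing A.toStrandGraph D.toStrandGraph ∅ ∅ ∅
      (fun a b => A.head a = .sink () ∧ A.tail b = .source ()),
    D.IsCutting (P.push fun x => if x = Sum.inl (A.head.symm (.sink ())) then 1 else 0)

/-! ### Reductions of closed strand diagrams -/

namespace ClosedStrandDiagram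

open Classical in
/-- The first reduction: if the output of the merge `m` is the input of the split `s`, then the edge
`e` from `m` to `s` is erased together with `m` and `s`, the left input of `m` is glued to the left
output of `s` and the right input of `m` to the right output of `s`.  The cutting class is pulled
back along the map that lets each glued strand run through `e` at each gluing. -/
def ReducesI (D D' : ClosedStrandDiagram) : Prop :=
  ∃ (m : D.Merge) (s : D.Split) (e : D.Edge), D.tail e = .merge m ∧ D.head e = .split s ∧
    ∃ P : Splicing D.toStrandGraph D'.toStrandGraph {s} {m} {Sum.inl e}
        (fun a b => ∃ k : Bool, D.head a = .merge m k ∧ D.tail b = .split s k),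
      ∃ z, D.IsCutting z ∧ D'.IsCutting (P.push fun x =>
        z x + if ∃ a k, x = Sum.inl a ∧ D.head a = .merge m k then z (Sum.inl e) else 0)

open Classical in
/-- The second reduction: if the left output `a` of the split `s` is the left input of the merge `m`,
the right output `b` of `s` is the right input of `m`, and the cutting class vanishes on the loop
that is spanned by `a` and `b`, then `s`, `m`, `a` and `b` are erased and the input of `s` is glued
to the output of `m`.  The cutting class is pulled back along the map that lets the glued strand run
through `a`. -/
def ReducesII (D D' : ClosedStrandDiagram) : Prop :=
  ∃ (s : D.Split) (m : D.Merge) (a b : D.Edge),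
    D.tail a = .split s false ∧ D.head a = .merge m false ∧
    D.tail b = .split s true ∧ D.head b = .merge m true ∧
    ∃ P : Splicing D.toStrandGraph D'.toStrandGraph {s} {m} {Sum.inl a, Sum.inl b}
        (fun x y => D.head x = .split s ∧ D.tail y = .merge m),
      ∃ z, D.IsCutting z ∧ z (Sum.inl a) = z (Sum.inl b) ∧ D'.IsCutting (P.push fun x =>
        z x + if x = Sum.inl (D.head.symm (.split s)) then z (Sum.inl a) else 0)

/-- The third reduction: of two distinct free loops on which the cutting class takes the same value,
one is erased. -/
def ReducesIII (D D' : ClosedStrandDiagram) : Prop :=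
  ∃ l l' : D.Loop, l ≠ l' ∧
    ∃ P : Splicing D.toStrandGraph D'.toStrandGraph ∅ ∅ {Sum.inr l'} (fun _ _ => False),
      ∃ z, D.IsCutting z ∧ z (Sum.inr l) = z (Sum.inr l') ∧ D'.IsCutting (P.push z)

/-- `D'` is obtained from `D` by one reduction. -/
def Reduces (D D' : ClosedStrandDiagram) : Prop :=
  ReducesI D D' ∨ ReducesII D D' ∨ ReducesIII D D'

/-- A closed strand diagram is reduced if it is not subject to any reductions. -/
def IsReduced (D : ClosedStrandDiagram) : Prop := ¬ ∃ D', Reduces D D'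

/-- Two closed strand diagrams are equivalent if one can be obtained from the other by a sequence of
reductions and inverse reductions. -/
def Equivalent : ClosedStrandDiagram → ClosedStrandDiagram → Prop := Relation.EqvGen Reduces

/-- `D` is a reduced closed strand diagram of the element `f` of `V`: it is reduced, and it is
equivalent to the closure of an abstract strand diagram that represents `f`. -/
def IsReducedDiagramOf (D : ClosedStrandDiagram) (f : ThompsonV) : Prop :=
  D.IsReduced ∧ ∃ (A : AbstractStrandDiagram) (C : ClosedStrandDiagram),
    A.Represents f.1 ∧ IsClosureOf C A ∧ Equivalent C D

end ClosedStrandDiagram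

end Strand

namespace Strand

/-! ### Spaces with charts, and maps between them that are given by prefix replacements -/

/-! The bridge between group elements and diagrams is a space with a permutation `T` and charts from
the Cantor set. For a closed strand diagram with a cochain `z` in its cutting class, put a copy of
the Cantor set on each strand, multiply by `ℤ`, and identify each point with its image after running
through the next vertex: the word changes as at a split or a merge, and the integer drops by the
value of `z` on the strand just left. `T` raises the integer by one. This quotient is the flow
space, a suspension of the dynamics encoded by the diagram. Maps between such spaces must commute
with `T` and be given, piecewise on cones, by prefix replacements and powers of `T`.

Two facts make the flow space an invariant of the conjugacy class. The Cantor sets with the actions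
of `f` and of `g` are isomorphic exactly if `f` and `g` are conjugate in `V`
(`isom_cantorSpace_iff`), and the flow space of a closure is the Cantor set with the action of the
represented element (`isom_cantorSpace`). Changing `z` by a coboundary translates charts, and each
reduction only discards redundant charts or joins two into one (`isom_I`, `isom_II`, `isom_III`);
splicing strands is harmless (`Splicing.isom_space`). Hence equivalent diagrams have isomorphic flow
spaces.

It remains to recover a reduced diagram from its flow space. The identifications are deterministic
forwards and backwards, so two equal points are joined by a path in one direction. Without move I no
merge feeds a split, so such a path is a descent through splits followed by passages through merges.
A directed cycle of splits appears in the space as a relation in which deleting a prefix is a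
translation; such relations are visible in the other diagram, so charts on cycles of splits
correspond up to translation (`exists_of_cycle`). All edges starting at splits descend from such
cycles, and the correspondence descends with them once an edge entering a split is known to be
matched with an edge entering a split (`mem_dom`); this is where the absence of move II is used.
Edges starting at merges are treated by reversing all arrows. Free loops are detected by their
periods, which are distinct in the absence of move III. The translations between matched charts
supply the coboundary relating the cutting classes.

Existence needs a diagram for each element, glued from two trees, and termination of reduction.
Positivity of the cutting class under splicing is carried by potentials: integers on the edges for
which a multiple of the class becomes at least one on each edge. Such inequalities are local and
simply add up along glued strands. -/

theorem zpow_add_apply {Y : Type} (T : Equiv.Perm Y) (m n : ℤ) (y : Y) :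
    (T ^ (m + n)) y = (T ^ m) ((T ^ n) y) := by
  rw [zpow_add, Equiv.Perm.mul_apply]

theorem map_zpow_of_map {Y Z : Type} (T : Equiv.Perm Y) (U : Equiv.Perm Z) (h : Y → Z)
    (hT : ∀ y, h (T y) = U (h y)) (n : ℤ) (y : Y) : h ((T ^ n) y) = (U ^ n) (h y) := by
  have hs : ∀ y, h (T⁻¹ y) = U⁻¹ (h y) := fun y => by
    rw [Equiv.Perm.eq_inv_iff_eq, ← hT]; simp
  induction n generalizing y with
  | zero => simp
  | succ n ih => rw [zpow_add_one, zpow_add_one, Equiv.Perm.mul_apply, ih, hT, Equiv.Perm.mul_apply]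
  | pred n ih => rw [zpow_sub_one, zpow_sub_one, Equiv.Perm.mul_apply, ih, hs, Equiv.Perm.mul_apply]

/-- A set with a permutation and with a family of charts that are defined on the Cantor set. -/
structure VSpace where
  Point : Type
  T : Equiv.Perm Point
  Index : Type
  chart : Index → Stream' Bool → Point

namespace VSpace

/-- A map from the Cantor set that is given, on the cones of a finite partition, by a translate of
a chart after a prefix replacement. -/
inductive IsLocal (Y : VSpace) : (Stream' Bool → Y.Point) → Prop
  | base (g : Stream' Bool → Y.Point) (n : ℤ) (i : Y.Index) (v : List Bool)
      (h : ∀ w, g w = (Y.T ^ n) (Y.chart i (v ++ₛ w))) : IsLocal Y g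
  | node (g : Stream' Bool → Y.Point) (h : ∀ b, IsLocal Y (fun w => g (Stream'.cons b w))) :
      IsLocal Y g

variable {X Y Z : VSpace}

theorem isLocal_chart (i : Y.Index) : Y.IsLocal (Y.chart i) :=
  .base _ 0 i [] fun w => by simp

theorem isLocal_zpow_chart (n : ℤ) (i : Y.Index) : Y.IsLocal (fun w => (Y.T ^ n) (Y.chart i w)) :=
  .base _ n i [] fun w => by simp

theorem IsLocal.cons {g : Stream' Bool → Y.Point} (hg : Y.IsLocal g) (b : Bool) :
    Y.IsLocal (fun w => g (Stream'.cons b w)) := by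
  cases hg with
  | base _ n i v h =>
    refine .base _ n i (v ++ [b]) fun w => ?_
    rw [h, Stream'.append_append_stream]; rfl
  | node _ h => exact h b

theorem IsLocal.append {g : Stream' Bool → Y.Point} (hg : Y.IsLocal g) (u : List Bool) :
    Y.IsLocal (fun w => g (u ++ₛ w)) := by
  induction u generalizing g with
  | nil => simpa using hg
  | cons b u ih => exact ih (hg.cons b)

theorem IsLocal.zpow {g : Stream' Bool → Y.Point} (hg : Y.IsLocal g) (m : ℤ) :
    Y.IsLocal (fun w => (Y.T ^ m) (g w)) := by
  induction hg with
  | base g n i v h => exact .base _ (m + n) i v fun w => by rw [h, zpow_add_apply]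
  | node g h ih => exact .node _ ih

theorem IsLocal.of_length {g : Stream' Bool → Y.Point} (N : ℕ)
    (h : ∀ u : List Bool, u.length = N → Y.IsLocal (fun w => g (u ++ₛ w))) : Y.IsLocal g := by
  induction N generalizing g with
  | zero => simpa using h [] rfl
  | succ N ih => exact .node _ fun b => ih fun u hu => h (b :: u) (by simp [hu])

/-- Along each infinite word a local map is eventually a translate of a chart after a prefix
replacement. -/
theorem IsLocal.eventually {g : Stream' Bool → Y.Point} (hg : Y.IsLocal g) (α : Stream' Bool) :
    ∃ N : ℕ, ∀ M, N ≤ M → ∃ (n : ℤ) (i : Y.Index) (v : List Bool), ∀ w,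
      g (α.take M ++ₛ w) = (Y.T ^ n) (Y.chart i (v ++ₛ w)) := by
  induction hg generalizing α with
  | base g n i v h =>
    refine ⟨0, fun M _ => ⟨n, i, v ++ α.take M, fun w => ?_⟩⟩
    rw [h, Stream'.append_append_stream]
  | node g h ih =>
    obtain ⟨N, hN⟩ := ih α.head α.tail
    refine ⟨N + 1, fun M hM => ?_⟩
    obtain ⟨M, rfl⟩ : ∃ M', M = M' + 1 := ⟨M - 1, by omega⟩
    exact hN M (by omega)

/-- An equivariant map of spaces with charts that is given by prefix replacements. -/
structure Hom (Y Z : VSpace) where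
  toFun : Y.Point → Z.Point
  map_T : ∀ y, toFun (Y.T y) = Z.T (toFun y)
  isLocal : ∀ i, Z.IsLocal (fun w => toFun (Y.chart i w))

theorem Hom.map_zpow (f : Hom Y Z) (n : ℤ) (y : Y.Point) :
    f.toFun ((Y.T ^ n) y) = (Z.T ^ n) (f.toFun y) :=
  map_zpow_of_map _ _ _ f.map_T n y

theorem IsLocal.map (f : Hom Y Z) {g : Stream' Bool → Y.Point} (hg : Y.IsLocal g) :
    Z.IsLocal (fun w => f.toFun (g w)) := by
  induction hg with
  | base g n i v h =>
    have := ((f.isLocal i).append v).zpow n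
    convert this using 2 with w
    rw [h, f.map_zpow]
  | node g h ih => exact .node _ ih

def Hom.comp (g : Hom Y Z) (f : Hom X Y) : Hom X Z where
  toFun x := g.toFun (f.toFun x)
  map_T x := by rw [f.map_T, g.map_T]
  isLocal i := (f.isLocal i).map g

/-- Two spaces with charts are isomorphic. -/
def Isom (Y Z : VSpace) : Prop :=
  ∃ (f : Hom Y Z) (g : Hom Z Y), (∀ y, g.toFun (f.toFun y) = y) ∧ ∀ z, f.toFun (g.toFun z) = z

theorem Isom.symm (h : Isom Y Z) : Isom Z Y := by
  obtain ⟨f, g, h1, h2⟩ := h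
  exact ⟨g, f, h2, h1⟩

theorem Isom.trans (h : Isom X Y) (h' : Isom Y Z) : Isom X Z := by
  obtain ⟨f, g, h1, h2⟩ := h
  obtain ⟨f', g', h1', h2'⟩ := h'
  refine ⟨f'.comp f, g.comp g', fun x => ?_, fun z => ?_⟩
  · change g.toFun (g'.toFun (f'.toFun (f.toFun x))) = x
    rw [h1', h1]
  · change f'.toFun (f.toFun (g.toFun (g'.toFun z))) = z
    rw [h2, h2']

end VSpace

/-! ### Spaces presented by gluing rules -/

/-- A family of gluing rules: `rule x u k y v` says that translating the cone of `u` in the chart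
`x` by `k` gives the cone of `v` in the chart `y`. -/
structure Presentation where
  Index : Type
  rule : Index → List Bool → ℤ → Index → List Bool → Prop

namespace Presentation

variable (P Q : Presentation)

/-- A family of maps from the Cantor set to a set with a permutation that satisfies the rules. -/
def IsModel {Y : Type} (T : Equiv.Perm Y) (φ : P.Index → Stream' Bool → Y) : Prop :=
  ∀ x u k y v, P.rule x u k y v → ∀ w, (T ^ k) (φ x (u ++ₛ w)) = φ y (v ++ₛ w)

/-- The triple `(x, w, n)` stands for the translate by `n` of the point `w` of the chart `x`; a step
is a gluing rule, translated by `n`. -/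
inductive Step : P.Index × Stream' Bool × ℤ → P.Index × Stream' Bool × ℤ → Prop
  | mk (x u k y v) (h : P.rule x u k y v) (w : Stream' Bool) (n : ℤ) :
      Step (x, u ++ₛ w, n + k) (y, v ++ₛ w, n)

def shift (n : ℤ) : Quot P.Step → Quot P.Step :=
  Quot.map (fun a => (a.1, a.2.1, a.2.2 + n)) (by
    rintro _ _ ⟨x, u, k, y, v, h, w, m⟩
    have := Step.mk x u k y v h w (m + n)
    rwa [add_right_comm] at this)

/-- The universal space with charts that satisfies the rules. -/
abbrev space : VSpace where
  Point := Quot P.Step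
  T :=
    { toFun := P.shift 1
      invFun := P.shift (-1)
      left_inv := by rintro ⟨x, w, n⟩; simp [shift, Quot.map]
      right_inv := by rintro ⟨x, w, n⟩; simp [shift, Quot.map] }
  Index := P.Index
  chart x w := Quot.mk _ (x, w, 0)

variable {P Q}

variable (P) in
def point (x : P.Index) (w : Stream' Bool) (n : ℤ) : P.space.Point := Quot.mk _ (x, w, n)

theorem space_zpow (n m : ℤ) (x : P.Index) (w : Stream' Bool) :
    (P.space.T ^ n) (P.point x w m) = P.point x w (m + n) := by
  have h1 : ∀ m, P.space.T (P.point x w m) = P.point x w (m + 1) := fun m => rfl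
  have h2 : ∀ m, P.space.T⁻¹ (P.point x w m) = P.point x w (m - 1) := fun m => rfl
  induction n generalizing m with
  | zero => simp
  | succ n ih =>
    rw [zpow_add_one, Equiv.Perm.mul_apply, h1, ih]
    congr 1
    ring
  | pred n ih =>
    rw [zpow_sub_one, Equiv.Perm.mul_apply, h2, ih]
    congr 1
    ring

theorem point_eq_zpow_chart (n : ℤ) (x : P.Index) (w : Stream' Bool) :
    P.point x w n = (P.space.T ^ n) (P.space.chart x w) := by
  change _ = (P.space.T ^ n) (P.point x w 0)
  rw [space_zpow, zero_add]

theorem space_induction {C : P.space.Point → Prop}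
    (h : ∀ (n : ℤ) (x : P.Index) (w : Stream' Bool), C ((P.space.T ^ n) (P.space.chart x w)))
    (y : P.space.Point) : C y := by
  obtain ⟨x, w, n⟩ := y
  change C (P.point x w n)
  rw [point_eq_zpow_chart]
  exact h n x w

theorem isModel_chart : P.IsModel P.space.T P.space.chart := by
  intro x u k y v h w
  rw [← point_eq_zpow_chart]
  have := Step.mk x u k y v h w 0
  rw [zero_add] at this
  exact Quot.sound this

/-- The map to a space that is given by a model of the rules. -/
def lift {Y : VSpace} (φ : P.Index → Stream' Bool → Y.Point) (hφ : P.IsModel Y.T φ)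
    (hl : ∀ x, Y.IsLocal (φ x)) : VSpace.Hom P.space Y where
  toFun := Quot.lift (fun a => (Y.T ^ a.2.2) (φ a.1 a.2.1)) (by
    rintro _ _ ⟨x, u, k, y, v, h, w, m⟩
    change (Y.T ^ (m + k)) _ = _
    rw [zpow_add_apply, hφ x u k y v h])
  map_T := by
    rintro ⟨x, w, n⟩
    change (Y.T ^ (n + 1)) _ = Y.T ((Y.T ^ n) _)
    rw [add_comm, zpow_add_apply, zpow_one]
  isLocal x := by
    change Y.IsLocal (fun w => (Y.T ^ (0 : ℤ)) (φ x w))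
    simpa using hl x

theorem lift_chart {Y : VSpace} (φ : P.Index → Stream' Bool → Y.Point) (hφ : P.IsModel Y.T φ)
    (hl : ∀ x, Y.IsLocal (φ x)) (x : P.Index) (w : Stream' Bool) :
    (lift φ hφ hl).toFun (P.space.chart x w) = φ x w := by
  change (Y.T ^ (0 : ℤ)) (φ x w) = _
  simp

/-- By universality, a model in each direction gives two equivariant maps. They are mutually inverse
as soon as they are so on charts, because every point is a translate of a chart point. -/
theorem isom_of_models (φ : P.Index → Stream' Bool → Q.space.Point)
    (ψ : Q.Index → Stream' Bool → P.space.Point) (hφ : P.IsModel Q.space.T φ)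
    (hψ : Q.IsModel P.space.T ψ) (hφl : ∀ x, Q.space.IsLocal (φ x))
    (hψl : ∀ x, P.space.IsLocal (ψ x))
    (h1 : ∀ f : VSpace.Hom P.space Q.space, (∀ x w, f.toFun (P.space.chart x w) = φ x w) →
      ∀ y w, f.toFun (ψ y w) = Q.space.chart y w)
    (h2 : ∀ f : VSpace.Hom Q.space P.space, (∀ x w, f.toFun (Q.space.chart x w) = ψ x w) →
      ∀ y w, f.toFun (φ y w) = P.space.chart y w) : VSpace.Isom P.space Q.space := by
  refine ⟨lift φ hφ hφl, lift ψ hψ hψl, ?_, ?_⟩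
  · refine space_induction fun n x w => ?_
    rw [VSpace.Hom.map_zpow, VSpace.Hom.map_zpow, lift_chart, h2 _ (lift_chart _ _ _)]
  · refine space_induction fun n x w => ?_
    rw [VSpace.Hom.map_zpow, VSpace.Hom.map_zpow, lift_chart, h1 _ (lift_chart _ _ _)]

end Presentation

/-! ### Finite cycles -/

/-- Along the cycles of a permutation, each cut open at a base point, the partial sums of `w`. -/
theorem exists_offset {X Y : Type} [Finite X] (π : Equiv.Perm X) (q : X → Y) (base : Y → X)
    (hq : ∀ x y, q x = q y ↔ π.SameCycle x y) (hbase : ∀ y, q (base y) = y) (w : X → ℤ) :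
    ∃ o : X → ℤ, (∀ y, o (base y) = 0) ∧ ∀ x,
      (π x = base (q x) → o x + w x = ∑ᶠ (x' : X) (_ : q x' = q x), w x') ∧
      (π x ≠ base (q x) → o (π x) = o x + w x) := by
  classical
  set r : Y → ℕ := fun y => Function.minimalPeriod π (base y) with hr
  have hper : ∀ y, 0 < r y := fun y =>
    Function.minimalPeriod_pos_of_mem_periodicPts
      (Function.Injective.mem_periodicPts π.injective (base y))
  have hidx : ∀ x, ∃ i, i < r (q x) ∧ π^[i] (base (q x)) = x := by
    intro x
    obtain ⟨i, hi⟩ := ((hq (base (q x)) x).1 (hbase _)).exists_nat_pow_eq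
    refine ⟨i % r (q x), Nat.mod_lt _ (hper _), ?_⟩
    rw [hr, Function.iterate_mod_minimalPeriod_eq, Equiv.Perm.iterate_eq_pow, hi]
  have hq' : ∀ (i : ℕ) y, q (π^[i] (base y)) = y := by
    intro i y
    conv_rhs => rw [← hbase y]
    rw [hq, Equiv.Perm.iterate_eq_pow]
    exact (Equiv.Perm.SameCycle.refl π (base y)).pow_left
  have huniq : ∀ y i j, i < r y → j < r y → π^[i] (base y) = π^[j] (base y) → i = j := by
    intro y i j hi hj h
    exact (Function.iterate_eq_iterate_iff_of_lt_minimalPeriod hi hj).1 h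
  choose idx hidx1 hidx2 using hidx
  have hidx3 : ∀ y i, i < r y → idx (π^[i] (base y)) = i := by
    intro y i hi
    refine huniq y _ _ ?_ hi ?_
    · have := hidx1 (π^[i] (base y)); rwa [hq'] at this
    · have := hidx2 (π^[i] (base y)); rwa [hq'] at this
  -- The offset of `x` is the total weight of the elements met on the way from the base point to
  -- `x`. At the last element before the base point, `idx x + 1` is the period and the sum runs over
  -- the whole cycle.
  refine ⟨fun x => ∑ j ∈ Finset.range (idx x), w (π^[j] (base (q x))), ?_, ?_⟩
  · intro y
    have := hidx3 y 0 (hper y)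
    rw [Function.iterate_zero, id] at this
    simp [this]
  intro x
  obtain ⟨y, i, hi, rfl⟩ : ∃ y i, i < r y ∧ π^[i] (base y) = x := ⟨_, _, hidx1 x, hidx2 x⟩
  have hnext : π (π^[i] (base y)) = π^[i + 1] (base y) := (Function.iterate_succ_apply' _ _ _).symm
  have hz : ∀ h : i + 1 < r y, π^[i + 1] (base y) ≠ base y := fun h h' => by
    have := huniq y (i + 1) 0 h (hper y) h'
    omega
  have hz' : i + 1 = r y → π^[i + 1] (base y) = base y := fun h => by
    rw [h]; exact Function.iterate_minimalPeriod
  have hsum : (∑ j ∈ Finset.range i, w (π^[j] (base y))) + w (π^[i] (base y))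
      = ∑ j ∈ Finset.range (i + 1), w (π^[j] (base y)) := (Finset.sum_range_succ _ _).symm
  simp only [hq', hidx3 y i hi, hnext, hsum]
  constructor
  · intro h
    have hi' : i + 1 = r y := by
      by_contra h'
      exact hz (by omega) h
    rw [hi']
    have hset : {x' | q x' = y}
        = ((Finset.range (r y)).image fun j => π^[j] (base y) : Finset X) := by
      ext x'
      simp only [Set.mem_ofPred_eq, Finset.coe_image, Finset.coe_range, Set.mem_image, Set.mem_Iio]
      constructor
      · rintro rfl
        exact ⟨_, hidx1 x', hidx2 x'⟩
      · rintro ⟨j, _, rfl⟩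
        exact hq' j y
    have : (∑ᶠ (x' : X) (_ : q x' = y), w x') = ∑ᶠ (x' : X) (_ : x' ∈ {x' | q x' = y}), w x' := rfl
    rw [this, hset, finsum_mem_coe_finset, Finset.sum_image]
    intro j hj k hk hjk
    exact huniq y j k (Finset.mem_range.1 hj) (Finset.mem_range.1 hk) hjk
  · intro h
    have hi' : i + 1 < r y := by
      by_contra h'
      exact h (hz' (by omega))
    rw [hidx3 y _ hi']

/-! ### The flow through a graph, and gluing data for splicing -/

namespace StrandGraph

variable {I O : Type}

/-- The gluing rules of the flow through a graph. -/
inductive FlowRule (G : StrandGraph I O) (z : G.Strands → ℤ) :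
    G.Strands → List Bool → ℤ → G.Strands → List Bool → Prop
  | split {s b a c} (ha : G.head a = .split s) (hc : G.tail c = .split s b) :
      FlowRule G z (Sum.inl a) [b] (z (Sum.inl a)) (Sum.inl c) []
  | merge {m b a c} (ha : G.head a = .merge m b) (hc : G.tail c = .merge m) :
      FlowRule G z (Sum.inl a) [] (z (Sum.inl a)) (Sum.inl c) [b]
  | loop (l) : FlowRule G z (Sum.inr l) [] (z (Sum.inr l)) (Sum.inr l) []

abbrev flow (G : StrandGraph I O) (z : G.Strands → ℤ) : Presentation where
  Index := G.Strands
  rule := G.FlowRule z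

/-- The gluing rules of the flow through the strands that remain when some vertices and strands
are erased and remaining strands are linked. -/
inductive PartRule (G : StrandGraph I O) (S₀ : Set G.Split) (M₀ : Set G.Merge)
    (X₀ : Set G.Strands) (link : G.Edge → G.Edge → Prop) (w : G.Strands → ℤ) :
    {x : G.Strands // x ∉ X₀} → List Bool → ℤ → {x : G.Strands // x ∉ X₀} → List Bool → Prop
  | split {s b a c} (hs : s ∉ S₀) (ha : G.head a = .split s) (hc : G.tail c = .split s b)
      (ha' : Sum.inl a ∉ X₀) (hc' : Sum.inl c ∉ X₀) :
      PartRule G S₀ M₀ X₀ link w ⟨Sum.inl a, ha'⟩ [b] (w (Sum.inl a)) ⟨Sum.inl c, hc'⟩ []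
  | merge {m b a c} (hm : m ∉ M₀) (ha : G.head a = .merge m b) (hc : G.tail c = .merge m)
      (ha' : Sum.inl a ∉ X₀) (hc' : Sum.inl c ∉ X₀) :
      PartRule G S₀ M₀ X₀ link w ⟨Sum.inl a, ha'⟩ [] (w (Sum.inl a)) ⟨Sum.inl c, hc'⟩ [b]
  | loop (l) (hl : Sum.inr l ∉ X₀) :
      PartRule G S₀ M₀ X₀ link w ⟨Sum.inr l, hl⟩ [] (w (Sum.inr l)) ⟨Sum.inr l, hl⟩ []
  | link {a c} (h : link a c) (ha' : Sum.inl a ∉ X₀) (hc' : Sum.inl c ∉ X₀) :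
      PartRule G S₀ M₀ X₀ link w ⟨Sum.inl a, ha'⟩ [] (w (Sum.inl a)) ⟨Sum.inl c, hc'⟩ []

abbrev partFlow (G : StrandGraph I O) (S₀ : Set G.Split) (M₀ : Set G.Merge)
    (X₀ : Set G.Strands) (link : G.Edge → G.Edge → Prop) (w : G.Strands → ℤ) : Presentation where
  Index := {x : G.Strands // x ∉ X₀}
  rule := G.PartRule S₀ M₀ X₀ link w

/-- The edge `a` starts at a vertex that is not erased. -/
def KeptTail (G : StrandGraph I O) (S₀ : Set G.Split) (M₀ : Set G.Merge) (a : G.Edge) : Prop :=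
  ∃ t : Tail Empty {s // s ∉ S₀} {m // m ∉ M₀},
    G.tail a = t.map Empty.elim Subtype.val Subtype.val

/-- The edge `a` ends at a vertex that is not erased. -/
def KeptHead (G : StrandGraph I O) (S₀ : Set G.Split) (M₀ : Set G.Merge) (a : G.Edge) : Prop :=
  ∃ h : Head Empty {s // s ∉ S₀} {m // m ∉ M₀},
    G.head a = h.map Empty.elim Subtype.val Subtype.val

/-- The links match the remaining edges that end at erased vertices with the remaining edges that
start at erased vertices. -/
structure IsGluing (G : StrandGraph I O) (S₀ : Set G.Split) (M₀ : Set G.Merge)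
    (X₀ : Set G.Strands) (link : G.Edge → G.Edge → Prop) : Prop where
  not_keptTail : ∀ a, Sum.inl a ∈ X₀ → ¬ G.KeptTail S₀ M₀ a
  not_keptHead : ∀ a, Sum.inl a ∈ X₀ → ¬ G.KeptHead S₀ M₀ a
  left_not_mem : ∀ a b, link a b → Sum.inl a ∉ X₀
  right_not_mem : ∀ a b, link a b → Sum.inl b ∉ X₀
  left_not_kept : ∀ a b, link a b → ¬ G.KeptHead S₀ M₀ a
  right_not_kept : ∀ a b, link a b → ¬ G.KeptTail S₀ M₀ b
  exists_right : ∀ a, Sum.inl a ∉ X₀ → ¬ G.KeptHead S₀ M₀ a → ∃ b, link a b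
  exists_left : ∀ b, Sum.inl b ∉ X₀ → ¬ G.KeptTail S₀ M₀ b → ∃ a, link a b
  right_unique : ∀ a b b', link a b → link a b' → b = b'
  left_unique : ∀ a a' b, link a b → link a' b → a = a'

/-- An edge is determined by its starting place, of which there are finitely many once the sources
are finite in number. -/
theorem finite_edge (G : StrandGraph I O) [Finite I] : Finite G.Edge := by
  have := G.finite_split
  have := G.finite_merge
  have : Function.Injective
      (fun t : Tail I G.Split G.Merge => match t with
        | .source i => (Sum.inl i : I ⊕ (G.Split × Bool) ⊕ G.Merge)
        | .split s b => Sum.inr (Sum.inl (s, b))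
        | .merge m => Sum.inr (Sum.inr m)) := by
    rintro (i | ⟨s, b⟩ | m) (i' | ⟨s', b'⟩ | m') h <;> simp_all
  have := Finite.of_injective _ this
  exact Finite.of_equiv _ G.tail.symm

theorem finite_strands (G : StrandGraph I O) [Finite I] : Finite G.Strands := by
  have := G.finite_edge
  have := G.finite_loop
  infer_instance

end StrandGraph

theorem Tail.map_map {I I' I'' S S' S'' M M' M'' : Type} (i : I' → I) (σ : S' → S) (μ : M' → M)
    (i' : I'' → I') (σ' : S'' → S') (μ' : M'' → M') (t : Tail I'' S'' M'') :
    (t.map i' σ' μ').map i σ μ = t.map (i ∘ i') (σ ∘ σ') (μ ∘ μ') := by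
  cases t <;> rfl

theorem Head.map_map {O O' O'' S S' S'' M M' M'' : Type} (i : O' → O) (σ : S' → S) (μ : M' → M)
    (i' : O'' → O') (σ' : S'' → S') (μ' : M'' → M') (t : Head O'' S'' M'') :
    (t.map i' σ' μ').map i σ μ = t.map (i ∘ i') (σ ∘ σ') (μ ∘ μ') := by
  cases t <;> rfl

theorem Tail.map_injective {I I' S S' M M' : Type} {i : I' → I} {σ : S' → S} {μ : M' → M}
    (hi : Function.Injective i) (hσ : Function.Injective σ) (hμ : Function.Injective μ) :
    Function.Injective (Tail.map i σ μ) := by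
  rintro (x | ⟨s, b⟩ | m) (x' | ⟨s', b'⟩ | m') h <;> simp_all [Tail.map, hi.eq_iff, hσ.eq_iff,
    hμ.eq_iff]

theorem Head.map_injective {O O' S S' M M' : Type} {i : O' → O} {σ : S' → S} {μ : M' → M}
    (hi : Function.Injective i) (hσ : Function.Injective σ) (hμ : Function.Injective μ) :
    Function.Injective (Head.map i σ μ) := by
  rintro (x | s | ⟨m, b⟩) (x' | s' | ⟨m', b'⟩) h <;> simp_all [Head.map, hi.eq_iff, hσ.eq_iff,
    hμ.eq_iff]

/-! ### First and last parts of the edges of a spliced graph -/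

namespace Splicing

variable {I O : Type} {G : StrandGraph I O} {G' : StrandGraph Empty Empty}
    {S₀ : Set G.Split} {M₀ : Set G.Merge} {X₀ : Set G.Strands} {link : G.Edge → G.Edge → Prop}
    (P : Splicing G G' S₀ M₀ X₀ link)

/-- The first part of an edge of the spliced graph. -/
def first (e : G'.Edge) : G.Edge :=
  G.tail.symm ((G'.tail e).map Empty.elim (fun s => (P.σ s).1) (fun m => (P.μ m).1))

/-- The last part of an edge of the spliced graph. -/
def last (e : G'.Edge) : G.Edge :=
  G.head.symm ((G'.head e).map Empty.elim (fun s => (P.σ s).1) (fun m => (P.μ m).1))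

theorem tail_first (e : G'.Edge) : G.tail (P.first e) =
    (G'.tail e).map Empty.elim (fun s => (P.σ s).1) (fun m => (P.μ m).1) := by
  simp [first]

theorem head_last (e : G'.Edge) : G.head (P.last e) =
    (G'.head e).map Empty.elim (fun s => (P.σ s).1) (fun m => (P.μ m).1) := by
  simp [last]

theorem keptTail_first (e : G'.Edge) : G.KeptTail S₀ M₀ (P.first e) := by
  refine ⟨(G'.tail e).map Empty.elim P.σ P.μ, ?_⟩
  rw [tail_first, Tail.map_map]
  congr
  exact funext fun x => x.elim

theorem keptHead_last (e : G'.Edge) : G.KeptHead S₀ M₀ (P.last e) := by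
  refine ⟨(G'.head e).map Empty.elim P.σ P.μ, ?_⟩
  rw [head_last, Head.map_map]
  congr
  exact funext fun x => x.elim

theorem exists_first {a : G.Edge} (ha : G.KeptTail S₀ M₀ a) : ∃ e, P.first e = a := by
  obtain ⟨t, ht⟩ := ha
  refine ⟨G'.tail.symm (t.map Empty.elim P.σ.symm P.μ.symm), ?_⟩
  apply G.tail.injective
  rw [tail_first, Equiv.apply_symm_apply, ht, Tail.map_map]
  congr 1
  · exact funext fun x => x.elim
  · funext s; simp
  · funext s; simp

theorem exists_last {a : G.Edge} (ha : G.KeptHead S₀ M₀ a) : ∃ e, P.last e = a := by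
  obtain ⟨t, ht⟩ := ha
  refine ⟨G'.head.symm (t.map Empty.elim P.σ.symm P.μ.symm), ?_⟩
  apply G.head.injective
  rw [head_last, Equiv.apply_symm_apply, ht, Head.map_map]
  congr 1
  · exact funext fun x => x.elim
  · funext s; simp
  · funext s; simp

theorem first_injective : Function.Injective P.first := by
  intro e e' h
  have := congrArg G.tail h
  rw [tail_first, tail_first] at this
  refine G'.tail.injective (Tail.map_injective ?_ ?_ ?_ this)
  · exact fun x => x.elim
  · exact Subtype.val_injective.comp P.σ.injective
  · exact Subtype.val_injective.comp P.μ.injective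

theorem last_injective : Function.Injective P.last := by
  intro e e' h
  have := congrArg G.head h
  rw [head_last, head_last] at this
  refine G'.head.injective (Head.map_injective ?_ ?_ ?_ this)
  · exact fun x => x.elim
  · exact Subtype.val_injective.comp P.σ.injective
  · exact Subtype.val_injective.comp P.μ.injective

variable {P}

theorem first_not_mem (hL : G.IsGluing S₀ M₀ X₀ link) (e : G'.Edge) : Sum.inl (P.first e) ∉ X₀ :=
  fun h => hL.not_keptTail _ h (P.keptTail_first e)

theorem last_not_mem (hL : G.IsGluing S₀ M₀ X₀ link) (e : G'.Edge) : Sum.inl (P.last e) ∉ X₀ :=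
  fun h => hL.not_keptHead _ h (P.keptHead_last e)

theorem q_first (hL : G.IsGluing S₀ M₀ X₀ link) (e : G'.Edge) :
    P.q ⟨Sum.inl (P.first e), first_not_mem hL e⟩ = Sum.inl e := by
  rw [P.q_tail (G'.tail e) _ _ (P.tail_first e), Equiv.symm_apply_apply]

theorem q_last (hL : G.IsGluing S₀ M₀ X₀ link) (e : G'.Edge) :
    P.q ⟨Sum.inl (P.last e), last_not_mem hL e⟩ = Sum.inl e := by
  rw [P.q_head (G'.head e) _ _ (P.head_last e), Equiv.symm_apply_apply]

end Splicing

/-! ### Invariance of the flow space under splicing -/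

namespace Splicing

variable {I O : Type} {G : StrandGraph I O} {G' : StrandGraph Empty Empty}
    {S₀ : Set G.Split} {M₀ : Set G.Merge} {X₀ : Set G.Strands} {link : G.Edge → G.Edge → Prop}
    {P : Splicing G G' S₀ M₀ X₀ link}

/-- The permutation of the parts that moves each part to the next part of its strand, and the last
part of an edge to its first part. -/
theorem exists_perm [Finite I] (hL : G.IsGluing S₀ M₀ X₀ link) :
    ∃ π : Equiv.Perm {x : G.Strands // x ∉ X₀},
      (∀ a b (ha : Sum.inl a ∉ X₀) (hb : Sum.inl b ∉ X₀), link a b →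
        π ⟨Sum.inl a, ha⟩ = ⟨Sum.inl b, hb⟩) ∧
      (∀ e, π ⟨Sum.inl (P.last e), last_not_mem hL e⟩
        = ⟨Sum.inl (P.first e), first_not_mem hL e⟩) ∧
      (∀ l (hl : Sum.inr l ∉ X₀), π ⟨Sum.inr l, hl⟩ = ⟨Sum.inr l, hl⟩) ∧
      ∀ x y, P.q x = P.q y ↔ π.SameCycle x y := by
  have := G.finite_strands
  -- The links alone form only a partial injection. Closing each chain by sending the last part of
  -- an edge back to the first makes the relation total, and an injective self-map of a finite set
  -- is a permutation.
  let R : {x : G.Strands // x ∉ X₀} → {x : G.Strands // x ∉ X₀} → Prop := fun x y =>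
    (∃ a b, x.1 = Sum.inl a ∧ y.1 = Sum.inl b ∧ link a b) ∨
    (∃ e, x.1 = Sum.inl (P.last e) ∧ y.1 = Sum.inl (P.first e)) ∨ (∃ l, x.1 = Sum.inr l ∧ y = x)
  have htot : ∀ x, ∃ y, R x y := by
    rintro ⟨a | l, hx⟩
    · by_cases hk : G.KeptHead S₀ M₀ a
      · obtain ⟨e, rfl⟩ := P.exists_last hk
        exact ⟨⟨_, first_not_mem hL e⟩, Or.inr (Or.inl ⟨e, rfl, rfl⟩)⟩
      · obtain ⟨b, hb⟩ := hL.exists_right a hx hk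
        exact ⟨⟨_, hL.right_not_mem a b hb⟩, Or.inl ⟨a, b, rfl, rfl, hb⟩⟩
    · exact ⟨_, Or.inr (Or.inr ⟨l, rfl, rfl⟩)⟩
  have hru : ∀ x y y', R x y → R x y' → y = y' := by
    rintro ⟨x, hx⟩ ⟨y, hy⟩ ⟨y', hy'⟩ h h'
    rcases h with ⟨a, b, rfl, rfl, h⟩ | ⟨e, rfl, rfl⟩ | ⟨l, h1, h2⟩ <;>
      rcases h' with ⟨a', b', h1', h2', h'⟩ | ⟨e', h1', h2'⟩ | ⟨l', h1', h2'⟩ <;>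
      simp only [Subtype.mk.injEq] at * <;> subst_vars <;>
      simp only [Sum.inl.injEq, reduceCtorEq] at * <;> subst_vars
    · exact hL.right_unique _ _ _ h h'
    · exact absurd (P.keptHead_last e') (hL.left_not_kept _ _ h)
    · exact absurd (P.keptHead_last e) (hL.left_not_kept _ _ h')
    · rw [P.last_injective h1']
  have hlu : ∀ x x' y, R x y → R x' y → x = x' := by
    rintro ⟨x, hx⟩ ⟨x', hx'⟩ ⟨y, hy⟩ h h'
    rcases h with ⟨a, b, rfl, rfl, h⟩ | ⟨e, rfl, rfl⟩ | ⟨l, h1, h2⟩ <;>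
      rcases h' with ⟨a', b', h1', h2', h'⟩ | ⟨e', h1', h2'⟩ | ⟨l', h1', h2'⟩ <;>
      simp only [Subtype.mk.injEq] at * <;> subst_vars <;>
      (try simp only [Sum.inl.injEq, reduceCtorEq] at *) <;> subst_vars
    · exact hL.left_unique _ _ _ h h'
    · exact absurd (P.keptTail_first e') (hL.right_not_kept _ _ h)
    · exact absurd (P.keptTail_first e) (hL.right_not_kept _ _ h')
    · rw [P.first_injective h2']
    · exact h2'
  choose f hf using htot
  have hfi : Function.Injective f := fun x x' h => hlu x x' (f x) (hf x) (h ▸ hf x')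
  let π := Equiv.ofBijective f ⟨hfi, Finite.injective_iff_surjective.1 hfi⟩
  have hπ : ∀ x y, R x y → π x = y := fun x y h => hru x _ _ (hf x) h
  have hqπ : ∀ x, P.q (π x) = P.q x := by
    intro x
    rcases hf x with h | ⟨e, h1, h2⟩ | ⟨l, h1, h2⟩
    · exact ((P.q_eq_iff _ _).2 (.rel _ _ h)).symm
    · have e1 : x = ⟨_, last_not_mem hL e⟩ := Subtype.ext h1
      have e2 : π x = ⟨_, first_not_mem hL e⟩ := Subtype.ext h2
      rw [e2, e1, q_first hL, q_last hL]
    · exact congrArg _ h2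
  refine ⟨π, fun a b ha hb h => hπ _ _ (Or.inl ⟨a, b, rfl, rfl, h⟩),
    fun e => hπ _ _ (Or.inr (Or.inl ⟨e, rfl, rfl⟩)),
    fun l hl => hπ _ _ (Or.inr (Or.inr ⟨l, rfl, rfl⟩)), fun x y => ⟨fun h => ?_, ?_⟩⟩
  · rw [P.q_eq_iff] at h
    induction h with
    | rel x y h => exact ⟨1, by simpa using hπ _ _ (Or.inl h)⟩
    | refl x => exact .refl _ _
    | symm x y _ ih => exact ih.symm
    | trans x y z _ _ ih ih' => exact ih.trans ih'
  · rintro ⟨n, rfl⟩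
    have := map_zpow_of_map π (1 : Equiv.Perm G'.Strands) P.q (by simpa using hqπ) n x
    simpa using this.symm

/-- The base point of a strand of the spliced graph: the first part of an edge, and some part of a
free loop. -/
theorem exists_base [Finite I] (hL : G.IsGluing S₀ M₀ X₀ link) :
    ∃ base : G'.Strands → {x : G.Strands // x ∉ X₀},
      (∀ e, base (Sum.inl e) = ⟨Sum.inl (P.first e), first_not_mem hL e⟩) ∧
      ∀ y, P.q (base y) = y := by
  choose f hf using P.q_surjective
  exact ⟨Sum.elim (fun e => ⟨Sum.inl (P.first e), first_not_mem hL e⟩) (fun l => f (Sum.inr l)),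
    fun e => rfl, fun y => by rcases y with e | l <;> simp [q_first hL, hf]⟩

/-- Splicing does not change the space of the flow. -/
theorem isom_space [Finite I] (P : Splicing G G' S₀ M₀ X₀ link)
    (hL : G.IsGluing S₀ M₀ X₀ link) (w : G.Strands → ℤ) :
    VSpace.Isom (G.partFlow S₀ M₀ X₀ link w).space (G'.flow (P.push w)).space := by
  have := G.finite_strands
  obtain ⟨π, hπlink, hπlast, hπloop, hπq⟩ := exists_perm (P := P) hL
  obtain ⟨base, hbase, hqbase⟩ := exists_base (P := P) hL
  obtain ⟨o, ho, ho'⟩ := exists_offset π P.q base hπq hqbase (fun x => w x.1)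
  have hlast : ∀ e, o ⟨Sum.inl (P.last e), last_not_mem hL e⟩ + w (Sum.inl (P.last e))
      = P.push w (Sum.inl e) := by
    intro e
    have := (ho' ⟨Sum.inl (P.last e), last_not_mem hL e⟩).1 (by rw [hπlast, q_last hL, hbase])
    rw [q_last hL] at this
    exact this
  have hfirst : ∀ e, o ⟨Sum.inl (P.first e), first_not_mem hL e⟩ = 0 := by
    intro e
    rw [← hbase, ho]
  -- the maps in the two directions
  set A := G.partFlow S₀ M₀ X₀ link w
  set B := G'.flow (P.push w)
  -- A part is the chart of its strand, delayed by the weight of the parts that precede it.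
  -- Conversely a strand is represented by its base part.
  let φ : A.Index → Stream' Bool → B.space.Point :=
    fun x t => (B.space.T ^ o x) (B.space.chart (P.q x) t)
  let ψ : B.Index → Stream' Bool → A.space.Point := fun y => A.space.chart (base y)
  have hqπ : ∀ x, P.q (π x) = P.q x := fun x =>
    (hπq _ _).2 (Equiv.Perm.sameCycle_apply_left.2 (.refl _ _))
  -- Every part except the last part of an edge is followed by a link rule or a free loop rule,
  -- which glues its translate to the next part without changing the word.
  have hstep : ∀ (x : A.Index) (t : Stream' Bool),
      (∀ e, x ≠ ⟨Sum.inl (P.last e), last_not_mem hL e⟩) →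
      (A.space.T ^ w x.1) (A.space.chart x t) = A.space.chart (π x) t := by
    rintro ⟨a | l, hx⟩ t hx'
    · by_cases hk : G.KeptHead S₀ M₀ a
      · obtain ⟨e, rfl⟩ := P.exists_last hk
        exact absurd rfl (hx' e)
      · obtain ⟨c, hc⟩ := hL.exists_right a hx hk
        rw [hπlink a c hx (hL.right_not_mem _ _ hc) hc]
        simpa using Presentation.isModel_chart (P := A) _ _ _ _ _
          (StrandGraph.PartRule.link hc hx (hL.right_not_mem _ _ hc)) t
    · rw [hπloop]
      simpa using Presentation.isModel_chart (P := A) _ _ _ _ _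
          (StrandGraph.PartRule.loop l hx) t
  have hstep' : ∀ (x : A.Index) (t : Stream' Bool),
      (∀ e, π x ≠ ⟨Sum.inl (P.first e), first_not_mem hL e⟩) →
      (B.space.T ^ w x.1) (φ x t) = φ (π x) t := by
    intro x t hx
    change (B.space.T ^ _) ((B.space.T ^ _) _) = (B.space.T ^ _) _
    rw [← zpow_add_apply, add_comm, hqπ]
    by_cases hb : π x = base (P.q x)
    · rw [(ho' x).1 hb, hb, ho]
      rcases hq : P.q x with e | l
      · rw [hq, hbase] at hb
        exact absurd hb (hx e)
      · rw [zpow_zero]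
        refine Eq.trans ?_
          (Presentation.isModel_chart (P := B) _ _ _ _ _ (StrandGraph.FlowRule.loop l) t)
        rfl
    · rw [(ho' x).2 hb]
  -- Walking along a strand from its base part accumulates exactly the offset, so all parts are
  -- translates of the base part.
  have key : ∀ y (t : Stream' Bool) (n : ℕ), A.space.chart ((π ^ n) (base y)) t
      = (A.space.T ^ o ((π ^ n) (base y))) (A.space.chart (base y) t) := by
    intro y t n
    induction n with
    | zero => simp [ho]
    | succ n ih =>
      rw [pow_succ', Equiv.Perm.mul_apply]
      set x := (π ^ n) (base y) with hx
      have hqx : P.q x = y := by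
        conv_rhs => rw [← hqbase y]
        rw [hπq]
        exact (Equiv.Perm.SameCycle.refl π (base y)).pow_left
      by_cases hb : π x = base (P.q x)
      · rw [hb, hqx, ho]; simp
      rw [(ho' x).2 hb, add_comm, zpow_add_apply, ← ih, hstep]
      rintro e he
      exact hb (by rw [he, hπlast, q_last hL, hbase])
  have key' : ∀ (x : A.Index) (t : Stream' Bool), A.space.chart x t
      = (A.space.T ^ o x) (A.space.chart (base (P.q x)) t) := by
    intro x t
    obtain ⟨n, hn⟩ := ((hπq (base (P.q x)) x).1 (hqbase _)).exists_nat_pow_eq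
    have := key (P.q x) t n
    rwa [hn] at this
  refine Presentation.isom_of_models φ ψ ?_ ?_ ?_ ?_ ?_ ?_
  · intro x u k y v h t
    cases h with
    | @split s b a c hs ha hc ha' hc' =>
      obtain ⟨e, rfl⟩ := P.exists_last (a := a) ⟨.split ⟨s, hs⟩, ha⟩
      obtain ⟨e', rfl⟩ := P.exists_first (a := c) ⟨.split ⟨s, hs⟩ b, hc⟩
      change (B.space.T ^ _) ((B.space.T ^ _) _) = (B.space.T ^ _) _
      rw [← zpow_add_apply, add_comm, hlast, q_last hL, q_first hL, hfirst, zpow_zero]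
      rw [P.head_last] at ha
      rw [P.tail_first] at hc
      refine Presentation.isModel_chart (P := B) _ _ _ _ _ (.split (s := P.σ.symm ⟨s, hs⟩) ?_ ?_) t
      · generalize G'.head e = h at ha ⊢
        rcases h with h | s' | ⟨m', b'⟩
        · exact h.elim
        · simp only [Head.map, Head.split.injEq] at ha ⊢
          rw [Equiv.eq_symm_apply]
          exact Subtype.ext ha
        · cases ha
      · generalize G'.tail e' = h at hc ⊢
        rcases h with h | ⟨s', b'⟩ | m'
        · exact h.elim
        · simp only [Tail.map, Tail.split.injEq] at hc ⊢
          rw [Equiv.eq_symm_apply]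
          exact ⟨Subtype.ext hc.1, hc.2⟩
        · cases hc
    | @merge m b a c hs ha hc ha' hc' =>
      obtain ⟨e, rfl⟩ := P.exists_last (a := a) ⟨.merge ⟨m, hs⟩ b, ha⟩
      obtain ⟨e', rfl⟩ := P.exists_first (a := c) ⟨.merge ⟨m, hs⟩, hc⟩
      change (B.space.T ^ _) ((B.space.T ^ _) _) = (B.space.T ^ _) _
      rw [← zpow_add_apply, add_comm, hlast, q_last hL, q_first hL, hfirst, zpow_zero]
      rw [P.head_last] at ha
      rw [P.tail_first] at hc
      refine Presentation.isModel_chart (P := B) _ _ _ _ _ (.merge (m := P.μ.symm ⟨m, hs⟩) ?_ ?_) t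
      · generalize G'.head e = h at ha ⊢
        rcases h with h | s' | ⟨m', b'⟩
        · exact h.elim
        · cases ha
        · simp only [Head.map, Head.merge.injEq] at ha ⊢
          rw [Equiv.eq_symm_apply]
          exact ⟨Subtype.ext ha.1, ha.2⟩
      · generalize G'.tail e' = h at hc ⊢
        rcases h with h | ⟨s', b'⟩ | m'
        · exact h.elim
        · cases hc
        · simp only [Tail.map, Tail.merge.injEq] at hc ⊢
          rw [Equiv.eq_symm_apply]
          exact Subtype.ext hc
    | loop l hl =>
      have := hstep' ⟨Sum.inr l, hl⟩ t (by rw [hπloop]; simp)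
      rwa [hπloop] at this
    | @link a c h ha' hc' =>
      have := hstep' ⟨Sum.inl a, ha'⟩ t (by
        rw [hπlink a c ha' hc' h]
        intro e he
        refine hL.right_not_kept _ _ h ?_
        rw [Sum.inl_injective (congrArg Subtype.val he)]
        exact P.keptTail_first e)
      rwa [hπlink a c ha' hc' h] at this
  · have hedge : ∀ e (t : Stream' Bool), (A.space.T ^ P.push w (Sum.inl e)) (ψ (Sum.inl e) t)
        = (A.space.T ^ w (Sum.inl (P.last e))) (A.space.chart ⟨Sum.inl (P.last e), last_not_mem hL e⟩ t) := by
      intro e t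
      rw [key', q_last hL, ← zpow_add_apply, add_comm (w _), hlast]
    have hψ : ∀ e t, ψ (Sum.inl e) t = A.space.chart ⟨Sum.inl (P.first e), first_not_mem hL e⟩ t := fun e t => by
      change A.space.chart (base _) t = _
      rw [hbase]
    intro x u k y v h t
    cases h with
    | @split s b a c ha hc =>
      rw [hedge, hψ]
      exact Presentation.isModel_chart (P := A) _ _ _ _ _
        (.split (s := (P.σ s).1) (P.σ s).2 (by rw [head_last, ha]; rfl)
          (by rw [tail_first, hc]; rfl) _ _) t
    | @merge m b a c ha hc =>
      rw [hedge, hψ]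
      exact Presentation.isModel_chart (P := A) _ _ _ _ _
        (.merge (m := (P.μ m).1) (P.μ m).2 (by rw [head_last, ha]; rfl)
          (by rw [tail_first, hc]; rfl) _ _) t
    | loop l =>
      -- The part just before the base part closes the loop; its offset plus its own weight is the
      -- total weight of the loop.
      obtain ⟨x, hx⟩ := π.surjective (base (Sum.inr l))
      have hqx : P.q x = Sum.inr l := by rw [← hqπ, hx, hqbase]
      have h1 := (ho' x).1 (by rw [hx, hqx])
      have h2 := hstep x t (by
        rintro e rfl
        rw [q_last hL] at hqx
        cases hqx)
      rw [key', ← zpow_add_apply, add_comm, h1, hqx, hx] at h2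
      exact h2
  · exact fun x => VSpace.isLocal_zpow_chart _ _
  · exact fun x => VSpace.isLocal_chart _
  · intro f hf y t
    change f.toFun (A.space.chart (base y) t) = _
    rw [hf]
    change (B.space.T ^ _) _ = _
    rw [ho, hqbase, zpow_zero]
    rfl
  · intro f hf x t
    change f.toFun ((B.space.T ^ _) _) = _
    rw [VSpace.Hom.map_zpow, hf, key']

end Splicing

/-! ### Gluing data of the three reductions, and the rules in terms of charts -/

namespace StrandGraph

variable {I O : Type} {G : StrandGraph I O}

theorem keptTail_iff {S₀ : Set G.Split} {M₀ : Set G.Merge} {a : G.Edge} :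
    G.KeptTail S₀ M₀ a ↔ (∃ s b, s ∉ S₀ ∧ G.tail a = .split s b) ∨
      ∃ m, m ∉ M₀ ∧ G.tail a = .merge m := by
  constructor
  · rintro ⟨i | ⟨s, b⟩ | m, h⟩
    · exact i.elim
    · exact Or.inl ⟨s, b, s.2, h⟩
    · exact Or.inr ⟨m, m.2, h⟩
  · rintro (⟨s, b, hs, h⟩ | ⟨m, hm, h⟩)
    · exact ⟨.split ⟨s, hs⟩ b, h⟩
    · exact ⟨.merge ⟨m, hm⟩, h⟩

theorem keptHead_iff {S₀ : Set G.Split} {M₀ : Set G.Merge} {a : G.Edge} :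
    G.KeptHead S₀ M₀ a ↔ (∃ s, s ∉ S₀ ∧ G.head a = .split s) ∨
      ∃ m b, m ∉ M₀ ∧ G.head a = .merge m b := by
  constructor
  · rintro ⟨i | s | ⟨m, b⟩, h⟩
    · exact i.elim
    · exact Or.inl ⟨s, s.2, h⟩
    · exact Or.inr ⟨m, b, m.2, h⟩
  · rintro (⟨s, hs, h⟩ | ⟨m, b, hm, h⟩)
    · exact ⟨.split ⟨s, hs⟩, h⟩
    · exact ⟨.merge ⟨m, hm⟩ b, h⟩

theorem eq_of_head {a b : G.Edge} {h : Head O G.Split G.Merge} (ha : G.head a = h)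
    (hb : G.head b = h) : a = b := G.head.injective (ha.trans hb.symm)

theorem eq_of_tail {a b : G.Edge} {h : Tail I G.Split G.Merge} (ha : G.tail a = h)
    (hb : G.tail b = h) : a = b := G.tail.injective (ha.trans hb.symm)

section closed

variable {G : StrandGraph Empty Empty}

/-- Since `e` is both the only output of `m` and the only input of `s`, the remaining loose ends are
the two inputs of `m` and the two outputs of `s`, and these are matched by side. -/
theorem isGluing_I {m : G.Merge} {s : G.Split} {e : G.Edge} (he : G.tail e = .merge m)
    (he' : G.head e = .split s) :
    G.IsGluing {s} {m} {Sum.inl e}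
      (fun a b => ∃ k : Bool, G.head a = .merge m k ∧ G.tail b = .split s k) where
  not_keptTail := by
    rintro a ha
    simp only [Set.mem_singleton_iff, Sum.inl.injEq] at ha
    subst ha
    rw [keptTail_iff, he]
    simp
  not_keptHead := by
    rintro a ha
    simp only [Set.mem_singleton_iff, Sum.inl.injEq] at ha
    subst ha
    rw [keptHead_iff, he']
    simp
  left_not_mem := by
    rintro a b ⟨k, h, h'⟩ ha
    simp only [Set.mem_singleton_iff, Sum.inl.injEq] at ha
    subst ha
    simp [he'] at h
  right_not_mem := by
    rintro a b ⟨k, h, h'⟩ ha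
    simp only [Set.mem_singleton_iff, Sum.inl.injEq] at ha
    subst ha
    simp [he] at h'
  left_not_kept := by
    rintro a b ⟨k, h, h'⟩
    rw [keptHead_iff, h]
    simp
  right_not_kept := by
    rintro a b ⟨k, h, h'⟩
    rw [keptTail_iff, h']
    simp
  exists_right := by
    intro a ha h
    simp only [keptHead_iff, Set.mem_singleton_iff, Sum.inl.injEq] at ha h
    rcases hh : G.head a with i | s' | ⟨m', k⟩
    · exact i.elim
    · by_cases hs : s' = s
      · subst hs
        exact absurd (eq_of_head hh he') ha
      · exact absurd (Or.inl ⟨s', hs, hh⟩) h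
    · by_cases hm : m' = m
      · subst hm
        exact ⟨G.tail.symm (.split s k), k, rfl, by simp⟩
      · exact absurd (Or.inr ⟨m', k, hm, hh⟩) h
  exists_left := by
    intro a ha h
    simp only [keptTail_iff, Set.mem_singleton_iff, Sum.inl.injEq] at ha h
    rcases hh : G.tail a with i | ⟨s', k⟩ | m'
    · exact i.elim
    · by_cases hs : s' = s
      · subst hs
        exact ⟨G.head.symm (.merge m k), k, by simp, rfl⟩
      · exact absurd (Or.inl ⟨s', k, hs, hh⟩) h
    · by_cases hm : m' = m
      · subst hm
        exact absurd (eq_of_tail hh he) ha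
      · exact absurd (Or.inr ⟨m', hm, hh⟩) h
  right_unique := by
    rintro a b b' ⟨k, h1, h2⟩ ⟨k', h1', h2'⟩
    rw [h1] at h1'
    obtain rfl : k = k' := by simpa using h1'
    exact eq_of_tail h2 h2'
  left_unique := by
    rintro a b b' ⟨k, h1, h2⟩ ⟨k', h1', h2'⟩
    rw [h2] at h2'
    obtain rfl : k = k' := by simpa using h2'
    exact eq_of_head h1 h1'

/-- Both inputs of `m` and both outputs of `s` are erased, so the only loose ends are the input of
`s` and the output of `m`. -/
theorem isGluing_II {m : G.Merge} {s : G.Split} {a b : G.Edge}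
    (ha : G.tail a = .split s false) (ha' : G.head a = .merge m false)
    (hb : G.tail b = .split s true) (hb' : G.head b = .merge m true) :
    G.IsGluing {s} {m} {Sum.inl a, Sum.inl b}
      (fun x y => G.head x = .split s ∧ G.tail y = .merge m) where
  not_keptTail := by
    rintro x hx
    simp only [Set.mem_insert_iff, Set.mem_singleton_iff, Sum.inl.injEq] at hx
    rw [keptTail_iff]
    rcases hx with rfl | rfl
    · simp [ha]
    · simp [hb]
  not_keptHead := by
    rintro x hx
    simp only [Set.mem_insert_iff, Set.mem_singleton_iff, Sum.inl.injEq] at hx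
    rw [keptHead_iff]
    rcases hx with rfl | rfl
    · simp [ha']
    · simp [hb']
  left_not_mem := by
    rintro x y ⟨h, h'⟩ hx
    simp only [Set.mem_insert_iff, Set.mem_singleton_iff, Sum.inl.injEq] at hx
    rcases hx with rfl | rfl
    · simp [ha'] at h
    · simp [hb'] at h
  right_not_mem := by
    rintro x y ⟨h, h'⟩ hx
    simp only [Set.mem_insert_iff, Set.mem_singleton_iff, Sum.inl.injEq] at hx
    rcases hx with rfl | rfl
    · simp [ha] at h'
    · simp [hb] at h'
  left_not_kept := by
    rintro x y ⟨h, h'⟩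
    rw [keptHead_iff, h]
    simp
  right_not_kept := by
    rintro x y ⟨h, h'⟩
    rw [keptTail_iff, h']
    simp
  exists_right := by
    intro x hx h
    simp only [keptHead_iff, Set.mem_insert_iff, Set.mem_singleton_iff, Sum.inl.injEq,
      not_or] at hx h
    rcases hh : G.head x with i | s' | ⟨m', k⟩
    · exact i.elim
    · by_cases hs : s' = s
      · subst hs
        exact ⟨G.tail.symm (.merge m), rfl, by simp⟩
      · exact absurd ⟨s', hs, hh⟩ h.1
    · by_cases hm : m' = m
      · subst hm
        cases k
        · exact absurd (eq_of_head hh ha') hx.1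
        · exact absurd (eq_of_head hh hb') hx.2
      · exact absurd ⟨m', k, hm, hh⟩ h.2
  exists_left := by
    intro x hx h
    simp only [keptTail_iff, Set.mem_insert_iff, Set.mem_singleton_iff, Sum.inl.injEq,
      not_or] at hx h
    rcases hh : G.tail x with i | ⟨s', k⟩ | m'
    · exact i.elim
    · by_cases hs : s' = s
      · subst hs
        cases k
        · exact absurd (eq_of_tail hh ha) hx.1
        · exact absurd (eq_of_tail hh hb) hx.2
      · exact absurd ⟨s', k, hs, hh⟩ h.1
    · by_cases hm : m' = m
      · subst hm
        exact ⟨G.head.symm (.split s), by simp, rfl⟩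
      · exact absurd ⟨m', hm, hh⟩ h.2
  right_unique := fun x y y' h h' => eq_of_tail h.2 h'.2
  left_unique := fun x x' y h h' => eq_of_head h.1 h'.1

theorem isGluing_III (l : G.Loop) :
    G.IsGluing ∅ ∅ {Sum.inr l} (fun _ _ => False) where
  not_keptTail := by simp
  not_keptHead := by simp
  left_not_mem := by simp
  right_not_mem := by simp
  left_not_kept := by simp
  right_not_kept := by simp
  exists_right := by
    intro a _ h
    rw [keptHead_iff] at h
    rcases hh : G.head a with i | s | ⟨m, k⟩
    · exact i.elim
    · simp [hh] at h
    · simp [hh] at h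
  exists_left := by
    intro a _ h
    rw [keptTail_iff] at h
    rcases hh : G.tail a with i | ⟨s, k⟩ | m
    · exact i.elim
    · simp [hh] at h
    · simp [hh] at h
  right_unique := by simp
  left_unique := by simp

open Presentation

theorem chart_split (z : G.Strands → ℤ) {s b a c} (ha : G.head a = .split s)
    (hc : G.tail c = .split s b) (t : Stream' Bool) :
    ((G.flow z).space.T ^ z (Sum.inl a)) ((G.flow z).space.chart (Sum.inl a) (Stream'.cons b t))
      = (G.flow z).space.chart (Sum.inl c) t :=
  isModel_chart (P := G.flow z) _ _ _ _ _ (.split ha hc) t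

theorem chart_merge (z : G.Strands → ℤ) {m b a c} (ha : G.head a = .merge m b)
    (hc : G.tail c = .merge m) (t : Stream' Bool) :
    ((G.flow z).space.T ^ z (Sum.inl a)) ((G.flow z).space.chart (Sum.inl a) t)
      = (G.flow z).space.chart (Sum.inl c) (Stream'.cons b t) :=
  isModel_chart (P := G.flow z) _ _ _ _ _ (.merge ha hc) t

theorem chart_loop (z : G.Strands → ℤ) (l : G.Loop) (t : Stream' Bool) :
    ((G.flow z).space.T ^ z (Sum.inr l)) ((G.flow z).space.chart (Sum.inr l) t)
      = (G.flow z).space.chart (Sum.inr l) t :=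
  isModel_chart (P := G.flow z) _ _ _ _ _ (.loop l) t

theorem isModel_flow (z : G.Strands → ℤ) {Y : Type} (T : Equiv.Perm Y)
    (φ : G.Strands → Stream' Bool → Y)
    (hs : ∀ s b a c, G.head a = .split s → G.tail c = .split s b → ∀ t,
      (T ^ z (Sum.inl a)) (φ (Sum.inl a) (Stream'.cons b t)) = φ (Sum.inl c) t)
    (hm : ∀ m b a c, G.head a = .merge m b → G.tail c = .merge m → ∀ t,
      (T ^ z (Sum.inl a)) (φ (Sum.inl a) t) = φ (Sum.inl c) (Stream'.cons b t))
    (hl : ∀ l t, (T ^ z (Sum.inr l)) (φ (Sum.inr l) t) = φ (Sum.inr l) t) :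
    (G.flow z).IsModel T φ := by
  intro x u k y v h t
  cases h with
  | split ha hc => exact hs _ _ _ _ ha hc t
  | merge ha hc => exact hm _ _ _ _ ha hc t
  | loop l => exact hl l t

end closed

theorem isModel_partFlow {S₀ : Set G.Split} {M₀ : Set G.Merge}
    {X₀ : Set G.Strands} {link : G.Edge → G.Edge → Prop} {w : G.Strands → ℤ}
    {Y : Type} (T : Equiv.Perm Y) (φ : {x : G.Strands // x ∉ X₀} → Stream' Bool → Y)
    (hs : ∀ s b a c ha' hc', s ∉ S₀ → G.head a = .split s → G.tail c = .split s b → ∀ t,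
      (T ^ w (Sum.inl a)) (φ ⟨Sum.inl a, ha'⟩ (Stream'.cons b t)) = φ ⟨Sum.inl c, hc'⟩ t)
    (hm : ∀ m b a c ha' hc', m ∉ M₀ → G.head a = .merge m b → G.tail c = .merge m → ∀ t,
      (T ^ w (Sum.inl a)) (φ ⟨Sum.inl a, ha'⟩ t) = φ ⟨Sum.inl c, hc'⟩ (Stream'.cons b t))
    (hl : ∀ l hl' t, (T ^ w (Sum.inr l)) (φ ⟨Sum.inr l, hl'⟩ t) = φ ⟨Sum.inr l, hl'⟩ t)
    (hlink : ∀ a c ha' hc', link a c → ∀ t,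
      (T ^ w (Sum.inl a)) (φ ⟨Sum.inl a, ha'⟩ t) = φ ⟨Sum.inl c, hc'⟩ t) :
    (G.partFlow S₀ M₀ X₀ link w).IsModel T φ := by
  intro x u k y v h t
  cases h with
  | split h0 ha hc ha' hc' => exact hs _ _ _ _ ha' hc' h0 ha hc t
  | merge h0 ha hc ha' hc' => exact hm _ _ _ _ ha' hc' h0 ha hc t
  | loop l hl' => exact hl l hl' t
  | link h ha' hc' => exact hlink _ _ ha' hc' h t

section parts

open Presentation

variable {S₀ : Set G.Split} {M₀ : Set G.Merge} {X₀ : Set G.Strands} {link : G.Edge → G.Edge → Prop}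

theorem partChart_split (w : G.Strands → ℤ) {s b a c} (ha' : Sum.inl a ∉ X₀)
    (hc' : Sum.inl c ∉ X₀) (hs : s ∉ S₀) (ha : G.head a = .split s)
    (hc : G.tail c = .split s b) (t : Stream' Bool) :
    ((G.partFlow S₀ M₀ X₀ link w).space.T ^ w (Sum.inl a))
        ((G.partFlow S₀ M₀ X₀ link w).space.chart ⟨Sum.inl a, ha'⟩ (Stream'.cons b t))
      = (G.partFlow S₀ M₀ X₀ link w).space.chart ⟨Sum.inl c, hc'⟩ t :=
  isModel_chart (P := G.partFlow S₀ M₀ X₀ link w) _ _ _ _ _ (.split hs ha hc ha' hc') t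

theorem partChart_merge (w : G.Strands → ℤ) {m b a c} (ha' : Sum.inl a ∉ X₀)
    (hc' : Sum.inl c ∉ X₀) (hm : m ∉ M₀) (ha : G.head a = .merge m b)
    (hc : G.tail c = .merge m) (t : Stream' Bool) :
    ((G.partFlow S₀ M₀ X₀ link w).space.T ^ w (Sum.inl a))
        ((G.partFlow S₀ M₀ X₀ link w).space.chart ⟨Sum.inl a, ha'⟩ t)
      = (G.partFlow S₀ M₀ X₀ link w).space.chart ⟨Sum.inl c, hc'⟩ (Stream'.cons b t) :=
  isModel_chart (P := G.partFlow S₀ M₀ X₀ link w) _ _ _ _ _ (.merge hm ha hc ha' hc') t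

theorem partChart_loop (w : G.Strands → ℤ) {l} (hl : Sum.inr l ∉ X₀) (t : Stream' Bool) :
    ((G.partFlow S₀ M₀ X₀ link w).space.T ^ w (Sum.inr l))
        ((G.partFlow S₀ M₀ X₀ link w).space.chart ⟨Sum.inr l, hl⟩ t)
      = (G.partFlow S₀ M₀ X₀ link w).space.chart ⟨Sum.inr l, hl⟩ t :=
  isModel_chart (P := G.partFlow S₀ M₀ X₀ link w) _ _ _ _ _ (.loop l hl) t

theorem partChart_link (w : G.Strands → ℤ) {a c} (ha' : Sum.inl a ∉ X₀)
    (hc' : Sum.inl c ∉ X₀) (h : link a c) (t : Stream' Bool) :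
    ((G.partFlow S₀ M₀ X₀ link w).space.T ^ w (Sum.inl a))
        ((G.partFlow S₀ M₀ X₀ link w).space.chart ⟨Sum.inl a, ha'⟩ t)
      = (G.partFlow S₀ M₀ X₀ link w).space.chart ⟨Sum.inl c, hc'⟩ t :=
  isModel_chart (P := G.partFlow S₀ M₀ X₀ link w) _ _ _ _ _ (.link h ha' hc') t

end parts

end StrandGraph

/-! ### Invariance of the flow space under the three reductions -/

namespace StrandGraph

open Presentation

variable {G : StrandGraph Empty Empty}

/-- The chart of `e` is redundant: its two halves are translates of the charts of the two inputs of
`m`. Running through `m`, `e` and `s` puts a letter in front of the word and takes it off again,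
which is the link rule with the weight of `e` added. -/
theorem isom_I {m : G.Merge} {s : G.Split} {e : G.Edge} (he : G.tail e = .merge m)
    (he' : G.head e = .split s) (z w : G.Strands → ℤ)
    (hw : ∀ a k, G.head a = .merge m k → w (Sum.inl a) = z (Sum.inl a) + z (Sum.inl e))
    (hw' : ∀ a, (∀ k, G.head a ≠ .merge m k) → w (Sum.inl a) = z (Sum.inl a))
    (hw'' : ∀ l, w (Sum.inr l) = z (Sum.inr l)) :
    VSpace.Isom (G.flow z).space (G.partFlow {s} {m} {Sum.inl e}
      (fun a b => ∃ k : Bool, G.head a = .merge m k ∧ G.tail b = .split s k) w).space := by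
  classical
  set link : G.Edge → G.Edge → Prop :=
    fun a b => ∃ k : Bool, G.head a = .merge m k ∧ G.tail b = .split s k
  have hin : ∀ k, Sum.inl (G.head.symm (.merge m k)) ∉ ({Sum.inl e} : Set G.Strands) := by
    intro k h
    rw [Set.mem_singleton_iff, Sum.inl.injEq, Equiv.symm_apply_eq, he'] at h
    cases h
  have hheq : ∀ a k, G.head a = .merge m k → a = G.head.symm (.merge m k) := by
    intro a k h
    rw [Equiv.eq_symm_apply, h]
  let A := G.flow z
  let B := G.partFlow {s} {m} {Sum.inl e} link w
  -- On `e`, the first letter of the word tells through which input of `m` it arrived.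
  let φ : A.Index → Stream' Bool → B.space.Point := fun x t =>
    if h : x ∉ ({Sum.inl e} : Set G.Strands) then B.space.chart ⟨x, h⟩ t else
      (B.space.T ^ z (Sum.inl (G.head.symm (.merge m t.head))))
        (B.space.chart ⟨_, hin t.head⟩ t.tail)
  let ψ : B.Index → Stream' Bool → A.space.Point := fun x => A.space.chart x.1
  have hφ : ∀ x (h : x ∉ ({Sum.inl e} : Set G.Strands)), φ x = B.space.chart ⟨x, h⟩ := by
    intro x h
    funext t
    simp only [φ, dif_pos h]
  have hφe : ∀ k t, φ (Sum.inl e) (Stream'.cons k t) =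
      (B.space.T ^ z (Sum.inl (G.head.symm (.merge m k)))) (B.space.chart ⟨_, hin k⟩ t) := by
    intro k t
    simp only [φ, Set.mem_singleton_iff, not_true_eq_false, dite_false, Stream'.head_cons,
      Stream'.tail_cons]
  have hcons : ∀ t : Stream' Bool, Stream'.cons t.head t.tail = t := fun t => Stream'.eta t
  refine isom_of_models φ ψ ?_ ?_ ?_ ?_ ?_ ?_
  · refine isModel_flow _ _ _ ?_ ?_ ?_
    · intro s' b a c ha hc t
      have hcX : Sum.inl c ∉ ({Sum.inl e} : Set G.Strands) := by
        intro h
        rw [Set.mem_singleton_iff, Sum.inl.injEq] at h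
        subst h
        rw [he] at hc
        cases hc
      rw [hφ _ hcX]
      by_cases hs : s' = s
      · subst hs
        obtain rfl := eq_of_head ha he'
        rw [hφe, ← zpow_add_apply, add_comm, ← hw _ b (by simp)]
        exact partChart_link (link := link) w _ _ ⟨b, by simp, hc⟩ t
      · have haX : Sum.inl a ∉ ({Sum.inl e} : Set G.Strands) := by
          intro h
          rw [Set.mem_singleton_iff, Sum.inl.injEq] at h
          subst h
          rw [he'] at ha
          exact hs (by simpa using ha.symm)
        rw [hφ _ haX, ← hw' a (by simp [ha])]
        exact partChart_split (S₀ := {s}) (M₀ := {m}) (link := link) (s := s') w _ _ hs ha hc t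
    · intro m' b a c ha hc t
      have haX : Sum.inl a ∉ ({Sum.inl e} : Set G.Strands) := by
        intro h
        rw [Set.mem_singleton_iff, Sum.inl.injEq] at h
        subst h
        rw [he'] at ha
        cases ha
      rw [hφ _ haX]
      by_cases hm : m' = m
      · subst hm
        obtain rfl := eq_of_tail hc he
        rw [hφe]
        obtain rfl := hheq a b ha
        rfl
      · have hcX : Sum.inl c ∉ ({Sum.inl e} : Set G.Strands) := by
          intro h
          rw [Set.mem_singleton_iff, Sum.inl.injEq] at h
          subst h
          rw [he] at hc
          exact hm (by simpa using hc.symm)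
        rw [hφ _ hcX, ← hw' a (by simp [ha, hm])]
        exact partChart_merge (S₀ := {s}) (M₀ := {m}) (link := link) (m := m') w _ _ hm ha hc t
    · intro l t
      rw [hφ _ (by simp), ← hw'']
      exact partChart_loop (link := link) w _ t
  · refine isModel_partFlow _ _ ?_ ?_ ?_ ?_
    · intro s' b a c _ _ hs ha hc t
      rw [hw' a (by simp [ha])]
      exact chart_split z ha hc t
    · intro m' b a c _ _ hm ha hc t
      rw [hw' a (by simpa [ha] using hm)]
      exact chart_merge z ha hc t
    · intro l _ t
      rw [hw'']
      exact chart_loop z l t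
    · rintro a c _ _ ⟨k, ha, hc⟩ t
      rw [hw a k ha, add_comm, zpow_add_apply]
      refine Eq.trans (congrArg _ (chart_merge z ha he t)) ?_
      exact chart_split z he' hc t
  · intro x
    by_cases h : x ∉ ({Sum.inl e} : Set G.Strands)
    · rw [hφ _ h]
      exact VSpace.isLocal_chart (Y := B.space) _
    · rw [not_not, Set.mem_singleton_iff] at h
      subst h
      refine .node _ fun b => ?_
      simp only [hφe]
      exact VSpace.isLocal_zpow_chart (Y := B.space) _ _
  · exact fun x => VSpace.isLocal_chart (Y := A.space) _
  · intro f hf y t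
    refine (hf y.1 t).trans ?_
    rw [hφ _ y.2]
  · intro f hf x t
    by_cases h : x ∉ ({Sum.inl e} : Set G.Strands)
    · rw [hφ _ h]
      exact hf _ t
    · rw [not_not, Set.mem_singleton_iff] at h
      subst h
      rw [← hcons t, hφe, VSpace.Hom.map_zpow]
      refine Eq.trans (congrArg _ (hf _ _)) ?_
      exact chart_merge z (by simp) he _

/-- The charts of the two parallel edges are redundant: they are translates of the two halves of the
chart of the input of `s`. The halves are put together again at `m`, and equality of the two weights
ensures that they arrive with the same translation. -/
theorem isom_II {m : G.Merge} {s : G.Split} (a : Bool → G.Edge)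
    (ha : ∀ k, G.tail (a k) = .split s k) (ha' : ∀ k, G.head (a k) = .merge m k)
    (z w : G.Strands → ℤ) (hz : z (Sum.inl (a false)) = z (Sum.inl (a true)))
    (hw : ∀ x, G.head x = .split s → w (Sum.inl x) = z (Sum.inl x) + z (Sum.inl (a false)))
    (hw' : ∀ x, G.head x ≠ .split s → w (Sum.inl x) = z (Sum.inl x))
    (hw'' : ∀ l, w (Sum.inr l) = z (Sum.inr l)) :
    VSpace.Isom (G.flow z).space (G.partFlow {s} {m} {Sum.inl (a false), Sum.inl (a true)}
      (fun x y => G.head x = .split s ∧ G.tail y = .merge m) w).space := by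
  classical
  set link : G.Edge → G.Edge → Prop := fun x y => G.head x = .split s ∧ G.tail y = .merge m
  set X₀ : Set G.Strands := {Sum.inl (a false), Sum.inl (a true)} with hX₀
  have hz' : ∀ k, z (Sum.inl (a k)) = z (Sum.inl (a false)) := by
    rintro (_ | _)
    · rfl
    · exact hz.symm
  have hX : ∀ x, x ∈ X₀ ↔ ∃ k, x = Sum.inl (a k) := by
    intro x
    simp [hX₀]
  have hXh : ∀ x, (∀ k, G.head x ≠ .merge m k) → Sum.inl x ∉ X₀ := by
    intro x hx h
    obtain ⟨k, hk⟩ := (hX _).1 h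
    rw [Sum.inl.injEq] at hk
    subst hk
    exact hx k (ha' k)
  have hXt : ∀ x, (∀ k, G.tail x ≠ .split s k) → Sum.inl x ∉ X₀ := by
    intro x hx h
    obtain ⟨k, hk⟩ := (hX _).1 h
    rw [Sum.inl.injEq] at hk
    subst hk
    exact hx k (ha k)
  have hin : Sum.inl (G.head.symm (.split s)) ∉ X₀ := hXh _ (by simp)
  let A := G.flow z
  let B := G.partFlow {s} {m} X₀ link w
  let φ : A.Index → Stream' Bool → B.space.Point := fun x t =>
    if h : x ∉ X₀ then B.space.chart ⟨x, h⟩ t else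
      (B.space.T ^ z (Sum.inl (G.head.symm (.split s))))
        (B.space.chart ⟨_, hin⟩ (Stream'.cons (if x = Sum.inl (a false) then false else true) t))
  let ψ : B.Index → Stream' Bool → A.space.Point := fun x => A.space.chart x.1
  have hφ : ∀ x (h : x ∉ X₀), φ x = B.space.chart ⟨x, h⟩ := by
    intro x h
    funext t
    simp only [φ, dif_pos h]
  have hane : a true ≠ a false := by
    intro h
    have := ha true
    rw [h, ha] at this
    cases this
  have hφa : ∀ k t, φ (Sum.inl (a k)) t =
      (B.space.T ^ z (Sum.inl (G.head.symm (.split s))))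
        (B.space.chart ⟨_, hin⟩ (Stream'.cons k t)) := by
    intro k t
    have : Sum.inl (a k) ∈ X₀ := (hX _).2 ⟨k, rfl⟩
    cases k
    · simp [φ, this]
    · have h1 : (Sum.inl (a true) : G.Strands) ≠ Sum.inl (a false) := by simpa using hane
      simp only [φ, this, not_true_eq_false, dite_false, if_neg h1]
  refine isom_of_models φ ψ ?_ ?_ ?_ ?_ ?_ ?_
  · refine isModel_flow _ _ _ ?_ ?_ ?_
    · intro s' b x c hx hc t
      have hxX : Sum.inl x ∉ X₀ := hXh _ (by simp [hx])
      rw [hφ _ hxX]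
      by_cases hs : s' = s
      · subst hs
        obtain rfl := eq_of_tail hc (ha b)
        rw [hφa]
        obtain rfl := eq_of_head hx (G.head.apply_symm_apply (.split s'))
        rfl
      · have hcX : Sum.inl c ∉ X₀ := hXt _ (by simp [hc, hs])
        rw [hφ _ hcX, ← hw' x (by simpa [hx] using hs)]
        exact partChart_split (S₀ := {s}) (M₀ := {m}) (link := link) (s := s') w _ _ hs hx hc t
    · intro m' b x c hx hc t
      have hcX : Sum.inl c ∉ X₀ := hXt _ (by simp [hc])
      rw [hφ _ hcX]
      by_cases hm : m' = m
      · subst hm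
        obtain rfl := eq_of_head hx (ha' b)
        rw [hφa, ← zpow_add_apply, hz', add_comm, ← hw _ (by simp)]
        exact partChart_link (link := link) w _ _ ⟨by simp, hc⟩ _
      · have hxX : Sum.inl x ∉ X₀ := hXh _ (by simp [hx, hm])
        rw [hφ _ hxX, ← hw' x (by simp [hx])]
        exact partChart_merge (S₀ := {s}) (M₀ := {m}) (link := link) (m := m') w _ _ hm hx hc t
    · intro l t
      rw [hφ _ (by simp [hX]), ← hw'']
      exact partChart_loop (link := link) w _ t
  · refine isModel_partFlow _ _ ?_ ?_ ?_ ?_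
    · intro s' b x c _ _ hs hx hc t
      rw [hw' x (by simpa [hx] using hs)]
      exact chart_split z hx hc t
    · intro m' b x c _ _ hm hx hc t
      rw [hw' x (by simp [hx])]
      exact chart_merge z hx hc t
    · intro l _ t
      rw [hw'']
      exact chart_loop z l t
    · rintro x c _ _ ⟨hx, hc⟩ t
      rw [hw x hx, add_comm, zpow_add_apply, ← Stream'.eta t, ← hz' t.head]
      refine Eq.trans (congrArg _ (chart_split z hx (ha _) t.tail)) ?_
      exact chart_merge z (ha' _) hc _
  · intro x
    by_cases h : x ∉ X₀
    · rw [hφ _ h]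
      exact VSpace.isLocal_chart (Y := B.space) _
    · rw [not_not, hX] at h
      obtain ⟨k, rfl⟩ := h
      have : φ (Sum.inl (a k)) = fun t => (B.space.T ^ z (Sum.inl (G.head.symm (.split s))))
        (B.space.chart ⟨_, hin⟩ (Stream'.cons k t)) := funext fun t => hφa k t
      rw [this]
      exact .base _ _ _ [k] fun w => rfl
  · exact fun x => VSpace.isLocal_chart (Y := A.space) _
  · intro f hf y t
    refine (hf y.1 t).trans ?_
    rw [hφ _ y.2]
  · intro f hf x t
    by_cases h : x ∉ X₀
    · rw [hφ _ h]
      exact hf _ t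
    · rw [not_not, hX] at h
      obtain ⟨k, rfl⟩ := h
      rw [hφa, VSpace.Hom.map_zpow]
      refine Eq.trans (congrArg _ (hf _ _)) ?_
      exact chart_split z (by simp) (ha k) _

/-- Two Cantor sets with the same period form one Cantor set with that period: the loop `l` becomes
the cone of `false` and `l'` the cone of `true` in the loop that is kept. -/
theorem isom_III {l l' : G.Loop} (hll : l ≠ l') (z : G.Strands → ℤ)
    (hz : z (Sum.inr l) = z (Sum.inr l')) :
    VSpace.Isom (G.flow z).space
      (G.partFlow ∅ ∅ {Sum.inr l'} (fun _ _ => False) z).space := by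
  classical
  set link : G.Edge → G.Edge → Prop := fun _ _ => False
  set X₀ : Set G.Strands := {Sum.inr l'} with hX₀
  have hl : Sum.inr l ∉ X₀ := by simpa [hX₀] using hll
  have hX : ∀ x, x ∉ X₀ ↔ x ≠ Sum.inr l' := fun x => by simp [hX₀]
  have hE : ∀ a, Sum.inl a ∉ X₀ := by simp [hX₀]
  let A := G.flow z
  let B := G.partFlow ∅ ∅ X₀ link z
  let φ : A.Index → Stream' Bool → B.space.Point := fun x t =>
    if h : x ∈ X₀ then B.space.chart ⟨_, hl⟩ (Stream'.cons true t) else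
      if x = Sum.inr l then B.space.chart ⟨_, hl⟩ (Stream'.cons false t) else
        B.space.chart ⟨x, h⟩ t
  let ψ : B.Index → Stream' Bool → A.space.Point := fun x t =>
    if x.1 = Sum.inr l then
      A.space.chart (if t.head then Sum.inr l' else Sum.inr l) t.tail
    else A.space.chart x.1 t
  have hφ1 : ∀ x (h : x ∉ X₀), x ≠ Sum.inr l → φ x = B.space.chart ⟨x, h⟩ := by
    intro x h h'
    funext t
    simp only [φ, dif_neg h, if_neg h']
  have hφ2 : ∀ t, φ (Sum.inr l) t = B.space.chart ⟨_, hl⟩ (Stream'.cons false t) := by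
    intro t
    simp only [φ, dif_neg hl, if_true]
  have hφ3 : ∀ t, φ (Sum.inr l') t = B.space.chart ⟨_, hl⟩ (Stream'.cons true t) := by
    intro t
    simp [φ, hX₀]
  have hψ1 : ∀ x : B.Index, x.1 ≠ Sum.inr l → ψ x = A.space.chart x.1 := by
    intro x h
    funext t
    simp only [ψ, if_neg h]
  have hψ2 : ∀ t, ψ ⟨Sum.inr l, hl⟩ (Stream'.cons false t) = A.space.chart (Sum.inr l) t := by
    intro t
    simp [ψ]
  have hψ3 : ∀ t, ψ ⟨Sum.inr l, hl⟩ (Stream'.cons true t) = A.space.chart (Sum.inr l') t := by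
    intro t
    simp [ψ]
  refine isom_of_models φ ψ ?_ ?_ ?_ ?_ ?_ ?_
  · refine isModel_flow _ _ _ ?_ ?_ ?_
    · intro s b a c ha hc t
      rw [hφ1 _ (hE a) (by simp), hφ1 _ (hE c) (by simp)]
      exact partChart_split (link := link) z _ _ (by simp) ha hc t
    · intro m b a c ha hc t
      rw [hφ1 _ (hE a) (by simp), hφ1 _ (hE c) (by simp)]
      exact partChart_merge (link := link) z _ _ (by simp) ha hc t
    · intro l₁ t
      by_cases h1 : l₁ = l'
      · subst h1
        rw [hφ3, ← hz]
        exact partChart_loop (link := link) z _ _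
      by_cases h2 : l₁ = l
      · subst h2
        rw [hφ2]
        exact partChart_loop (link := link) z _ _
      rw [hφ1 _ ((hX _).2 (by simpa using h1)) (by simpa using h2)]
      exact partChart_loop (link := link) z _ _
  · refine isModel_partFlow _ _ ?_ ?_ ?_ ?_
    · intro s b a c _ _ _ ha hc t
      rw [hψ1 _ (by simp), hψ1 _ (by simp)]
      exact chart_split z ha hc t
    · intro m b a c _ _ _ ha hc t
      rw [hψ1 _ (by simp), hψ1 _ (by simp)]
      exact chart_merge z ha hc t
    · intro l₁ hl₁ t
      by_cases h2 : l₁ = l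
      · subst h2
        rw [← Stream'.eta t]
        cases t.head
        · rw [hψ2]
          exact chart_loop z _ _
        · rw [hψ3, hz]
          exact chart_loop z _ _
      · rw [hψ1 _ (by simpa using h2)]
        exact chart_loop z _ _
    · intro a c _ _ h
      exact h.elim
  · intro x
    by_cases h1 : x ∈ X₀
    · rw [hX₀, Set.mem_singleton_iff] at h1
      subst h1
      exact .base _ 0 ⟨_, hl⟩ [true] fun t => by rw [hφ3]; simp; rfl
    by_cases h2 : x = Sum.inr l
    · subst h2
      exact .base _ 0 ⟨_, hl⟩ [false] fun t => by rw [hφ2]; simp; rfl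
    rw [hφ1 _ h1 h2]
    exact VSpace.isLocal_chart (Y := B.space) _
  · rintro ⟨x, hx⟩
    by_cases h : x = Sum.inr l
    · subst h
      refine .node _ fun b => ?_
      cases b
      · simp only [hψ2]
        exact VSpace.isLocal_chart (Y := A.space) _
      · simp only [hψ3]
        exact VSpace.isLocal_chart (Y := A.space) _
    · rw [hψ1 _ h]
      exact VSpace.isLocal_chart (Y := A.space) _
  · rintro f hf ⟨x, hx⟩ t
    by_cases h : x = Sum.inr l
    · subst h
      rw [← Stream'.eta t]
      cases t.head
      · rw [hψ2]
        exact (hf _ _).trans (hφ2 _)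
      · rw [hψ3]
        exact (hf _ _).trans (hφ3 _)
    · rw [hψ1 _ h]
      exact (hf _ _).trans (congrFun (hφ1 _ hx h) t)
  · intro f hf x t
    by_cases h1 : x ∈ X₀
    · rw [hX₀, Set.mem_singleton_iff] at h1
      subst h1
      rw [hφ3]
      exact (hf _ _).trans (hψ3 _)
    by_cases h2 : x = Sum.inr l
    · subst h2
      rw [hφ2]
      exact (hf _ _).trans (hψ2 _)
    rw [hφ1 _ h1 h2]
    exact (hf _ _).trans (congrFun (hψ1 _ h2) t)

end StrandGraph

/-! ### Invariance of the flow space under coboundaries -/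

namespace StrandGraph

open Presentation

theorem tgt_eq_src_split {I O : Type} {G : StrandGraph I O} {s b a c} (ha : G.head a = .split s)
    (hc : G.tail c = .split s b) : G.tgt a = G.src c := by
  simp [tgt, src, ha, hc, Head.vertex, Tail.vertex]

theorem tgt_eq_src_merge {I O : Type} {G : StrandGraph I O} {m b a c} (ha : G.head a = .merge m b)
    (hc : G.tail c = .merge m) : G.tgt a = G.src c := by
  simp [tgt, src, ha, hc, Head.vertex, Tail.vertex]

variable {G : StrandGraph Empty Empty}

/-- Adding a coboundary amounts to translating the chart of each edge by the value of the 0-cochain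
at the vertex where it starts; free loops need no translation. -/
theorem isom_add_coboundary (z : G.Strands → ℤ) (p : G.Vertices → ℤ) :
    VSpace.Isom (G.flow z).space (G.flow (z + G.coboundary p)).space := by
  have key : ∀ (z : G.Strands → ℤ) (p : G.Vertices → ℤ),
      (G.flow z).IsModel (G.flow (z + G.coboundary p)).space.T (fun x t =>
        ((G.flow (z + G.coboundary p)).space.T ^ (Sum.elim (fun e => - p (G.src e)) 0 x : ℤ))
          ((G.flow (z + G.coboundary p)).space.chart x t)) := by
    intro z p
    have hz : ∀ a, (z + G.coboundary p) (Sum.inl a)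
        = z (Sum.inl a) + (p (G.tgt a) - p (G.src a)) := fun a => rfl
    refine isModel_flow _ _ _ ?_ ?_ ?_
    · intro s b a c ha hc t
      rw [← chart_split _ ha hc t, ← zpow_add_apply, ← zpow_add_apply, hz,
        tgt_eq_src_split ha hc]
      congr 2
      simp only [Sum.elim_inl]
      ring
    · intro s b a c ha hc t
      rw [← chart_merge _ ha hc t, ← zpow_add_apply, ← zpow_add_apply, hz,
        tgt_eq_src_merge ha hc]
      congr 2
      simp only [Sum.elim_inl]
      ring
    · intro l t
      have := chart_loop (z + G.coboundary p) l t
      have hz' : (z + G.coboundary p) (Sum.inr l) = z (Sum.inr l) := add_zero _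
      rw [hz'] at this
      simpa using this
  set z' := z + G.coboundary p with hz'
  -- The inverse is the same construction for the opposite 0-cochain, which leads back to `z`.
  have key' := key z' (-p)
  have e : z' + G.coboundary (-p) = z := by rw [map_neg, hz']; abel
  rw [e] at key'
  refine isom_of_models _ _ (key z p) key' (fun x => VSpace.isLocal_zpow_chart _ _)
    (fun x => VSpace.isLocal_zpow_chart _ _) ?_ ?_
  · intro f hf x t
    rw [VSpace.Hom.map_zpow, hf, ← zpow_add_apply]
    rcases x with x | x <;> simp <;> rfl
  · intro f hf x t
    rw [VSpace.Hom.map_zpow, hf, ← zpow_add_apply]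
    rcases x with x | x <;> simp

end StrandGraph

/-! ### The Cantor set with the action of an element of `V` -/

/-- The Cantor set with the action of `f`. -/
abbrev cantorSpace (f : Equiv.Perm (Stream' Bool)) : VSpace where
  Point := Stream' Bool
  T := f
  Index := Unit
  chart _ := id

theorem IsPrefixReplacement.mono {g : Stream' Bool → Stream' Bool} {N M : ℕ} (hNM : N ≤ M)
    (h : ∀ u : List Bool, u.length = N → ∃ v : List Bool, ∀ w, g (u ++ₛ w) = v ++ₛ w)
    (u : List Bool) (hu : u.length = M) : ∃ v : List Bool, ∀ w, g (u ++ₛ w) = v ++ₛ w := by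
  obtain ⟨v, hv⟩ := h (u.take N) (by simp [hu, hNM])
  refine ⟨v ++ u.drop N, fun w => ?_⟩
  conv_lhs => rw [← List.take_append_drop N u]
  rw [Stream'.append_append_stream, hv, Stream'.append_append_stream]

theorem IsPrefixReplacement.of_cons {g : Stream' Bool → Stream' Bool}
    (h : ∀ b, IsPrefixReplacement fun w => g (Stream'.cons b w)) : IsPrefixReplacement g := by
  choose N hN using h
  refine ⟨max (N false) (N true) + 1, fun u hu => ?_⟩
  match u, hu with
  | b :: u, hu =>
    refine IsPrefixReplacement.mono (g := fun w => g (Stream'.cons b w))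
      (M := max (N false) (N true)) ?_ (hN b) u (by simpa using hu)
    cases b <;> simp

theorem VSpace.IsLocal.induct {Y : VSpace} {C : (Stream' Bool → Y.Point) → Prop}
    {g : Stream' Bool → Y.Point} (hg : Y.IsLocal g)
    (base : ∀ (g : Stream' Bool → Y.Point) (n : ℤ) (i : Y.Index) (v : List Bool),
      (∀ w, g w = (Y.T ^ n) (Y.chart i (v ++ₛ w))) → C g)
    (node : ∀ g : Stream' Bool → Y.Point, (∀ b, C fun w => g (Stream'.cons b w)) → C g) : C g := by
  induction hg with
  | base g n i v h => exact base g n i v h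
  | node g h ih => exact node g ih

/-- Locality allows powers of `f`, but these are themselves prefix replacements because `f` lies in
`V`. -/
theorem IsPrefixReplacement.of_isLocal {f : ThompsonV} {g : Stream' Bool → Stream' Bool}
    (hg : (cantorSpace f.1).IsLocal g) : IsPrefixReplacement g := by
  refine hg.induct (C := IsPrefixReplacement) (fun g n i v h => ?_) fun g h => .of_cons h
  have h1 : IsPrefixReplacement ⇑((f ^ n : ThompsonV).1) := (f ^ n).2
  have h2 : IsPrefixReplacement (fun w => v ++ₛ w) :=
    ⟨0, fun u hu => ⟨v, fun w => by
      obtain rfl := List.length_eq_zero_iff.1 hu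
      rfl⟩⟩
  convert isPrefixReplacement_comp h1 h2 using 1
  funext w
  rw [h]
  simp

theorem IsPrefixReplacement.isLocal {f : Equiv.Perm (Stream' Bool)}
    {g : Stream' Bool → Stream' Bool} (hg : IsPrefixReplacement g) :
    (cantorSpace f).IsLocal g := by
  obtain ⟨N, hN⟩ := hg
  refine .of_length N fun u hu => ?_
  obtain ⟨v, hv⟩ := hN u hu
  exact .base _ 0 () v fun w => by simp [hv]

/-- An isomorphism is an equivariant bijection of the Cantor set that is piecewise a prefix
replacement followed by a power of `g`, hence an element of `V` conjugating `f` to `g`. -/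
theorem isom_cantorSpace_iff (f g : ThompsonV) :
    VSpace.Isom (cantorSpace f.1) (cantorSpace g.1) ↔ IsConj f g := by
  rw [isConj_iff]
  constructor
  · rintro ⟨h, h', h1, h2⟩
    let c : Equiv.Perm (Stream' Bool) := ⟨h.toFun, h'.toFun, h1, h2⟩
    refine ⟨⟨c, IsPrefixReplacement.of_isLocal (h.isLocal ())⟩, ?_⟩
    rw [mul_inv_eq_iff_eq_mul]
    ext x
    exact congrFun (congrArg Stream'.get (h.map_T x)) _
  · rintro ⟨c, hc⟩
    rw [mul_inv_eq_iff_eq_mul] at hc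
    have hc' : ∀ x, c.1 (f.1 x) = g.1 (c.1 x) := fun x =>
      congrFun (congrArg (fun h : ThompsonV => ⇑h.1) hc) x
    refine ⟨⟨c.1, hc', fun _ => IsPrefixReplacement.isLocal c.2⟩,
      ⟨c.1.symm, fun y => ?_, fun _ => IsPrefixReplacement.isLocal (c⁻¹).2⟩,
      c.1.symm_apply_apply, c.1.apply_symm_apply⟩
    change c.1.symm (g.1 y) = f.1 (c.1.symm y)
    rw [Equiv.symm_apply_eq, hc', Equiv.apply_symm_apply]

/-! ### The flow space of the closure of an abstract strand diagram -/

open Presentation StrandGraph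

theorem isDirectedCycle_of_nat {I O : Type} {G : StrandGraph I O} {n : ℕ} {γ : ℕ → G.Edge}
    (h : ∀ i ≤ n, G.tgt (γ i) = G.src (γ (i + 1))) (h0 : γ (n + 1) = γ 0) :
    G.IsDirectedCycle (fun i : Fin (n + 1) => γ i) := by
  intro i
  rw [h i (by omega)]
  rcases Nat.lt_or_ge i.1 n with hi | hi
  · have := Fin.val_add_one_of_lt (i := i) (Fin.lt_def.2 (by simpa using hi))
    simp only [this]
  · have : i = Fin.last n := Fin.ext (by simp; omega)
    subst this
    simp [h0]

theorem exists_path_of_transGen {E : Type} {r : E → E → Prop} {a b : E}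
    (h : Relation.TransGen r a b) :
    ∃ (n : ℕ) (γ : ℕ → E), γ 0 = a ∧ γ (n + 1) = b ∧ ∀ i ≤ n, r (γ i) (γ (i + 1)) := by
  induction h with
  | @single b h =>
    refine ⟨0, fun i => if i = 0 then a else b, by simp, by simp, fun i hi => ?_⟩
    obtain rfl : i = 0 := by omega
    simpa using h
  | @tail b c _ h ih =>
    obtain ⟨n, γ, h0, h1, h2⟩ := ih
    refine ⟨n + 1, fun i => if i ≤ n + 1 then γ i else c, by simpa using h0, by simp, ?_⟩
    intro i hi
    rcases Nat.lt_or_ge i (n + 1) with hi' | hi'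
    · simpa [hi, hi'.le, Nat.succ_le_of_lt hi'] using h2 i (by omega)
    · obtain rfl : i = n + 1 := by omega
      simpa [h1] using h

/-- In a finite acyclic graph the transitive closure of succession is irreflexive. This permits
induction on edges starting from the sink. -/
theorem AbstractStrandDiagram.wellFounded (A : AbstractStrandDiagram) :
    WellFounded (fun c a : A.Edge => A.tgt a = A.src c) := by
  have := A.toStrandGraph.finite_edge
  have hirr : ∀ a : A.Edge, ¬ Relation.TransGen (fun a c : A.Edge => A.tgt a = A.src c) a a := by
    intro a h
    obtain ⟨n, γ, h0, h1, h2⟩ := exists_path_of_transGen h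
    exact A.acyclic n _ (isDirectedCycle_of_nat h2 (h1.trans h0.symm))
  have : Std.Irrefl (Relation.TransGen (fun c a : A.Edge => A.tgt a = A.src c)) :=
    ⟨fun a h => hirr a (Relation.transGen_swap.1 h)⟩
  have hwf : WellFounded (Relation.TransGen (fun c a : A.Edge => A.tgt a = A.src c)) :=
    Finite.wellFounded_of_trans_of_irrefl _
  exact Subrelation.wf (r := Relation.TransGen (fun c a : A.Edge => A.tgt a = A.src c))
    (fun h => Relation.TransGen.single h) hwf

theorem AbstractStrandDiagram.isGluing (A : AbstractStrandDiagram) :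
    A.toStrandGraph.IsGluing ∅ ∅ ∅
      (fun a b => A.head a = .sink () ∧ A.tail b = .source ()) where
  not_keptTail := by simp
  not_keptHead := by simp
  left_not_mem := by simp
  right_not_mem := by simp
  left_not_kept := by
    rintro a b ⟨h, h'⟩
    rw [keptHead_iff, h]
    simp
  right_not_kept := by
    rintro a b ⟨h, h'⟩
    rw [keptTail_iff, h']
    simp
  exists_right := by
    intro a _ h
    rw [keptHead_iff] at h
    rcases hh : A.head a with _ | s | ⟨m, k⟩
    · exact ⟨A.tail.symm (.source ()), rfl, by simp⟩
    · simp [hh] at h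
    · simp [hh] at h
  exists_left := by
    intro a _ h
    rw [keptTail_iff] at h
    rcases hh : A.tail a with _ | ⟨s, k⟩ | m
    · exact ⟨A.head.symm (.sink ()), by simp, rfl⟩
    · simp [hh] at h
    · simp [hh] at h
  right_unique := fun x y y' h h' => eq_of_tail h.2 h'.2
  left_unique := fun x x' y h h' => eq_of_head h.1 h'.1

/-- An edge of an abstract strand diagram ends at the sink, at a split or at a merge. -/
theorem AbstractStrandDiagram.induction (A : AbstractStrandDiagram) {C : A.Edge → Prop}
    (sink : ∀ a, A.head a = .sink () → C a)
    (split : ∀ a s, A.head a = .split s → (∀ b, C (A.tail.symm (.split s b))) → C a)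
    (merge : ∀ a m b, A.head a = .merge m b → C (A.tail.symm (.merge m)) → C a) (a : A.Edge) :
    C a := by
  refine A.wellFounded.induction a fun a ih => ?_
  rcases hh : A.head a with _ | s | ⟨m, k⟩
  · exact sink a hh
  · exact split a s hh fun b => ih _ (tgt_eq_src_split (b := b) hh (by simp))
  · exact merge a m k hh (ih _ (tgt_eq_src_merge hh (by simp)))

/-- Time passes only at the cut point. Elsewhere charts are glued without translation, so each is
absorbed into the chart of the edge that ends at the sink, by the map computed by the rest of the
diagram. One turn from that edge through the cut and back is therefore both `T` and the action of
`f`. -/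
theorem isom_cantorSpace (A : AbstractStrandDiagram) {f : Equiv.Perm (Stream' Bool)}
    (hA : A.Represents f) (w : A.Strands → ℤ)
    (hw : ∀ a, A.head a = .sink () → w (Sum.inl a) = 1)
    (hw' : ∀ a, A.head a ≠ .sink () → w (Sum.inl a) = 0) :
    VSpace.Isom (A.partFlow ∅ ∅ ∅
      (fun a b => A.head a = .sink () ∧ A.tail b = .source ()) w).space (cantorSpace f) := by
  obtain ⟨F, hf, hs, hm, ht⟩ := hA
  have hs' : ∀ s b a c, A.head a = .split s → A.tail c = .split s b → ∀ t,
      F a (Stream'.cons b t) = F c t := by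
    intro s b a c ha hc t
    rw [← Equiv.eq_symm_apply] at ha hc
    subst ha hc
    exact hs s b t
  have hm' : ∀ m b a c, A.head a = .merge m b → A.tail c = .merge m → ∀ t,
      F a t = F c (Stream'.cons b t) := by
    intro s b a c ha hc t
    rw [← Equiv.eq_symm_apply] at ha hc
    subst ha hc
    exact hm s b t
  have ht' : ∀ a, A.head a = .sink () → ∀ t, F a t = t := by
    intro a ha t
    rw [← Equiv.eq_symm_apply] at ha
    subst ha
    exact ht t
  have := A.isEmpty_loop
  set link : A.Edge → A.Edge → Prop := fun a b => A.head a = .sink () ∧ A.tail b = .source ()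
  set B := A.partFlow ∅ ∅ ∅ link w with hB
  have hE : ∀ a, Sum.inl a ∉ (∅ : Set A.Strands) := fun a => Set.notMem_empty _
  let φ : {x : A.Strands // x ∉ (∅ : Set A.Strands)} → Stream' Bool → Stream' Bool :=
    fun x => Sum.elim F (fun _ => id) x.1
  have hmod : B.IsModel (cantorSpace f).T φ := by
    refine isModel_partFlow _ _ ?_ ?_ ?_ ?_
    · intro s b a c _ _ _ ha hc t
      rw [hw' a (by simp [ha]), zpow_zero]
      exact hs' s b a c ha hc t
    · intro m b a c _ _ _ ha hc t
      rw [hw' a (by simp [ha]), zpow_zero]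
      exact hm' m b a c ha hc t
    · intro l
      exact isEmptyElim l
    · rintro a c _ _ ⟨ha, hc⟩ t
      rw [hw a ha, zpow_one]
      change f (F a t) = F c t
      rw [ht' a ha, ← hf]
      rw [← Equiv.eq_symm_apply] at hc
      rw [hc]
  have hloc : ∀ a, (cantorSpace f).IsLocal (F a) := by
    refine A.induction (fun a ha => ?_) (fun a s ha ih => ?_) (fun a m b ha ih => ?_)
    · exact .base _ 0 () [] fun t => by simp [ht' a ha]
    · refine .node _ fun b => ?_
      have := ih b
      convert this using 2 with t
      exact hs' s b a _ ha (by simp) t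
    · have := ih.cons b
      convert this using 2 with t
      exact hm' m b a _ ha (by simp) t
  -- By induction from the sink: all charts factor through the chart of the last edge.
  have hchart : ∀ a t, B.space.chart ⟨Sum.inl a, hE a⟩ t =
      B.space.chart ⟨Sum.inl (A.head.symm (.sink ())), hE _⟩ (F a t) := by
    refine A.induction (fun a ha t => ?_) (fun a s ha ih t => ?_) (fun a m b ha ih t => ?_)
    · rw [ht' a ha]
      rw [← Equiv.eq_symm_apply] at ha
      subst ha
      rfl
    · rw [← Stream'.eta t, hs' s t.head a (A.tail.symm (.split s t.head)) ha (by simp), ← ih]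
      have := partChart_split (link := link) (S₀ := ∅) (M₀ := ∅) (b := t.head) w (hE a)
        (hE (A.tail.symm (.split s t.head))) (Set.notMem_empty _) ha (by simp) t.tail
      rwa [hw' a (by simp [ha]), zpow_zero] at this
    · rw [hm' m b a (A.tail.symm (.merge m)) ha (by simp), ← ih]
      have := partChart_merge (link := link) (S₀ := ∅) (M₀ := ∅) w (hE a)
        (hE (A.tail.symm (.merge m))) (Set.notMem_empty _) ha (by simp) t
      rwa [hw' a (by simp [ha]), zpow_zero] at this
  have hT : ∀ t, B.space.chart ⟨Sum.inl (A.head.symm (.sink ())), hE _⟩ (f t)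
      = B.space.T (B.space.chart ⟨Sum.inl (A.head.symm (.sink ())), hE _⟩ t) := by
    intro t
    have h1 := partChart_link (link := link) (S₀ := ∅) (M₀ := ∅) w
      (hE (A.head.symm (.sink ()))) (hE (A.tail.symm (.source ()))) ⟨by simp, by simp⟩ t
    rw [hw _ (by simp), zpow_one] at h1
    refine Eq.trans ?_ h1.symm
    refine Eq.trans ?_ (hchart _ _).symm
    rw [hf]
  refine ⟨lift (Y := cantorSpace f) φ hmod ?_,
    ⟨B.space.chart ⟨Sum.inl (A.head.symm (.sink ())), hE _⟩, ?_, ?_⟩, ?_, ?_⟩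
  · rintro ⟨a | l, h⟩
    · exact hloc a
    · exact isEmptyElim l
  · exact hT
  · exact fun _ => VSpace.isLocal_chart (Y := B.space) _
  · refine space_induction fun n x t => ?_
    rw [VSpace.Hom.map_zpow, lift_chart]
    rcases x with ⟨a | l, h⟩
    · change B.space.chart _ ((f ^ n) (F a t)) = _
      rw [map_zpow_of_map f B.space.T _ hT, ← hchart]
    · exact isEmptyElim l
  · intro t
    refine (lift_chart (P := B) (Y := cantorSpace f) φ hmod _ _ t).trans ?_
    exact ht' _ (by simp) t

/-! ### The flow space under equivalence and isomorphism of diagrams -/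

namespace ClosedStrandDiagram

variable {D D' : ClosedStrandDiagram}

theorem isom_of_isCutting {z z' : D.Strands → ℤ} (hz : D.IsCutting z) (hz' : D.IsCutting z') :
    VSpace.Isom (D.flow z).space (D.flow z').space := by
  have h : (QuotientAddGroup.mk z : D.toStrandGraph.H1) = QuotientAddGroup.mk z' :=
    hz.trans hz'.symm
  rw [QuotientAddGroup.eq] at h
  obtain ⟨p, hp⟩ := h
  have := isom_add_coboundary z p
  rwa [hp, add_neg_cancel_left] at this

theorem exists_isCutting (D : ClosedStrandDiagram) : ∃ z, D.IsCutting z := by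
  obtain ⟨z, hz⟩ := QuotientAddGroup.mk_surjective D.cuttingClass
  exact ⟨z, hz⟩

theorem isom_of_reduces (h : Reduces D D') {z : D.Strands → ℤ} {z' : D'.Strands → ℤ}
    (hz : D.IsCutting z) (hz' : D'.IsCutting z') :
    VSpace.Isom (D.flow z).space (D'.flow z').space := by
  rcases h with ⟨m, s, e, he, he', P, y, hy, hy'⟩ | ⟨s, m, a, b, ha, ha', hb, hb', P, y, hy, hab, hy'⟩ |
    ⟨l, l', hll, P, y, hy, hl, hy'⟩
  · refine (isom_of_isCutting hz hy).trans (((isom_I he he' y _ ?_ ?_ ?_).trans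
      (P.isom_space (isGluing_I he he') _)).trans (isom_of_isCutting hy' hz'))
    · intro a k ha
      rw [if_pos ⟨a, k, rfl, ha⟩]
    · intro a ha
      rw [if_neg, add_zero]
      rintro ⟨a', k, h, h'⟩
      rw [Sum.inl.injEq] at h
      subst h
      exact ha k h'
    · intro l
      rw [if_neg, add_zero]
      rintro ⟨a', k, h, h'⟩
      cases h
  · refine (isom_of_isCutting hz hy).trans (((isom_II (m := m) (s := s) (fun k => cond k b a) ?_ ?_
      y _ hab ?_ ?_ ?_).trans (P.isom_space (isGluing_II ha ha' hb hb') _)).trans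
      (isom_of_isCutting hy' hz'))
    · rintro (_ | _)
      · exact ha
      · exact hb
    · rintro (_ | _)
      · exact ha'
      · exact hb'
    · intro x hx
      rw [if_pos]
      · rfl
      · rw [Sum.inl.injEq, Equiv.eq_symm_apply, hx]
    · intro x hx
      rw [if_neg, add_zero]
      rwa [Sum.inl.injEq, Equiv.eq_symm_apply]
    · intro l
      rw [if_neg (by simp), add_zero]
  · exact (isom_of_isCutting hz hy).trans (((isom_III hll y hl).trans
      (P.isom_space (isGluing_III l') _)).trans (isom_of_isCutting hy' hz'))

theorem isom_of_equivalent (h : Equivalent D D') {z : D.Strands → ℤ} {z' : D'.Strands → ℤ}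
    (hz : D.IsCutting z) (hz' : D'.IsCutting z') :
    VSpace.Isom (D.flow z).space (D'.flow z').space := by
  induction h with
  | rel D D' h => exact isom_of_reduces h hz hz'
  | refl D => exact isom_of_isCutting hz hz'
  | symm D D' _ ih => exact (ih hz' hz).symm
  | trans D D₁ D' _ _ ih ih' =>
    obtain ⟨y, hy⟩ := exists_isCutting D₁
    exact (ih hz hy).trans (ih' hy hz')

theorem isom_of_isClosureOf {A : AbstractStrandDiagram} {f : Equiv.Perm (Stream' Bool)}
    (hA : A.Represents f) (h : IsClosureOf D A) {z : D.Strands → ℤ} (hz : D.IsCutting z) :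
    VSpace.Isom (D.flow z).space (cantorSpace f) := by
  obtain ⟨P, hP⟩ := h
  refine (isom_of_isCutting hz hP).trans (((P.isom_space A.isGluing _).symm).trans
    (isom_cantorSpace A hA _ ?_ ?_))
  · intro a ha
    rw [if_pos]
    rw [Sum.inl.injEq, Equiv.eq_symm_apply, ha]
  · intro a ha
    rw [if_neg]
    rwa [Sum.inl.injEq, Equiv.eq_symm_apply]

/-- Every reduced diagram of `f` thus has the same flow space up to isomorphism, whichever abstract
diagram and whichever moves lead to it. -/
theorem IsReducedDiagramOf.isom {f : ThompsonV} (h : D.IsReducedDiagramOf f)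
    {z : D.Strands → ℤ} (hz : D.IsCutting z) :
    VSpace.Isom (D.flow z).space (cantorSpace f.1) := by
  obtain ⟨-, A, C, hA, hC, hCD⟩ := h
  obtain ⟨y, hy⟩ := exists_isCutting C
  exact (isom_of_equivalent hCD hy hz).symm.trans (isom_of_isClosureOf hA hC hy)

theorem isom_of_iso (ι : Iso D D') {z : D.Strands → ℤ} {z' : D'.Strands → ℤ}
    (hz : D.IsCutting z) (hz' : D'.IsCutting z') :
    VSpace.Isom (D.flow z).space (D'.flow z').space := by
  refine (isom_of_isCutting hz (ι.isCutting _ hz')).trans ?_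
  have hhs : ∀ a s, D'.head (ι.edge a) = .split (ι.split s) ↔ D.head a = .split s := by
    intro a s
    rw [ι.head_edge]
    rcases D.head a with i | s' | ⟨m', b⟩ <;> simp [Head.map]
  have hhm : ∀ a m b, D'.head (ι.edge a) = .merge (ι.merge m) b ↔ D.head a = .merge m b := by
    intro a s b
    rw [ι.head_edge]
    rcases D.head a with i | s' | ⟨m', b⟩ <;> simp [Head.map]
  have hts : ∀ a s b, D'.tail (ι.edge a) = .split (ι.split s) b ↔ D.tail a = .split s b := by
    intro a s b
    rw [ι.tail_edge]
    rcases D.tail a with i | ⟨s', b⟩ | m' <;> simp [Tail.map]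
  have htm : ∀ a m, D'.tail (ι.edge a) = .merge (ι.merge m) ↔ D.tail a = .merge m := by
    intro a s
    rw [ι.tail_edge]
    rcases D.tail a with i | ⟨s', b⟩ | m' <;> simp [Tail.map]
  let e : D.Strands ≃ D'.Strands := Equiv.sumCongr ι.edge ι.loop
  refine isom_of_models (fun x => (D'.flow z').space.chart (e x))
    (fun y => (D.flow (z' ∘ Sum.map ι.edge ι.loop)).space.chart (e.symm y)) ?_ ?_
    (fun x => VSpace.isLocal_chart (Y := (D'.flow z').space) _)
    (fun x => VSpace.isLocal_chart (Y := (D.flow _).space) _) ?_ ?_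
  · refine isModel_flow _ _ _ ?_ ?_ ?_
    · intro s b a c ha hc t
      exact chart_split z' ((hhs _ _).2 ha) ((hts _ _ _).2 hc) t
    · intro s b a c ha hc t
      exact chart_merge z' ((hhm _ _ _).2 ha) ((htm _ _).2 hc) t
    · intro l t
      exact chart_loop z' _ t
  · refine isModel_flow _ _ _ ?_ ?_ ?_
    · intro s b a c ha hc t
      obtain ⟨s, rfl⟩ := ι.split.surjective s
      obtain ⟨a, rfl⟩ := ι.edge.surjective a
      obtain ⟨c, rfl⟩ := ι.edge.surjective c
      have := chart_split (z' ∘ Sum.map ι.edge ι.loop) ((hhs _ _).1 ha) ((hts _ _ _).1 hc) t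
      simp only [e, Equiv.sumCongr_symm, Equiv.sumCongr_apply, Sum.map_inl,
        Equiv.symm_apply_apply]
      exact this
    · intro s b a c ha hc t
      obtain ⟨s, rfl⟩ := ι.merge.surjective s
      obtain ⟨a, rfl⟩ := ι.edge.surjective a
      obtain ⟨c, rfl⟩ := ι.edge.surjective c
      have := chart_merge (z' ∘ Sum.map ι.edge ι.loop) ((hhm _ _ _).1 ha) ((htm _ _).1 hc) t
      simp only [e, Equiv.sumCongr_symm, Equiv.sumCongr_apply, Sum.map_inl,
        Equiv.symm_apply_apply]
      exact this
    · intro l t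
      obtain ⟨l, rfl⟩ := ι.loop.surjective l
      have := chart_loop (z' ∘ Sum.map ι.edge ι.loop) l t
      simp only [e, Equiv.sumCongr_symm, Equiv.sumCongr_apply, Sum.map_inr,
        Equiv.symm_apply_apply]
      exact this
  · intro f hf y t
    refine (hf _ _).trans ?_
    rw [Equiv.apply_symm_apply]
  · intro f hf y t
    refine (hf _ _).trans ?_
    rw [Equiv.symm_apply_apply]

end ClosedStrandDiagram

/-! ### Existence of spliced graphs -/

/-- For a partial injection zigzags can be straightened: two elements reachable from a common
element, or reaching a common one, are reachable one from the other. -/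
theorem eqvGen_iff_reflTransGen {X : Type} {r : X → X → Prop}
    (hr : ∀ x y y', r x y → r x y' → y = y') (hl : ∀ x x' y, r x y → r x' y → x = x') {x y : X} :
    Relation.EqvGen r x y ↔ Relation.ReflTransGen r x y ∨ Relation.ReflTransGen r y x := by
  constructor
  · intro h
    induction h with
    | rel x y h => exact Or.inl (.single h)
    | refl x => exact Or.inl .refl
    | symm x y _ ih => exact ih.symm
    | trans x y z _ _ ih ih' =>
      rcases ih with h | h <;> rcases ih' with h' | h'
      · exact Or.inl (h.trans h')
      · have hs : Relator.RightUnique (Function.swap r) := fun a b c h h' => hl _ _ _ h h'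
        rcases Relation.ReflTransGen.total_of_right_unique hs (Relation.reflTransGen_swap.2 h)
          (Relation.reflTransGen_swap.2 h') with h | h
        · exact Or.inr (Relation.reflTransGen_swap.1 h)
        · exact Or.inl (Relation.reflTransGen_swap.1 h)
      · have hs : Relator.RightUnique r := fun a b c h h' => hr _ _ _ h h'
        exact Relation.ReflTransGen.total_of_right_unique hs h h'
      · exact Or.inr (h'.trans h)
  · have : ∀ {x y}, Relation.ReflTransGen r x y → Relation.EqvGen r x y := by
      intro x y h
      induction h with
      | refl => exact .refl _
      | tail _ h ih => exact ih.trans _ _ _ (.rel _ _ h)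
    rintro (h | h)
    · exact this h
    · exact (this h).symm

/-- A chain of a finite injective relation that starts somewhere also ends somewhere. -/
theorem exists_reflTransGen_terminal {X : Type} [Finite X] {r : X → X → Prop}
    (hl : ∀ x x' y, r x y → r x' y → x = x') {x : X} (hx : ∀ y, ¬ r y x) :
    ∃ y, Relation.ReflTransGen r x y ∧ ∀ z, ¬ r y z := by
  by_contra! h
  choose! f hf using h
  -- If the chain never stopped, the successor map would be an injective self-map of the finite set
  -- of elements reachable from `x`. It would then be surjective, and `x` would have a predecessor.
  let g : {y // Relation.ReflTransGen r x y} → {y // Relation.ReflTransGen r x y} :=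
    fun y => ⟨f y.1, y.2.tail (hf y.1 y.2)⟩
  have hg : Function.Injective g := by
    intro y y' h
    have h' : f y.1 = f y'.1 := congrArg Subtype.val h
    refine Subtype.ext (hl _ _ (f y.1) (hf _ y.2) ?_)
    rw [h']
    exact hf _ y'.2
  obtain ⟨y, hy⟩ := Finite.injective_iff_surjective.1 hg ⟨x, .refl⟩
  have h' : f y.1 = x := congrArg Subtype.val hy
  have h2 := hf y.1 y.2
  rw [h'] at h2
  exact hx y.1 h2

/-- The strands of the new graph are the connected chains of linked strands. By finiteness a chain
that has a beginning at a kept vertex also has an end at a kept vertex, and is an edge; the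
remaining chains become free loops. -/
theorem exists_splicing {I O : Type} [Finite I] {G : StrandGraph I O} {S₀ : Set G.Split}
    {M₀ : Set G.Merge} {X₀ : Set G.Strands} {link : G.Edge → G.Edge → Prop}
    (hL : G.IsGluing S₀ M₀ X₀ link) :
    ∃ G' : StrandGraph Empty Empty, Nonempty (Splicing G G' S₀ M₀ X₀ link) := by
  classical
  have := G.finite_strands
  have := G.finite_split
  have := G.finite_merge
  let X := {x : G.Strands // x ∉ X₀}
  let r : X → X → Prop := fun x y => ∃ a b, x.1 = Sum.inl a ∧ y.1 = Sum.inl b ∧ link a b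
  have hru : ∀ x y y', r x y → r x y' → y = y' := by
    rintro ⟨x, hx⟩ ⟨y, hy⟩ ⟨y', hy'⟩ ⟨a, b, rfl, rfl, h⟩ ⟨a', b', h1, rfl, h'⟩
    obtain rfl := Sum.inl_injective h1
    exact Subtype.ext (congrArg Sum.inl (hL.right_unique _ _ _ h h'))
  have hlu : ∀ x x' y, r x y → r x' y → x = x' := by
    rintro ⟨x, hx⟩ ⟨x', hx'⟩ ⟨y, hy⟩ ⟨a, b, rfl, rfl, h⟩ ⟨a', b', rfl, h1, h'⟩
    obtain rfl := Sum.inl_injective h1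
    exact Subtype.ext (congrArg Sum.inl (hL.left_unique _ _ _ h h'))
  let st : Setoid X := Relation.EqvGen.setoid r
  have hst : ∀ x y : X, (Quotient.mk st x = Quotient.mk st y) ↔ Relation.EqvGen r x y :=
    fun x y => Quotient.eq
  have hst' : ∀ x y : X, (Quotient.mk st x = Quotient.mk st y) ↔
      Relation.ReflTransGen r x y ∨ Relation.ReflTransGen r y x :=
    fun x y => (hst x y).trans (eqvGen_iff_reflTransGen hru hlu)
  let T := Tail Empty {s // s ∉ S₀} {m // m ∉ M₀}
  let H := Head Empty {s // s ∉ S₀} {m // m ∉ M₀}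
  let ft : T → G.Edge := fun t => G.tail.symm (t.map Empty.elim Subtype.val Subtype.val)
  let lh : H → G.Edge := fun h => G.head.symm (h.map Empty.elim Subtype.val Subtype.val)
  have hft : ∀ t, G.KeptTail S₀ M₀ (ft t) := fun t => ⟨t, by simp [ft]⟩
  have hlh : ∀ h, G.KeptHead S₀ M₀ (lh h) := fun h => ⟨h, by simp [lh]⟩
  have hftX : ∀ t, Sum.inl (ft t) ∉ X₀ := fun t h => hL.not_keptTail _ h (hft t)
  have hlhX : ∀ t, Sum.inl (lh t) ∉ X₀ := fun t h => hL.not_keptHead _ h (hlh t)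
  let first : T → X := fun t => ⟨Sum.inl (ft t), hftX t⟩
  let last : H → X := fun h => ⟨Sum.inl (lh h), hlhX h⟩
  have hfirst : ∀ t y, ¬ r y (first t) := by
    rintro t ⟨y, hy⟩ ⟨a, b, h1, h2, h⟩
    have h2' : ft t = b := Sum.inl_injective h2
    exact hL.right_not_kept _ _ h (h2' ▸ hft t)
  have hlast : ∀ h y, ¬ r (last h) y := by
    rintro t ⟨y, hy⟩ ⟨a, b, h1, h2, h⟩
    have h1' : lh t = a := Sum.inl_injective h1
    exact hL.left_not_kept _ _ h (h1' ▸ hlh t)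
  have hfi : ∀ t t', Quotient.mk st (first t) = Quotient.mk st (first t') → t = t' := by
    intro t t' h
    have : first t = first t' := by
      rcases (hst' _ _).1 h with h | h
      · rcases Relation.ReflTransGen.cases_tail h with h | ⟨y, _, h⟩
        · exact h.symm
        · exact absurd h (hfirst _ _)
      · rcases Relation.ReflTransGen.cases_tail h with h | ⟨y, _, h⟩
        · exact h
        · exact absurd h (hfirst _ _)
    have h1 : ft t = ft t' := Sum.inl_injective (congrArg Subtype.val this)
    exact Tail.map_injective (fun x => x.elim) Subtype.val_injective Subtype.val_injective
      (G.tail.symm.injective h1)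
  have hli : ∀ t t', Quotient.mk st (last t) = Quotient.mk st (last t') → t = t' := by
    intro t t' h
    have : last t = last t' := by
      rcases (hst' _ _).1 h with h | h
      · rcases Relation.ReflTransGen.cases_head h with h | ⟨y, h, _⟩
        · exact h
        · exact absurd h (hlast _ _)
      · rcases Relation.ReflTransGen.cases_head h with h | ⟨y, h, _⟩
        · exact h.symm
        · exact absurd h (hlast _ _)
    have h1 : lh t = lh t' := Sum.inl_injective (congrArg Subtype.val this)
    exact Head.map_injective (fun x => x.elim) Subtype.val_injective Subtype.val_injective
      (G.head.symm.injective h1)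
  -- A chain followed forwards from a kept start must stop, and it can only stop where no link
  -- applies, at a kept end. The next claim is the same statement backwards.
  have hfl : ∀ t, ∃ h, Quotient.mk st (first t) = Quotient.mk st (last h) := by
    intro t
    obtain ⟨y, hy, hy'⟩ := exists_reflTransGen_terminal hlu (hfirst t)
    obtain ⟨a, ha⟩ : ∃ a, y.1 = Sum.inl a := by
      rcases Relation.ReflTransGen.cases_tail hy with h | ⟨x, _, a, b, _, h, _⟩
      · exact ⟨ft t, by rw [h]⟩
      · exact ⟨b, h⟩
    have hk : G.KeptHead S₀ M₀ a := by
      by_contra hk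
      obtain ⟨b, hb⟩ := hL.exists_right a (ha ▸ y.2) hk
      exact hy' ⟨Sum.inl b, hL.right_not_mem _ _ hb⟩ ⟨a, b, ha, rfl, hb⟩
    obtain ⟨h, hh⟩ := hk
    refine ⟨h, (hst' _ _).2 (Or.inl ?_)⟩
    have : y = last h := Subtype.ext (by
      rw [ha]
      exact congrArg _ (by rw [Equiv.eq_symm_apply, hh]))
    rwa [this] at hy
  have hlf : ∀ h, ∃ t, Quotient.mk st (last h) = Quotient.mk st (first t) := by
    intro t
    obtain ⟨y, hy, hy'⟩ := exists_reflTransGen_terminal (r := Function.swap r)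
      (fun x x' y h h' => hru _ _ _ h h') (hlast t)
    rw [Relation.reflTransGen_swap] at hy
    obtain ⟨a, ha⟩ : ∃ a, y.1 = Sum.inl a := by
      rcases Relation.ReflTransGen.cases_head hy with h | ⟨x, ⟨a, b, h, _, _⟩, _⟩
      · exact ⟨lh t, by rw [h]⟩
      · exact ⟨a, h⟩
    have hk : G.KeptTail S₀ M₀ a := by
      by_contra hk
      obtain ⟨b, hb⟩ := hL.exists_left a (ha ▸ y.2) hk
      exact hy' ⟨Sum.inl b, hL.left_not_mem _ _ hb⟩ ⟨b, a, rfl, ha, hb⟩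
    obtain ⟨h, hh⟩ := hk
    refine ⟨h, (hst' _ _).2 (Or.inr ?_)⟩
    have : y = first h := Subtype.ext (by
      rw [ha]
      exact congrArg _ (by rw [Equiv.eq_symm_apply, hh]))
    rwa [this] at hy
  let isEdge : Quotient st → Prop := fun c => ∃ t, c = Quotient.mk st (first t)
  let tl : T ≃ {c // isEdge c} := Equiv.ofBijective (fun t => ⟨Quotient.mk st (first t), t, rfl⟩)
    ⟨fun t t' h => hfi t t' (congrArg Subtype.val h), fun ⟨c, t, h⟩ => ⟨t, Subtype.ext h.symm⟩⟩
  let hd : H ≃ {c // isEdge c} := Equiv.ofBijective (fun h => ⟨Quotient.mk st (last h), hlf h⟩)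
    ⟨fun t t' h => hli t t' (congrArg Subtype.val h), by
      rintro ⟨c, t, rfl⟩
      obtain ⟨h, hh⟩ := hfl t
      exact ⟨h, Subtype.ext hh.symm⟩⟩
  have : Finite X := inferInstance
  have : Finite (Quotient st) := inferInstance
  let G' : StrandGraph Empty Empty :=
    { Split := {s // s ∉ S₀}
      Merge := {m // m ∉ M₀}
      Edge := {c // isEdge c}
      Loop := {c // ¬ isEdge c}
      finite_split := inferInstance
      finite_merge := inferInstance
      finite_loop := inferInstance
      tail := tl.symm
      head := hd.symm }
  let q' : Quotient st ≃ G'.Strands := (Equiv.sumCompl isEdge).symm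
  refine ⟨G', ⟨⟨Equiv.refl _, Equiv.refl _, fun x => q' (Quotient.mk st x), ?_, ?_, ?_, ?_⟩⟩⟩
  · exact q'.surjective.comp Quotient.mk_surjective
  · intro x y
    rw [q'.apply_eq_iff_eq]
    exact hst x y
  · intro t a ha hat
    change q' _ = Sum.inl (tl t)
    have : (⟨Sum.inl a, ha⟩ : X) = first t := Subtype.ext (congrArg Sum.inl (by
      rw [Equiv.eq_symm_apply]
      exact hat))
    rw [this]
    exact Equiv.sumCompl_symm_apply_of_pos (p := isEdge) _
  · intro t a ha hat
    change q' _ = Sum.inl (hd t)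
    have : (⟨Sum.inl a, ha⟩ : X) = last t := Subtype.ext (congrArg Sum.inl (by
      rw [Equiv.eq_symm_apply]
      exact hat))
    rw [this]
    exact Equiv.sumCompl_symm_apply_of_pos (p := isEdge) _

/-! ### Potentials -/

/-- If every closed walk in a finite graph has positive weight, then some multiple of the weight is
positive on all edges up to a coboundary. -/
theorem exists_potential_of_pos {E : Type} [Finite E] (r : E → E → Prop) (z : E → ℤ)
    (hz : ∀ (n : ℕ) (γ : ℕ → E), (∀ i ≤ n, r (γ i) (γ (i + 1))) → γ (n + 1) = γ 0 →
      0 < ∑ i ∈ Finset.range (n + 1), z (γ i)) :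
    ∃ (K : ℤ) (p : E → ℤ), 0 < K ∧ ∀ a b, r a b → 1 ≤ K * z a + p b - p a := by
  have := Fintype.ofFinite E
  set N := Fintype.card E with hN
  -- A closed walk of length at most `N` has integral weight at least one, so the modified weight of
  -- such a walk is at least `(N + 1) - N > 0`. Subtracting one per edge thus creates no negative
  -- short cycles.
  set c : E → ℤ := fun e => (N + 1) * z e - 1 with hc
  obtain ⟨C, hC⟩ : ∃ C : ℤ, ∀ e, -C ≤ c e := by
    obtain ⟨C, hC⟩ := (Set.finite_range fun e => - c e).bddAbove
    exact ⟨C, fun e => neg_le.1 (hC ⟨e, rfl⟩)⟩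
  have hC' : ∀ e, -(max C 0) ≤ c e := fun e => le_trans (by simp) (hC e)
  -- A walk with more than `N` edges repeats one of them among the first `N + 1`; cutting out the
  -- cycle in between does not increase the modified weight.
  have hbound : ∀ (n : ℕ) (γ : ℕ → E), (∀ i < n, r (γ i) (γ (i + 1))) →
      -((N : ℤ) * max C 0) ≤ ∑ i ∈ Finset.range n, c (γ i) := by
    intro n
    induction n using Nat.strong_induction_on with
    | _ n ih =>
    intro γ hγ
    rcases Nat.lt_or_ge N n with hn | hn
    · obtain ⟨i, j, hij, hγij⟩ : ∃ i j : Fin (N + 1), i ≠ j ∧ γ i = γ j :=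
        Fintype.exists_ne_map_eq_of_card_lt (fun i : Fin (N + 1) => γ i) (by simp [hN])
      wlog hlt : i.1 < j.1 generalizing i j
      · refine this j i hij.symm hγij.symm ?_
        have : i.1 ≠ j.1 := fun h => hij (Fin.ext h)
        omega
      obtain ⟨d, hd⟩ : ∃ d, j.1 = i.1 + (d + 1) := ⟨j.1 - i.1 - 1, by omega⟩
      obtain ⟨m, hm⟩ : ∃ m, n = i.1 + ((d + 1) + m) := ⟨n - j.1, by omega⟩
      have h1 := hz d (fun t => γ (i.1 + t)) (fun t ht => hγ _ (by omega)) (by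
        rw [← hd, add_zero, hγij])
      have h2 := ih (i.1 + m) (by omega) (fun t => if t ≤ i.1 then γ t else γ (t + (d + 1))) (by
        intro t ht
        rcases lt_trichotomy t i.1 with h | h | h
        · simpa [h.le, Nat.succ_le_of_lt h] using hγ t (by omega)
        · have := hγ (j.1) (by omega)
          simp only [h, le_refl, if_true]
          rw [if_neg (by omega), hγij]
          convert this using 2
          omega
        · simp only [if_neg (not_le.2 h), if_neg (not_le.2 (h.trans (Nat.lt_succ_self t)))]
          have := hγ (t + (d + 1)) (by omega)
          convert this using 2
          omega)
      rw [hm, Finset.sum_range_add, Finset.sum_range_add]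
      rw [Finset.sum_range_add] at h2
      have e1 : ∑ t ∈ Finset.range i.1, c (if t ≤ i.1 then γ t else γ (t + (d + 1)))
          = ∑ t ∈ Finset.range i.1, c (γ t) :=
        Finset.sum_congr rfl fun t ht => by rw [if_pos (Finset.mem_range.1 ht).le]
      have e2 : ∑ t ∈ Finset.range m, c (if i.1 + t ≤ i.1 then γ (i.1 + t)
            else γ (i.1 + t + (d + 1)))
          = ∑ t ∈ Finset.range m, c (γ (i.1 + (d + 1 + t))) :=
        Finset.sum_congr rfl fun t ht => by
          split_ifs with h
          · obtain rfl : t = 0 := by omega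
            rw [add_zero, add_zero, hγij, hd]
          · congr 2
            omega
      have e3 : ∑ t ∈ Finset.range (d + 1), c (γ (i.1 + t))
          = (N + 1) * ∑ t ∈ Finset.range (d + 1), z (γ (i.1 + t)) - (d + 1) := by
        simp [hc, Finset.mul_sum]
      rw [e1, e2] at h2
      have hdN : (d : ℤ) + 1 ≤ N := by omega
      have : (N : ℤ) + 1 ≤ (N + 1) * ∑ t ∈ Finset.range (d + 1), z (γ (i.1 + t)) :=
        le_mul_of_one_le_right (by positivity) h1
      linarith
    · have h1 : ∑ i ∈ Finset.range n, -(max C 0) ≤ ∑ i ∈ Finset.range n, c (γ i) :=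
        Finset.sum_le_sum fun i _ => hC' _
      rw [Finset.sum_const, Finset.card_range, nsmul_eq_mul] at h1
      have h2 : (n : ℤ) * max C 0 ≤ N * max C 0 :=
        mul_le_mul_of_nonneg_right (by exact_mod_cast hn) (le_max_right _ _)
      linarith
  -- The potential is minus the least modified weight of a walk ending at the edge, as for shortest
  -- paths; extending a walk by one edge gives the inequality.
  let W : E → Set ℤ := fun e => {s | ∃ (n : ℕ) (γ : ℕ → E), (∀ i < n, r (γ i) (γ (i + 1))) ∧
    γ n = e ∧ s = ∑ i ∈ Finset.range n, c (γ i)}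
  have hWb : ∀ e, BddBelow (W e) := fun e => ⟨_, by
    rintro _ ⟨n, γ, h, _, rfl⟩
    exact hbound n γ h⟩
  have hWn : ∀ e, (W e).Nonempty := fun e => ⟨0, 0, fun _ => e, by simp, rfl, by simp⟩
  refine ⟨N + 1, fun e => - sInf (W e), by positivity, fun a b hab => ?_⟩
  obtain ⟨n, γ, hγ, hn, hs⟩ := Int.csInf_mem (hWn a) (hWb a)
  have : sInf (W b) ≤ sInf (W a) + c a := by
    refine csInf_le (hWb b) ⟨n + 1, fun i => if i ≤ n then γ i else b, ?_, by simp, ?_⟩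
    · intro i hi
      rcases Nat.lt_or_ge i n with h | h
      · simpa [h.le, Nat.succ_le_of_lt h] using hγ i h
      · obtain rfl : i = n := by omega
        simpa [hn] using hab
    · rw [Finset.sum_range_succ, hs]
      congr 1
      · exact Finset.sum_congr rfl fun i hi => by simp [(Finset.mem_range.1 hi).le]
      · simp [hn]
  simp only [hc] at this
  linarith

namespace StrandGraph

variable {I O : Type} {G : StrandGraph I O}

theorem exists_potential [Finite I] {z : G.Strands → ℤ} (hz : G.PositiveOnCycles z) :
    ∃ (K : ℤ) (p : G.Edge → ℤ), 0 < K ∧ ∀ a b, G.tgt a = G.src b →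
      1 ≤ K * z (Sum.inl a) + p b - p a := by
  have := G.finite_edge
  refine exists_potential_of_pos (fun a b => G.tgt a = G.src b) (fun e => z (Sum.inl e)) ?_
  intro n γ h h0
  rw [Finset.sum_range]
  exact hz.1 n _ (isDirectedCycle_of_nat h h0)

/-- Summed around a cycle, the potential differences cancel, and what remains is `K` times the
weight, at least the length of the cycle. -/
theorem positiveOnCycles_of_potential {z : G.Strands → ℤ} {K : ℤ} {p : G.Edge → ℤ} (hK : 0 < K)
    (hp : ∀ a b, G.tgt a = G.src b → 1 ≤ K * z (Sum.inl a) + p b - p a)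
    (hl : ∀ l, 0 < z (Sum.inr l)) : G.PositiveOnCycles z := by
  refine ⟨fun n γ hγ => ?_, hl⟩
  have h1 : ∑ i, p (γ (i + 1)) = ∑ i, p (γ i) :=
    Equiv.sum_comp (Equiv.addRight (1 : Fin (n + 1))) fun i => p (γ i)
  have h2 : ∑ i : Fin (n + 1), (1 : ℤ) ≤
      ∑ i, (K * z (Sum.inl (γ i)) + p (γ (i + 1)) - p (γ i)) :=
    Finset.sum_le_sum fun i _ => hp _ _ (hγ i)
  rw [Finset.sum_sub_distrib, Finset.sum_add_distrib, h1, ← Finset.mul_sum] at h2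
  simp only [Finset.sum_const, Finset.card_univ, Fintype.card_fin, nsmul_eq_mul] at h2
  push_cast at h2
  by_contra! h
  have := mul_nonpos_of_nonneg_of_nonpos hK.le h
  linarith

theorem PositiveOnCycles.add_coboundary {z : G.Strands → ℤ} (hz : G.PositiveOnCycles z)
    (f : G.Vertices → ℤ) : G.PositiveOnCycles (z + G.coboundary f) := by
  refine ⟨fun n γ hγ => ?_, fun l => ?_⟩
  · have h1 : ∑ i, f (G.src (γ (i + 1))) = ∑ i, f (G.src (γ i)) :=
      Equiv.sum_comp (Equiv.addRight (1 : Fin (n + 1))) fun i => f (G.src (γ i))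
    have h2 : ∀ i, (z + G.coboundary f) (Sum.inl (γ i))
        = z (Sum.inl (γ i)) + (f (G.src (γ (i + 1))) - f (G.src (γ i))) := by
      intro i
      rw [← hγ i]
      rfl
    simp only [h2, Finset.sum_add_distrib, Finset.sum_sub_distrib, h1, sub_self, add_zero]
    exact hz.1 n γ hγ
  · exact (hz.2 l).trans_eq (add_zero _).symm

end StrandGraph

/-- A potential is a local certificate of positivity: the inequalities for the parts of a strand add
up to an inequality for the strand, and the values at the first parts form a potential for the new
edges. So no cycle of the new graph has to be lifted to the old one. -/
theorem Splicing.potential_push {I O : Type} [Finite I] {G : StrandGraph I O}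
    {G' : StrandGraph Empty Empty} {S₀ : Set G.Split} {M₀ : Set G.Merge} {X₀ : Set G.Strands}
    {link : G.Edge → G.Edge → Prop} (P : Splicing G G' S₀ M₀ X₀ link)
    (hL : G.IsGluing S₀ M₀ X₀ link) {w : G.Strands → ℤ} {K : ℤ} {p : G.Edge → ℤ} (hK : 0 < K)
    (hp : ∀ a b, G.KeptHead S₀ M₀ a → G.tgt a = G.src b →
      1 ≤ K * w (Sum.inl a) + p b - p a)
    (hlink : ∀ a b, link a b → 1 ≤ K * w (Sum.inl a) + p b - p a)
    (hl : ∀ l, 0 < w (Sum.inr l)) : G'.PositiveOnCycles (P.push w) := by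
  classical
  have := G.finite_strands
  have := Fintype.ofFinite {x : G.Strands // x ∉ X₀}
  obtain ⟨π, hπlink, hπlast, hπloop, hπq⟩ := exists_perm (P := P) hL
  let p' : {x : G.Strands // x ∉ X₀} → ℤ := fun x => Sum.elim p (fun _ => 0) x.1
  let d : {x : G.Strands // x ∉ X₀} → ℤ := fun x => K * w x.1 + p' (π x) - p' x
  have hd : ∀ x, (∀ e, x ≠ ⟨Sum.inl (P.last e), last_not_mem hL e⟩) → 1 ≤ d x := by
    rintro ⟨a | l, hx⟩ hx'
    · by_cases hk : G.KeptHead S₀ M₀ a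
      · obtain ⟨e, rfl⟩ := P.exists_last hk
        exact absurd rfl (hx' e)
      · obtain ⟨c, hc⟩ := hL.exists_right a hx hk
        simp only [d]
        rw [hπlink a c hx (hL.right_not_mem _ _ hc) hc]
        exact hlink a c hc
    · simp only [d]
      rw [hπloop]
      have : 1 ≤ K * w (Sum.inr l) := one_le_mul_of_one_le_of_one_le hK (hl l)
      linarith
  have hqπ : ∀ x, P.q (π x) = P.q x := fun x =>
    (hπq _ _).2 (Equiv.Perm.sameCycle_apply_left.2 (.refl _ _))
  have hpush : ∀ y, P.push w y = ∑ x with P.q x = y, w x.1 := fun y => by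
    rw [Splicing.push, ← finsum_mem_coe_finset]
    simp
  -- Over all parts of one strand, closed up by `π`, the potential differences cancel.
  have hsum : ∀ y, ∑ x with P.q x = y, d x = K * P.push w y := by
    intro y
    have h1 : ∑ x with P.q x = y, p' (π x) = ∑ x with P.q x = y, p' x := by
      refine Finset.sum_bijective π π.bijective ?_ fun _ _ => rfl
      intro x
      simp [hqπ]
    simp only [d]
    rw [Finset.sum_sub_distrib, Finset.sum_add_distrib, h1, hpush, Finset.mul_sum]
    ring
  refine StrandGraph.positiveOnCycles_of_potential (p := fun e => p (P.first e)) hK ?_ ?_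
  · intro e e' hee'
    have h1 : G.tgt (P.last e) = G.src (P.first e') := by
      simp only [StrandGraph.tgt, StrandGraph.src, P.head_last, P.tail_first] at hee' ⊢
      revert hee'
      rcases G'.head e with x | s | ⟨m, b⟩ <;> rcases G'.tail e' with x' | ⟨s', b'⟩ | m' <;>
        simp +contextual [Head.vertex, Tail.vertex, Head.map, Tail.map]
    have h2 := hp _ _ (P.keptHead_last e) h1
    rw [← hsum, ← Finset.add_sum_erase _ _
      (show (⟨Sum.inl (P.last e), last_not_mem hL e⟩ : {x : G.Strands // x ∉ X₀}) ∈ _ by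
        simp [q_last hL])]
    have h3 : 0 ≤ ∑ x ∈ (Finset.univ.filter fun x => P.q x = Sum.inl e).erase
        ⟨Sum.inl (P.last e), last_not_mem hL e⟩, d x := by
      refine Finset.sum_nonneg fun x hx => ?_
      simp only [Finset.mem_erase, Finset.mem_filter, Finset.mem_univ, true_and] at hx
      have := hd x (by
        rintro e' rfl
        rw [q_last hL] at hx
        obtain rfl := Sum.inl_injective hx.2
        exact hx.1 rfl)
      omega
    have h4 : d ⟨Sum.inl (P.last e), last_not_mem hL e⟩
        = K * w (Sum.inl (P.last e)) + p (P.first e) - p (P.last e) := by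
      simp only [d]
      rw [hπlast]
      rfl
    linarith
  · intro l
    obtain ⟨x, hx⟩ := P.q_surjective (Sum.inr l)
    have h1 : 0 < ∑ x with P.q x = Sum.inr l, d x := by
      refine Finset.sum_pos (fun x hx => ?_) ⟨x, by simpa using hx⟩
      simp only [Finset.mem_filter, Finset.mem_univ, true_and] at hx
      refine hd x ?_
      rintro e rfl
      rw [q_last hL] at hx
      cases hx
    rw [hsum] at h1
    exact (mul_pos_iff_of_pos_left hK).1 h1

/-- Positivity is demanded of all cochains in the class; the potential proves it for the pushed
cochain, and coboundaries do not affect cycles. -/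
theorem exists_closedStrandDiagram {I O : Type} [Finite I] {G : StrandGraph I O}
    {S₀ : Set G.Split} {M₀ : Set G.Merge} {X₀ : Set G.Strands} {link : G.Edge → G.Edge → Prop}
    (hL : G.IsGluing S₀ M₀ X₀ link) {w : G.Strands → ℤ} {K : ℤ} {p : G.Edge → ℤ} (hK : 0 < K)
    (hp : ∀ a b, G.KeptHead S₀ M₀ a → G.tgt a = G.src b →
      1 ≤ K * w (Sum.inl a) + p b - p a)
    (hlink : ∀ a b, link a b → 1 ≤ K * w (Sum.inl a) + p b - p a)
    (hl : ∀ l, 0 < w (Sum.inr l)) :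
    ∃ (D : ClosedStrandDiagram) (P : Splicing G D.toStrandGraph S₀ M₀ X₀ link),
      D.IsCutting (P.push w) := by
  obtain ⟨G', ⟨P⟩⟩ := exists_splicing hL
  refine ⟨⟨G', QuotientAddGroup.mk (P.push w), fun z hz => ?_⟩, P, rfl⟩
  rw [eq_comm, QuotientAddGroup.eq] at hz
  obtain ⟨f, hf⟩ := hz
  have := (P.potential_push hL hK hp hlink hl).add_coboundary f
  rwa [hf, add_neg_cancel_left] at this

/-! ### Configurations excluded in reduced diagrams, and termination of reduction -/

namespace ClosedStrandDiagram

open StrandGraph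

variable {D D' : ClosedStrandDiagram}

theorem IsCutting.positiveOnCycles {z : D.Strands → ℤ} (hz : D.IsCutting z) :
    D.PositiveOnCycles z := D.positive z hz

/-- Reducedness denies the existence of a diagram to reduce to. To exploit it, the result of the
move must be constructed as a closed strand diagram, with a positive cutting class. -/
theorem IsReduced.not_merge_split (hD : D.IsReduced) {m : D.Merge} {s : D.Split} {e : D.Edge}
    (he : D.tail e = .merge m) (he' : D.head e = .split s) : False := by
  classical
  obtain ⟨z, hz⟩ := exists_isCutting D
  obtain ⟨K, p, hK, hp⟩ := exists_potential hz.positiveOnCycles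
  let w : D.Strands → ℤ := fun x =>
    z x + if ∃ a k, x = Sum.inl a ∧ D.head a = .merge m k then z (Sum.inl e) else 0
  obtain ⟨D', P, hP⟩ : ∃ (D' : ClosedStrandDiagram)
      (P : Splicing D.toStrandGraph D'.toStrandGraph _ _ _ _), D'.IsCutting (P.push w) := by
    refine exists_closedStrandDiagram (isGluing_I he he') (p := p) hK ?_ ?_ ?_
    · intro a b ha hab
      simp only [w]
      rw [if_neg, add_zero]
      · exact hp a b hab
      · rintro ⟨a', k, h, h'⟩
        obtain rfl := Sum.inl_injective h
        simp [keptHead_iff, h'] at ha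
    · rintro a b ⟨k, ha, hb⟩
      simp only [w]
      rw [if_pos ⟨a, k, rfl, ha⟩]
      -- The inequality for the glued strand is the sum of the inequalities for entering and for
      -- leaving `e`.
      have h1 := hp a e (tgt_eq_src_merge ha he)
      have h2 := hp e b (tgt_eq_src_split he' hb)
      linarith
    · intro l
      simp only [w]
      rw [if_neg (by simp), add_zero]
      exact hz.positiveOnCycles.2 l
  refine hD ⟨D', Or.inl ⟨m, s, e, he, he', P, z, hz, ?_⟩⟩
  convert hP

theorem IsReduced.not_parallel (hD : D.IsReduced) {s : D.Split} {m : D.Merge} {a b : D.Edge}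
    (ha : D.tail a = .split s false) (ha' : D.head a = .merge m false)
    (hb : D.tail b = .split s true) (hb' : D.head b = .merge m true) {z : D.Strands → ℤ}
    (hz : D.IsCutting z) : z (Sum.inl a) ≠ z (Sum.inl b) := by
  classical
  intro hab
  obtain ⟨K, p, hK, hp⟩ := exists_potential hz.positiveOnCycles
  let w : D.Strands → ℤ := fun x =>
    z x + if x = Sum.inl (D.head.symm (.split s)) then z (Sum.inl a) else 0
  obtain ⟨D', P, hP⟩ : ∃ (D' : ClosedStrandDiagram)
      (P : Splicing D.toStrandGraph D'.toStrandGraph _ _ _ _), D'.IsCutting (P.push w) := by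
    refine exists_closedStrandDiagram (isGluing_II ha ha' hb hb') (p := p) hK ?_ ?_ ?_
    · intro x y hx hxy
      simp only [w]
      rw [if_neg, add_zero]
      · exact hp x y hxy
      · intro h
        rw [Sum.inl.injEq, Equiv.eq_symm_apply] at h
        simp [keptHead_iff, h] at hx
    · rintro x y ⟨hx, hy⟩
      simp only [w]
      rw [if_pos (by rw [Sum.inl.injEq, Equiv.eq_symm_apply, hx])]
      have h1 := hp x a (tgt_eq_src_split hx ha)
      have h2 := hp a y (tgt_eq_src_merge ha' hy)
      linarith
    · intro l
      simp only [w]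
      rw [if_neg (by simp), add_zero]
      exact hz.positiveOnCycles.2 l
  refine hD ⟨D', Or.inr (Or.inl ⟨s, m, a, b, ha, ha', hb, hb', P, z, hz, hab, ?_⟩)⟩
  convert hP

theorem IsReduced.loop_injective (hD : D.IsReduced) {z : D.Strands → ℤ} (hz : D.IsCutting z) :
    Function.Injective fun l => z (Sum.inr l) := by
  intro l l' hll
  by_contra hne
  obtain ⟨K, p, hK, hp⟩ := exists_potential hz.positiveOnCycles
  obtain ⟨D', P, hP⟩ := exists_closedStrandDiagram (isGluing_III (G := D.toStrandGraph) l')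
    (w := z) (p := p) hK (fun a b _ h => hp a b h) (fun a b h => h.elim)
    hz.positiveOnCycles.2
  exact hD ⟨D', Or.inr (Or.inr ⟨l, l', hne, P, z, hz, hll, hP⟩)⟩

/-- Moves I and II erase a split; move III keeps the splits and erases a strand. -/
theorem Reduces.lt (h : Reduces D D') :
    Prod.Lex (· < ·) (· < ·) (Nat.card D'.Split, Nat.card D'.Strands)
      (Nat.card D.Split, Nat.card D.Strands) := by
  have := D.finite_split
  have := D.toStrandGraph.finite_strands
  have key : ∀ (s : D.Split) (M₀ : Set D.Merge) (X₀ : Set D.Strands)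
      (link : D.Edge → D.Edge → Prop), Splicing D.toStrandGraph D'.toStrandGraph {s} M₀ X₀ link →
      Nat.card D'.Split < Nat.card D.Split := by
    intro s M₀ X₀ link P
    rw [Nat.card_congr P.σ]
    exact Finite.card_subtype_lt (x := s) (by simp)
  rcases h with ⟨m, s, e, he, he', P, -⟩ | ⟨s, m, a, b, ha, ha', hb, hb', P, -⟩ | ⟨l, l', hll, P, -⟩
  · exact Prod.Lex.left _ _ (key s _ _ _ P)
  · exact Prod.Lex.left _ _ (key s _ _ _ P)
  · have h1 : Nat.card D'.Split = Nat.card D.Split := by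
      rw [Nat.card_congr P.σ]
      exact Nat.card_congr (Equiv.subtypeUnivEquiv (by simp))
    rw [h1]
    refine Prod.Lex.right _ ?_
    refine lt_of_le_of_lt (Nat.card_le_card_of_surjective _ P.q_surjective) ?_
    exact Finite.card_subtype_lt (x := Sum.inr l') (by simp)

theorem exists_isReduced (C : ClosedStrandDiagram) :
    ∃ D : ClosedStrandDiagram, D.IsReduced ∧ Equivalent C D := by
  have hwf : WellFounded (fun D' D : ClosedStrandDiagram => Reduces D D') :=
    Subrelation.wf (fun h => Reduces.lt h)
      (InvImage.wf (fun D : ClosedStrandDiagram => (Nat.card D.Split, Nat.card D.Strands))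
        (WellFounded.prod_lex Nat.lt_wfRel.wf Nat.lt_wfRel.wf))
  induction C using hwf.induction with
  | _ C ih =>
  by_cases h : C.IsReduced
  · exact ⟨C, h, .refl _⟩
  · rw [IsReduced, not_not] at h
    obtain ⟨C', h⟩ := h
    obtain ⟨D, hD, hD'⟩ := ih C' h
    exact ⟨D, hD, (Relation.EqvGen.rel _ _ h).trans _ _ _ hD'⟩

end ClosedStrandDiagram

/-! ### Words -/

/-- An infinite word none of whose extensions by a finite prefix is periodic. -/
def oneWord : Stream' Bool := Stream'.cons true (Stream'.const false)

/-- The word has its only `true` at the start, whereas after a nonempty prefix there is a `true` at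
a positive position. -/
theorem append_oneWord_ne {u : List Bool} (hu : u ≠ []) : u ++ₛ oneWord ≠ oneWord := by
  intro h
  have h1 : (u ++ₛ oneWord).get (u.length + 0) = oneWord.get (u.length + 0) := by rw [h]
  rw [Stream'.get_append_right] at h1
  obtain ⟨b, u, rfl⟩ := List.exists_cons_of_ne_nil hu
  simp [oneWord] at h1

/-- This makes `oneWord` a test tail: an identity between points that end in it can be read as an
identity between finite prefixes. -/
theorem append_oneWord_injective {u v : List Bool} (h : u ++ₛ oneWord = v ++ₛ oneWord) :
    u = v := by
  have key : ∀ (u v : List Bool), u.length ≤ v.length → u ++ₛ oneWord = v ++ₛ oneWord → u = v := by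
    intro u v huv h
    have h1 : u = v.take u.length := by
      have := congrArg (Stream'.take u.length) h
      rwa [Stream'.take_append_of_le_length _ _ _ le_rfl, List.take_length,
        Stream'.take_append_of_le_length _ _ _ huv] at this
    rw [← List.take_append_drop u.length v, ← h1, Stream'.append_append_stream] at h
    have h2 : v.drop u.length ++ₛ oneWord = oneWord := (Stream'.append_right_injective _ _ _ h).symm
    have h3 : v.drop u.length = [] := by
      by_contra hne
      exact append_oneWord_ne hne h2
    rw [List.drop_eq_nil_iff] at h3
    rw [h1, List.take_of_length_le h3]
  rcases le_total u.length v.length with h' | h'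
  · exact key u v h' h
  · exact (key v u h' h.symm).symm

theorem eq_append_of_append_eq {u v : List Bool} {s t : Stream' Bool} (h : u ++ₛ s = v ++ₛ t)
    (huv : u.length ≤ v.length) : ∃ v', v = u ++ v' ∧ s = v' ++ₛ t := by
  have h1 : u = v.take u.length := by
    have := congrArg (Stream'.take u.length) h
    rwa [Stream'.take_append_of_le_length _ _ _ le_rfl, List.take_length,
      Stream'.take_append_of_le_length _ _ _ huv] at this
  refine ⟨v.drop u.length, ?_, ?_⟩
  · conv_lhs => rw [← List.take_append_drop u.length v, ← h1]
  · rw [← List.take_append_drop u.length v, ← h1, Stream'.append_append_stream] at h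
    exact Stream'.append_right_injective _ _ _ h

theorem take_cycle (u : List Bool) (hu : u ≠ []) (N : ℕ) :
    (Stream'.cycle u hu).take (N * u.length) = (List.replicate N u).flatten := by
  have h : ∀ N, Stream'.cycle u hu = (List.replicate N u).flatten ++ₛ Stream'.cycle u hu := by
    intro N
    induction N with
    | zero => rfl
    | succ N ih =>
      rw [List.replicate_succ, List.flatten_cons, Stream'.append_append_stream, ← ih]
      exact Stream'.cycle_eq u hu
  have hl : (List.replicate N u).flatten.length = N * u.length := by simp
  rw [h N, ← hl, Stream'.take_append_of_le_length _ _ _ le_rfl, List.take_length]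

/-! ### Binary forests -/

/-- Edges some of which have a left and a right child, with weights. -/
structure Forest (E : Type) where
  dom : Set E
  child : E → Bool → E
  wt : E → Bool → ℤ

/-- `F.Path e u c k`: the descendant of `e` along `u` is `c`, and the weights add up to `k`. -/
inductive Forest.Path {E : Type} (F : Forest E) : E → List Bool → E → ℤ → Prop
  | nil (e) : Path F e [] e 0
  | cons {e b u c k} (he : e ∈ F.dom) (h : Path F (F.child e b) u c k) :
      Path F e (b :: u) c (F.wt e b + k)

namespace Forest

variable {E : Type} {F : Forest E}

theorem Path.det {e c c' : E} {u : List Bool} {k k' : ℤ} (h : F.Path e u c k)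
    (h' : F.Path e u c' k') : c = c' ∧ k = k' := by
  induction h generalizing k' with
  | nil e => cases h'; exact ⟨rfl, rfl⟩
  | cons he h ih =>
    cases h' with
    | cons he' h' =>
      obtain ⟨rfl, rfl⟩ := ih h'
      exact ⟨rfl, rfl⟩

theorem Path.eq_of_nil {e c : E} {k : ℤ} (h : F.Path e [] c k) : c = e ∧ k = 0 := by
  cases h; exact ⟨rfl, rfl⟩

theorem Path.append {e c d : E} {u v : List Bool} {k l : ℤ} (h : F.Path e u c k)
    (h' : F.Path c v d l) : F.Path e (u ++ v) d (k + l) := by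
  induction h with
  | nil e => simpa using h'
  | cons he h ih =>
    rw [add_assoc]
    exact .cons he (ih h')

theorem Path.of_append {e d : E} {u v : List Bool} {m : ℤ} (h : F.Path e (u ++ v) d m) :
    ∃ c k l, F.Path e u c k ∧ F.Path c v d l ∧ m = k + l := by
  induction u generalizing e m with
  | nil => exact ⟨e, 0, m, .nil e, h, (zero_add m).symm⟩
  | cons b u ih =>
    cases h with
    | cons he h =>
      obtain ⟨c, k, l, h1, h2, rfl⟩ := ih h
      exact ⟨c, _, l, .cons he h1, h2, (add_assoc _ _ _).symm⟩

theorem Path.of_concat {e d : E} {u : List Bool} {b : Bool} {m : ℤ}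
    (h : F.Path e (u ++ [b]) d m) :
    ∃ c k, F.Path e u c k ∧ c ∈ F.dom ∧ d = F.child c b ∧ m = k + F.wt c b := by
  obtain ⟨c, k, l, h1, h2, rfl⟩ := h.of_append
  cases h2 with
  | cons he h2 =>
    obtain ⟨rfl, rfl⟩ := h2.eq_of_nil
    exact ⟨c, k, h1, he, rfl, by simp⟩

theorem Path.concat {e c : E} {u : List Bool} {k : ℤ} (h : F.Path e u c k) (hc : c ∈ F.dom)
    (b : Bool) : F.Path e (u ++ [b]) (F.child c b) (k + F.wt c b) := by
  have := h.append (.cons (b := b) hc (.nil _))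
  rwa [add_zero] at this

theorem Path.mem_dom {e c : E} {u : List Bool} {k : ℤ} (h : F.Path e u c k) (hu : u ≠ []) :
    e ∈ F.dom := by
  cases h with
  | nil => exact absurd rfl hu
  | cons he _ => exact he

end Forest

/-- The forest of splits and the forest of merges of a reduced closed strand diagram. -/
structure BiForest (E : Type) where
  F : Forest E
  G : Forest E
  K : ℤ
  p : E → ℤ
  not_both : ∀ e, e ∈ F.dom → e ∉ G.dom
  childF : ∀ e ∈ F.dom, ∀ b, F.child e b ∉ G.dom
  childG : ∀ e ∈ G.dom, ∀ b, G.child e b ∉ F.dom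
  parentF : ∀ e, e ∉ G.dom → ∃ d ∈ F.dom, ∃ b, F.child d b = e
  parentG : ∀ e, e ∉ F.dom → ∃ d ∈ G.dom, ∃ b, G.child d b = e
  potF : ∀ e ∈ F.dom, ∀ b, 1 ≤ K * F.wt e b + p (F.child e b) - p e
  potG : ∀ e ∈ G.dom, ∀ b, K * G.wt e b + p (G.child e b) - p e ≤ -1
  irred : ∀ d ∈ F.dom, ∀ o ∈ G.dom, (∀ b, F.child d b = G.child o b) →
    F.wt d false - G.wt o false ≠ F.wt d true - G.wt o true

/-! ### Pairs of forests realized by charts -/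

namespace BiForest

variable {E E' L L' Y : Type}

/-- Reversal of all arrows. Weights along the merge forest count against the flow, so only `K` and
the potential change sign; every statement about splits yields one about merges. -/
def swap (B : BiForest E) : BiForest E where
  F := B.G
  G := B.F
  K := -B.K
  p := fun e => - B.p e
  not_both e h h' := B.not_both e h' h
  childF := B.childG
  childG := B.childF
  parentF := B.parentG
  parentG := B.parentF
  potF e he b := by have := B.potG e he b; linarith
  potG e he b := by have := B.potF e he b; linarith
  irred d hd o ho h h' := B.irred o ho d hd (fun b => (h b).symm) (by linarith)

variable {B : BiForest E} {B' : BiForest E'}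

/-- Each step of a path costs at least one unit of potential, so a path with given ends and weight
has bounded length. -/
theorem potential_path {e c : E} {u : List Bool} {k : ℤ} (h : B.F.Path e u c k) :
    (u.length : ℤ) ≤ B.K * k + B.p c - B.p e := by
  induction h with
  | nil e => simp
  | @cons e b u c k he h ih =>
    have := B.potF e he b
    push_cast [List.length_cons]
    linarith

/-- The edges that are connected to a point by a descending path in each of the forests. -/
def Conn (F G : Forest E) (e : E) (w : Stream' Bool) (e' : E) (w' : Stream' Bool) (n : ℤ) : Prop :=
  ∃ c u v t k l, w = u ++ₛ t ∧ w' = v ++ₛ t ∧ F.Path e u c k ∧ G.Path e' v c l ∧ n = k - l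

theorem Conn.symm {F G : Forest E} {e e' : E} {w w' : Stream' Bool} {n : ℤ}
    (h : Conn F G e w e' w' n) : Conn G F e' w' e w (-n) := by
  obtain ⟨c, u, v, t, k, l, h1, h2, h3, h4, rfl⟩ := h
  exact ⟨c, v, u, t, l, k, h2, h1, h4, h3, by ring⟩

/-- Charts in a set with a permutation that are glued exactly as the forests prescribe. -/
structure Realization (B : BiForest E) (ζ : L → ℤ) (T : Equiv.Perm Y)
    (φ : E ⊕ L → Stream' Bool → Y) : Prop where
  modF : ∀ e ∈ B.F.dom, ∀ b t,
    (T ^ B.F.wt e b) (φ (Sum.inl e) (Stream'.cons b t)) = φ (Sum.inl (B.F.child e b)) t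
  modG : ∀ e ∈ B.G.dom, ∀ b t,
    (T ^ B.G.wt e b) (φ (Sum.inl e) (Stream'.cons b t)) = φ (Sum.inl (B.G.child e b)) t
  loop : ∀ l t, (T ^ ζ l) (φ (Sum.inr l) t) = φ (Sum.inr l) t
  loop_pos : ∀ l, 0 < ζ l
  exact_edge : ∀ e e' w w' (n : ℤ), (T ^ n) (φ (Sum.inl e) w) = φ (Sum.inl e') w' →
    Conn B.F B.G e w e' w' n ∨ Conn B.F B.G e' w' e w (-n)
  exact_loop : ∀ l l' w w' (n : ℤ), (T ^ n) (φ (Sum.inr l) w) = φ (Sum.inr l') w' →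
    w = w' ∧ ζ l ∣ n

variable {ζ : L → ℤ} {ζ' : L' → ℤ} {T : Equiv.Perm Y} {φ : E ⊕ L → Stream' Bool → Y}
  {φ' : E' ⊕ L' → Stream' Bool → Y}

theorem Realization.swap (R : Realization B ζ T φ) : Realization B.swap ζ T φ where
  modF := R.modG
  modG := R.modF
  loop := R.loop
  loop_pos := R.loop_pos
  exact_edge e e' w w' n h := by
    rcases R.exact_edge e e' w w' n h with h | h
    · exact Or.inr h.symm
    · left
      have := h.symm
      rwa [neg_neg] at this
  exact_loop := R.exact_loop

theorem Realization.path (R : Realization B ζ T φ) {e c : E} {u : List Bool} {k : ℤ}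
    (h : B.F.Path e u c k) (t : Stream' Bool) :
    (T ^ k) (φ (Sum.inl e) (u ++ₛ t)) = φ (Sum.inl c) t := by
  induction h with
  | nil e => simp
  | @cons e b u c k he h ih =>
    rw [add_comm, zpow_add_apply, Stream'.cons_append_stream, R.modF e he, ih]

/-- Along each infinite word the charts `φ` are eventually translates of charts `φ'`. -/
def LocalIn (T : Equiv.Perm Y) (φ : E ⊕ L → Stream' Bool → Y)
    (φ' : E' ⊕ L' → Stream' Bool → Y) : Prop :=
  ∀ x (α : Stream' Bool), ∃ N : ℕ, ∀ M, N ≤ M → ∃ (n : ℤ) (x' : E' ⊕ L') (v : List Bool),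
    ∀ w, φ x (α.take M ++ₛ w) = (T ^ n) (φ' x' (v ++ₛ w))

/-- A chart on a cycle of splits is a translate of a chart on a cycle of splits. -/
theorem Realization.exists_of_cycle (R : Realization B ζ T φ) (R' : Realization B' ζ' T φ')
    (hloc : LocalIn T φ φ') (hK : 0 < B.K * B'.K) {e : E} {u : List Bool} {k : ℤ} (hu : u ≠ [])
    (h : B.F.Path e u e k) :
    ∃ (e' : E') (n : ℤ) (u' : List Bool) (k' : ℤ), u' ≠ [] ∧ B'.F.Path e' u' e' k' ∧
      ∀ t, φ (Sum.inl e) t = (T ^ n) (φ' (Sum.inl e') t) := by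
  have hul : 0 < u.length := List.length_pos_iff.2 hu
  have hkK : 0 < B.K * k := by
    have := potential_path h
    have : (0 : ℤ) < u.length := by exact_mod_cast hul
    linarith
  -- Only equality of the signs of `B.K` and `B'.K` is assumed, so that the statement also applies
  -- after `swap`.
  have hkK' : 0 < B'.K * k := by
    rcases lt_trichotomy k 0 with hk | hk | hk
    · have h1 : B.K < 0 := by nlinarith
      have h2 : B'.K < 0 := by nlinarith
      exact mul_pos_of_neg_of_neg h2 hk
    · simp [hk] at hkK
    · have h1 : 0 < B.K := by nlinarith
      have h2 : 0 < B'.K := by nlinarith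
      exact mul_pos h2 hk
  have hpow : ∀ (N : ℕ) t, (T ^ (N * k)) (φ (Sum.inl e) ((List.replicate N u).flatten ++ₛ t))
      = φ (Sum.inl e) t := by
    intro N t
    induction N with
    | zero => simp
    | succ N ih =>
      have : ((N + 1 : ℕ) : ℤ) * k = N * k + k := by push_cast; ring
      rw [List.replicate_succ, List.flatten_cons, Stream'.append_append_stream, this,
        zpow_add_apply, R.path h, ih]
  -- Locality is applied along the periodic word `uuu…`, at a multiple of the length of `u`. Running
  -- around the cycle removes this prefix at the cost of a translation, so the whole chart of `e`
  -- becomes a translate of a cone in the other chart.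
  obtain ⟨N, hN⟩ := hloc (Sum.inl e) (Stream'.cycle u hu)
  obtain ⟨n, x', v, hv⟩ := hN (N * u.length) (Nat.le_mul_of_pos_right N hul)
  rw [take_cycle] at hv
  have hφ : ∀ t, φ (Sum.inl e) t = (T ^ (N * k + n)) (φ' x' (v ++ₛ t)) := by
    intro t
    rw [← hpow N, hv, zpow_add_apply]
  have hφ' : ∀ (N : ℕ) t, (T ^ (N * k)) (φ' x' (v ++ₛ ((List.replicate N u).flatten ++ₛ t)))
      = φ' x' (v ++ₛ t) := by
    intro M t
    have h1 := hpow M t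
    rw [hφ, hφ, ← zpow_add_apply, add_comm, zpow_add_apply] at h1
    exact (T ^ ((N : ℤ) * k + n)).injective h1
  rcases x' with e' | l'
  -- So many periods make the repeated word longer than `v`, which excludes overlaps of the wrong
  -- kind below.
  · set M := v.length + 1 with hM
    set U := (List.replicate M u).flatten with hU
    have hUl : U.length = M * u.length := by simp [hU]
    have hUp : v.length < U.length := by
      rw [hUl]
      exact lt_of_lt_of_le (Nat.lt_succ_self _) (Nat.le_mul_of_pos_right M hul)
    have hMK : 0 < B'.K * (M * k) := by
      have : (0 : ℤ) < M := by positivity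
      have := mul_pos this hkK'
      linarith
    have hM' := hφ' M oneWord
    rw [← hU, ← Stream'.append_append_stream] at hM'
    -- The periodicity, tested on `oneWord`, must come from a path. The only case that survives is a
    -- nonempty path of splits `a` from `e'` to itself with `a = v ++ a'`. The edge reached from
    -- `e'` along `v` then lies on the cycle `a' ++ v` and carries the chart sought. A cycle of
    -- merges would have the wrong sign, and the other cases have wrong lengths.
    rcases R'.exact_edge _ _ _ _ _ hM' with ⟨c, a, b, s, k₁, k₂, h1, h2, h3, h4, h5⟩ |
      ⟨c, a, b, s, k₁, k₂, h1, h2, h3, h4, h5⟩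
    · by_cases ha : a = []
      · subst ha
        rw [Stream'.nil_append_stream] at h1
        rw [← h1, ← Stream'.append_append_stream] at h2
        have := congrArg List.length (append_oneWord_injective h2)
        simp only [List.length_append] at this
        omega
      · have hb : b = [] := by
          by_contra hb
          exact B'.not_both _ (h3.mem_dom ha) (h4.mem_dom hb)
        subst hb
        obtain ⟨rfl, rfl⟩ := h4.eq_of_nil
        rw [Stream'.nil_append_stream] at h2
        rw [← h2, ← Stream'.append_append_stream] at h1
        have h6 := append_oneWord_injective h1
        have h7 : v.length ≤ a.length := by
          have := congrArg List.length h6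
          simp only [List.length_append] at this
          omega
        obtain ⟨a', rfl⟩ : ∃ a', a = v ++ a' := by
          have h8 : v <+: a ++ v := ⟨U, h6⟩
          obtain ⟨a', ha'⟩ := List.prefix_of_prefix_length_le h8 (List.prefix_append a v) h7
          exact ⟨a', ha'.symm⟩
        obtain ⟨d, kv, ka, h8, h9, -⟩ := h3.of_append
        refine ⟨d, N * k + n - kv, a' ++ v, ka + kv, ?_, h9.append h8, fun t => ?_⟩
        · intro h
          apply ha
          rw [List.append_eq_nil_iff] at h ⊢
          exact ⟨h.2, h.1⟩
        · rw [hφ, ← R'.path h8, ← zpow_add_apply, sub_add_cancel]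
    · by_cases ha : a = []
      · subst ha
        obtain ⟨rfl, rfl⟩ := h3.eq_of_nil
        have h6 : (b.length : ℤ) ≤ -B'.K * k₂ + -B'.p c - -B'.p c :=
          potential_path (B := B'.swap) h4
        have h7 : (0 : ℤ) ≤ b.length := by positivity
        have h8 : k₂ = M * k := by linarith
        rw [h8] at h6
        linarith
      · have hb : b = [] := by
          by_contra hb
          exact B'.not_both _ (h3.mem_dom ha) (h4.mem_dom hb)
        subst hb
        rw [Stream'.nil_append_stream] at h2
        rw [← h2, ← Stream'.append_append_stream] at h1
        have := congrArg List.length (append_oneWord_injective h1)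
        simp only [List.length_append] at this
        omega
  -- On a free loop, translation never changes the word, so no prefix can be removed.
  · exfalso
    have h1 := (R'.exact_loop _ _ _ _ _ (hφ' 1 oneWord)).1
    rw [← Stream'.append_append_stream] at h1
    have := append_oneWord_injective h1
    simp [hu] at this

/-- Each edge that starts at a split descends from a cycle of splits. -/
theorem exists_cycle_path [Finite E] (B : BiForest E) {e : E} (he : e ∉ B.G.dom) :
    ∃ c u k v l, u ≠ [] ∧ B.F.Path c u c k ∧ B.F.Path c v e l := by
  have hpar : ∀ e : {e // e ∉ B.G.dom}, ∃ d : {e // e ∉ B.G.dom}, d.1 ∈ B.F.dom ∧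
      ∃ b, B.F.child d.1 b = e.1 := by
    rintro ⟨e, he⟩
    obtain ⟨d, hd, b, h⟩ := B.parentF e he
    exact ⟨⟨d, B.not_both d hd⟩, hd, b, h⟩
  choose f hf1 b hf2 using hpar
  have hpath : ∀ (n : ℕ) (x : {e // e ∉ B.G.dom}), ∃ (u : List Bool) (k : ℤ), u.length = n ∧
      B.F.Path (f^[n] x).1 u x.1 k := by
    intro n x
    induction n with
    | zero => exact ⟨[], 0, rfl, .nil _⟩
    | succ n ih =>
      obtain ⟨u, k, h1, h2⟩ := ih
      rw [Function.iterate_succ_apply']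
      refine ⟨b (f^[n] x) :: u, _, by simp [h1], .cons (k := k) (hf1 _) ?_⟩
      rwa [hf2]
  -- Parents can be taken forever among edges that start at splits, and by finiteness an ancestor
  -- repeats.
  obtain ⟨i, j, hij, h⟩ := Finite.exists_ne_map_eq_of_infinite (fun n : ℕ => f^[n] ⟨e, he⟩)
  wlog hlt : i < j generalizing i j
  · exact this j i hij.symm h.symm (by omega)
  obtain ⟨d, rfl⟩ : ∃ d, j = d + 1 + i := ⟨j - i - 1, by omega⟩
  simp only [Function.iterate_add_apply f (d + 1) i] at h
  obtain ⟨u, k, h1, h2⟩ := hpath (d + 1) (f^[i] ⟨e, he⟩)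
  obtain ⟨v, l, h3, h4⟩ := hpath i ⟨e, he⟩
  rw [← h] at h2
  exact ⟨_, u, k, v, l, by rintro rfl; simp at h1, h2, h4⟩

end BiForest

/-! ### Matching the charts of two realizations -/

namespace BiForest

variable {E E' L L' Y : Type} {B : BiForest E} {B' : BiForest E'} {ζ : L → ℤ} {ζ' : L' → ℤ}
  {T : Equiv.Perm Y} {φ : E ⊕ L → Stream' Bool → Y} {φ' : E' ⊕ L' → Stream' Bool → Y}

/-- The chart of `e` is the translate by `n` of the chart of `e'`. -/
def Matches (T : Equiv.Perm Y) (φ : E ⊕ L → Stream' Bool → Y) (φ' : E' ⊕ L' → Stream' Bool → Y)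
    (e : E) (e' : E') (n : ℤ) : Prop :=
  ∀ t, φ (Sum.inl e) t = (T ^ n) (φ' (Sum.inl e') t)

theorem Matches.symm {e : E} {e' : E'} {n : ℤ} (h : Matches T φ φ' e e' n) :
    Matches T φ' φ e' e (-n) := by
  intro t
  rw [h t, ← zpow_add_apply]
  simp

theorem Matches.trans {E'' L'' : Type} {φ'' : E'' ⊕ L'' → Stream' Bool → Y} {e : E} {e' : E'}
    {e'' : E''} {m n : ℤ} (h : Matches T φ φ' e e' m) (h' : Matches T φ' φ'' e' e'' n) :
    Matches T φ φ'' e e'' (m + n) := by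
  intro t
  rw [h t, h' t, zpow_add_apply]

/-- Translates of charts of edges that agree on the cone of `v` are glued along a prefix of each
sufficiently long word. -/
theorem Realization.exists_prefix (R : Realization B ζ T φ) {κ o : E} {v : List Bool} {n : ℤ}
    (hκ : κ ∈ B.F.dom) (ho : o ∈ B.G.dom)
    (h : ∀ t, (T ^ n) (φ (Sum.inl κ) t) = φ (Sum.inl o) (v ++ₛ t)) {x : List Bool}
    (hx : B.K * n + B.p o - B.p κ ≤ x.length) :
    ∃ a, a <+: x ∧ ∃ c k l, B.F.Path κ a c k ∧ B.G.Path o (v ++ a) c l ∧ n = k - l := by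
  rcases R.exact_edge _ _ _ _ _ (h (x ++ₛ oneWord)) with ⟨c, a, b, s, k, l, h1, h2, h3, h4, h5⟩ |
    ⟨c, a, b, s, k, l, h1, h2, h3, h4, h5⟩
  · have h6 := potential_path h3
    have h7 : (b.length : ℤ) ≤ -B.K * l + -B.p c - -B.p o := potential_path (B := B.swap) h4
    have h8 : a.length ≤ x.length := by
      have : (0 : ℤ) ≤ b.length := by positivity
      subst h5
      zify
      linarith
    obtain ⟨x', rfl, rfl⟩ := eq_append_of_append_eq h1.symm h8
    refine ⟨a, List.prefix_append _ _, c, k, l, h3, ?_, h5⟩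
    have : v ++ a = b := by
      rw [← Stream'.append_append_stream, ← Stream'.append_append_stream] at h2
      have h9 := append_oneWord_injective h2
      rw [← List.append_assoc] at h9
      exact List.append_cancel_right h9
    rwa [this]
  · exfalso
    have ha : a = [] := by
      by_contra ha
      exact B.not_both _ (h3.mem_dom ha) ho
    have hb : b = [] := by
      by_contra hb
      exact B.not_both _ hκ (h4.mem_dom hb)
    subst ha hb
    obtain ⟨rfl, -⟩ := h3.eq_of_nil
    obtain ⟨rfl, -⟩ := h4.eq_of_nil
    exact B.not_both _ hκ ho

/-- The chart of a split is not a translate of the restriction of the chart of a merge. -/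
theorem Realization.ne_append (R : Realization B ζ T φ) {κ o : E} {v : List Bool} {n : ℤ}
    (hκ : κ ∈ B.F.dom) (ho : o ∈ B.G.dom)
    (h : ∀ t, (T ^ n) (φ (Sum.inl κ) t) = φ (Sum.inl o) (v ++ₛ t)) : False := by
  -- A word is good if descending along it through splits from `κ`, and along `v` followed by it
  -- through merges from `o`, leads to the same edge with the right weights. Every long word has a
  -- good prefix, good words have bounded length, and no good word properly extends another, since
  -- the common edge would have children in both forests. So the good words are the leaves of a
  -- finite complete binary tree.
  let Good (a : List Bool) : Prop :=
    ∃ c k l, B.F.Path κ a c k ∧ B.G.Path o (v ++ a) c l ∧ n = k - l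
  obtain ⟨C, hC⟩ : ∃ C : ℕ, B.K * n + B.p o - B.p κ ≤ C := ⟨_, Int.self_le_toNat _⟩
  have hpre : ∀ x : List Bool, C ≤ x.length → ∃ a, a <+: x ∧ Good a := fun x hx =>
    R.exists_prefix hκ ho h (hC.trans (by exact_mod_cast hx))
  have hbound : ∀ a, Good a → a.length ≤ C := by
    rintro a ⟨c, k, l, h1, h2, rfl⟩
    have h6 := potential_path h1
    have h7 : ((v ++ a).length : ℤ) ≤ -B.K * l + -B.p c - -B.p o :=
      potential_path (B := B.swap) h2
    have : (0 : ℤ) ≤ (v ++ a).length := by positivity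
    zify
    linarith
  have hanti : ∀ a a', Good a → Good (a ++ a') → a' = [] := by
    rintro a a' ⟨c, k, l, h1, h2, -⟩ ⟨c', k', l', h3, h4, -⟩
    by_contra ha'
    obtain ⟨d, _, _, h5, h6, -⟩ := h3.of_append
    rw [← List.append_assoc] at h4
    obtain ⟨d', _, _, h7, h8, -⟩ := h4.of_append
    obtain ⟨rfl, -⟩ := h1.det h5
    obtain ⟨rfl, -⟩ := h2.det h7
    exact B.not_both _ (h6.mem_dom ha') (h8.mem_dom ha')
  have hnil : ¬ Good [] := by
    rintro ⟨c, k, l, h1, h2, -⟩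
    obtain ⟨rfl, -⟩ := h1.eq_of_nil
    rw [List.append_nil] at h2
    rcases List.eq_nil_or_concat' v with rfl | ⟨v, b, rfl⟩
    · obtain ⟨rfl, -⟩ := h2.eq_of_nil
      exact B.not_both _ hκ ho
    · obtain ⟨d, k, -, hd, rfl, -⟩ := h2.of_concat
      exact B.childG d hd b hκ
  let S : Set ℕ := {j | ∃ a, Good a ∧ a.length = j}
  have hS : S.Nonempty := by
    obtain ⟨a, -, ha⟩ := hpre (List.replicate C false) (by simp)
    exact ⟨_, a, ha, rfl⟩
  have hS' : BddAbove S := ⟨C, by rintro _ ⟨a, ha, rfl⟩; exact hbound a ha⟩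
  obtain ⟨a, ha, haS⟩ := Nat.sSup_mem hS hS'
  have hmax : ∀ a', Good a' → a'.length ≤ a.length := fun a' h' => by
    rw [haS]
    exact le_csSup hS' ⟨a', h', rfl⟩
  rcases List.eq_nil_or_concat' a with rfl | ⟨a, b, rfl⟩
  · exact hnil ha
  -- The sibling of a deepest leaf is also a leaf. The two leaves are the two outputs of one split
  -- and the two inputs of one merge, with equal weights: exactly the configuration of move II.
  obtain ⟨a', h1, ha'⟩ := hpre ((a ++ [!b]) ++ List.replicate C false)
    (by simp only [List.length_append, List.length_replicate]; omega)
  have h3 := hmax a' ha'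
  have h4 : a' <+: a ++ [!b] :=
    List.prefix_of_prefix_length_le h1 (List.prefix_append _ _) (by simpa using h3)
  rw [List.prefix_concat_iff] at h4
  rcases h4 with rfl | ⟨a'', rfl⟩
  · obtain ⟨c, k, l, h1, h2, h3⟩ := ha
    obtain ⟨c', k', l', h1', h2', h3'⟩ := ha'
    replace h2 : B.G.Path o ((v ++ a) ++ [b]) c l := by rwa [List.append_assoc]
    replace h2' : B.G.Path o ((v ++ a) ++ [!b]) c' l' := by rwa [List.append_assoc]
    obtain ⟨d, kd, p1, hd, rfl, rfl⟩ := h1.of_concat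
    obtain ⟨d', kd', p1', -, rfl, rfl⟩ := h1'.of_concat
    obtain ⟨f, kf, p2, hf, q1, rfl⟩ := h2.of_concat
    obtain ⟨f', kf', p2', -, q2, rfl⟩ := h2'.of_concat
    obtain ⟨rfl, rfl⟩ := p1.det p1'
    obtain ⟨rfl, rfl⟩ := p2.det p2'
    cases b
    · refine B.irred d hd f hf (fun b => ?_) (by simp only [Bool.not_false] at h3'; linarith)
      cases b
      · exact q1
      · exact q2
    · refine B.irred d hd f hf (fun b => ?_) (by simp only [Bool.not_true] at h3'; linarith)
      cases b
      · exact q2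
      · exact q1
  · have h5 := hanti a' (a'' ++ [b]) ha' (by rwa [← List.append_assoc])
    simp at h5

/-- If `κ'` did not end at a split, it would descend through merges from a cycle of merges. That
cycle has a counterpart in the first diagram, so the chart of the split edge `κ` would be a
restriction of the chart of a merge, against `ne_append`. -/
theorem Realization.mem_dom [Finite E'] (R : Realization B ζ T φ) (R' : Realization B' ζ' T φ')
    (hloc : LocalIn T φ' φ) (hK : 0 < B.K * B'.K) {κ : E} {κ' : E'} {n : ℤ}
    (h : Matches T φ φ' κ κ' n) (hκ : κ ∈ B.F.dom) : κ' ∈ B'.F.dom := by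
  by_contra hκ'
  obtain ⟨o', u, k, v, l, hu, h1, h2⟩ := exists_cycle_path B'.swap hκ'
  obtain ⟨o, m, u', k', hu', h3, h4⟩ := R'.swap.exists_of_cycle R.swap hloc
    (by change 0 < -B'.K * -B.K; linarith) hu h1
  refine R.ne_append (v := v) (n := -(n + l + m)) hκ (h3.mem_dom hu') fun t => ?_
  have h5 := R'.swap.path h2 t
  rw [h t, ← h5, h4, ← zpow_add_apply, ← zpow_add_apply, ← zpow_add_apply]
  have : -(n + l + m) + n + l + m = 0 := by ring
  rw [this]
  simp

theorem Realization.matches_child (R : Realization B ζ T φ) (R' : Realization B' ζ' T φ')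
    {e : E} {e' : E'} {n : ℤ} (h : Matches T φ φ' e e' n) (he : e ∈ B.F.dom) (he' : e' ∈ B'.F.dom)
    (b : Bool) :
    Matches T φ φ' (B.F.child e b) (B'.F.child e' b) (B.F.wt e b + n - B'.F.wt e' b) := by
  intro t
  rw [← R.modF e he, ← R'.modF e' he', h, ← zpow_add_apply, ← zpow_add_apply, sub_add_cancel]

/-- The match is found on a cycle of splits above `e` and carried down to `e`; `mem_dom` guarantees
that the partner has children whenever the edge has. -/
theorem Realization.exists_matches_of_notMem [Finite E] [Finite E'] (R : Realization B ζ T φ)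
    (R' : Realization B' ζ' T φ') (hloc : LocalIn T φ φ') (hloc' : LocalIn T φ' φ)
    (hK : 0 < B.K * B'.K) {e : E} (he : e ∉ B.G.dom) : ∃ e' n, Matches T φ φ' e e' n := by
  obtain ⟨c, u, k, v, l, hu, h1, h2⟩ := exists_cycle_path B he
  obtain ⟨c', n, -, -, -, -, h3⟩ := R.exists_of_cycle R' hloc hK hu h1
  clear h1
  change Matches T φ φ' c c' n at h3
  induction h2 generalizing c' n with
  | nil e => exact ⟨c', n, h3⟩
  | cons hc h ih =>
    exact ih he _ _ (R.matches_child R' h3 hc (R.mem_dom R' hloc' hK h3 hc) _)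

theorem Realization.exists_matches [Finite E] [Finite E'] (R : Realization B ζ T φ)
    (R' : Realization B' ζ' T φ') (hloc : LocalIn T φ φ') (hloc' : LocalIn T φ' φ)
    (hK : 0 < B.K * B'.K) (e : E) : ∃ e' n, Matches T φ φ' e e' n := by
  by_cases he : e ∈ B.G.dom
  · exact R.swap.exists_matches_of_notMem R'.swap hloc hloc'
      (by change 0 < -B.K * -B'.K; linarith) (e := e) fun he' => B.not_both e he' he
  · exact R.exists_matches_of_notMem R' hloc hloc' hK he

theorem localIn_refl (T : Equiv.Perm Y) (φ : E ⊕ L → Stream' Bool → Y) : LocalIn T φ φ :=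
  fun x α => ⟨0, fun M _ => ⟨0, x, α.take M, fun w => by simp⟩⟩

/-- Tested on `oneWord`, a path with just one nonempty prefix would give a word equal to its own
proper extension. Two nonempty prefixes would make one edge end at a split and its match start at a
merge, which `mem_dom` excludes. -/
theorem Realization.eq_of_matches [Finite E] (R : Realization B ζ T φ) (hK : B.K ≠ 0) {e e' : E}
    {n : ℤ} (h : Matches T φ φ e e' n) : e = e' ∧ n = 0 := by
  have key : ∀ {e e' : E} {n : ℤ}, Matches T φ φ e e' n →
      Conn B.F B.G e' oneWord e oneWord n → e = e' ∧ n = 0 := by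
    rintro e e' n h ⟨c, a, b, s, k, l, h1, h2, h3, h4, rfl⟩
    have hKK : 0 < B.K * B.K := mul_self_pos.2 hK
    by_cases ha : a = []
    · by_cases hb : b = []
      · subst ha hb
        obtain ⟨rfl, rfl⟩ := h3.eq_of_nil
        obtain ⟨rfl, rfl⟩ := h4.eq_of_nil
        simp
      · exfalso
        subst ha
        rw [Stream'.nil_append_stream] at h1
        exact append_oneWord_ne hb (by rw [h1, ← h2, h1])
    · exfalso
      have h5 := R.mem_dom R (localIn_refl T φ) hKK h.symm (h3.mem_dom ha)
      have hb : b = [] := by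
        by_contra hb
        exact B.not_both _ h5 (h4.mem_dom hb)
      subst hb
      rw [Stream'.nil_append_stream] at h2
      exact append_oneWord_ne ha (by rw [h2, ← h1, h2])
  rcases R.exact_edge _ _ _ _ _ (h oneWord).symm with h' | h'
  · exact key h h'
  · obtain ⟨h1, h2⟩ := key h.symm h'
    exact ⟨h1.symm, by omega⟩

/-- Two realizations in the same space whose charts are related locally come from forests that are
isomorphic, with cohomologous weights. -/
theorem Realization.exists_equiv [Finite E] [Finite E'] (R : Realization B ζ T φ)
    (R' : Realization B' ζ' T φ') (hloc : LocalIn T φ φ') (hloc' : LocalIn T φ' φ)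
    (hK : 0 < B.K * B'.K) :
    ∃ (α : E ≃ E') (ψ : E → ℤ), (∀ e, α e ∈ B'.F.dom ↔ e ∈ B.F.dom) ∧
      (∀ e, α e ∈ B'.G.dom ↔ e ∈ B.G.dom) ∧
      (∀ e ∈ B.F.dom, ∀ b, α (B.F.child e b) = B'.F.child (α e) b ∧
        ψ (B.F.child e b) = B.F.wt e b + ψ e - B'.F.wt (α e) b) ∧
      ∀ e ∈ B.G.dom, ∀ b, α (B.G.child e b) = B'.G.child (α e) b ∧
        ψ (B.G.child e b) = B.G.wt e b + ψ e - B'.G.wt (α e) b := by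
  have hK' : 0 < B'.K * B.K := by rwa [mul_comm]
  have hs : 0 < B.swap.K * B'.swap.K := by change 0 < -B.K * -B'.K; linarith
  have hs' : 0 < B'.swap.K * B.swap.K := by change 0 < -B'.K * -B.K; linarith
  have hn : B.K ≠ 0 := left_ne_zero_of_mul hK.ne'
  have hn' : B'.K ≠ 0 := right_ne_zero_of_mul hK.ne'
  choose α ψ hα using R.exists_matches R' hloc hloc' hK
  choose β χ hβ using R'.exists_matches R hloc' hloc hK'
  -- Matches are unique, with their translation. Hence matching is a bijection, and compatibility
  -- with children follows since children of matched edges match.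
  have huniq : ∀ {e e' n}, Matches T φ φ' e e' n → α e = e' ∧ ψ e = n := by
    intro e e' n h
    obtain ⟨h1, h2⟩ := R'.eq_of_matches hn' ((hα e).symm.trans h)
    exact ⟨h1, by omega⟩
  let A : E ≃ E' :=
    { toFun := α
      invFun := β
      left_inv := fun e => (R.eq_of_matches hn ((hα e).trans (hβ (α e)))).1.symm
      right_inv := fun e' => (R'.eq_of_matches hn' ((hβ e').trans (hα (β e')))).1.symm }
  have hF : ∀ e, α e ∈ B'.F.dom ↔ e ∈ B.F.dom := fun e =>
    ⟨R'.mem_dom R hloc hK' (hα e).symm, R.mem_dom R' hloc' hK (hα e)⟩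
  have hG : ∀ e, α e ∈ B'.G.dom ↔ e ∈ B.G.dom := fun e =>
    ⟨R'.swap.mem_dom R.swap hloc hs' (hα e).symm, R.swap.mem_dom R'.swap hloc' hs (hα e)⟩
  exact ⟨A, ψ, hF, hG, fun e he b => huniq (R.matches_child R' (hα e) he ((hF e).2 he) b),
    fun e he b => huniq (R.swap.matches_child R'.swap (hα e) he ((hG e).2 he) b)⟩

/-- A chart of an edge is not periodic on a cone. -/
theorem Realization.not_periodic (R : Realization B ζ T φ) {e : E} {v : List Bool} {n : ℤ}
    (h : (T ^ n) (φ (Sum.inl e) (v ++ₛ oneWord)) = φ (Sum.inl e) (v ++ₛ oneWord)) : n = 0 := by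
  have key : ∀ {n : ℤ}, Conn B.F B.G e (v ++ₛ oneWord) e (v ++ₛ oneWord) n → n = 0 := by
    rintro n ⟨c, a, b, s, k, l, h1, h2, h3, h4, rfl⟩
    have hab : a = [] ∨ b = [] := by
      by_contra! hab
      exact B.not_both _ (h3.mem_dom hab.1) (h4.mem_dom hab.2)
    have hab : a = [] ∧ b = [] := by
      rcases hab with rfl | rfl
      · rw [Stream'.nil_append_stream] at h1
        rw [← h1, ← Stream'.append_append_stream] at h2
        have := append_oneWord_injective h2
        exact ⟨rfl, by simpa using this⟩
      · rw [Stream'.nil_append_stream] at h2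
        rw [← h2, ← Stream'.append_append_stream] at h1
        have := append_oneWord_injective h1
        exact ⟨by simpa using this, rfl⟩
    obtain ⟨rfl, rfl⟩ := hab
    rw [h3.eq_of_nil.2, h4.eq_of_nil.2]
    rfl
  rcases R.exact_edge _ _ _ _ _ h with h' | h'
  · exact key h'
  · have := key h'
    omega

/-- At a word ending in `oneWord`, points on edges are not periodic, while points on a free loop
have its weight as exact period. So a loop corresponds locally to a loop, and the two weights divide
each other. -/
theorem Realization.exists_loop (R : Realization B ζ T φ) (R' : Realization B' ζ' T φ')
    (hloc : LocalIn T φ φ') (l : L) : ∃ l', ζ' l' = ζ l := by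
  obtain ⟨N, hN⟩ := hloc (Sum.inr l) oneWord
  obtain ⟨n, x', v, h⟩ := hN N le_rfl
  have h1 : ∀ m : ℤ, (T ^ m) (φ (Sum.inr l) (oneWord.take N ++ₛ oneWord)) =
      φ (Sum.inr l) (oneWord.take N ++ₛ oneWord) ↔
      (T ^ m) (φ' x' (v ++ₛ oneWord)) = φ' x' (v ++ₛ oneWord) := by
    intro m
    rw [h, ← zpow_add_apply, add_comm, zpow_add_apply, (T ^ n).injective.eq_iff]
  have h2 := (h1 _).1 (R.loop l _)
  have hl := R.loop_pos l
  rcases x' with e' | l'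
  · exact absurd (R'.not_periodic h2) hl.ne'
  · have h3 := (R'.exact_loop _ _ _ _ _ h2).2
    have h4 := (R.exact_loop _ _ _ _ _ ((h1 _).2 (R'.loop l' _))).2
    exact ⟨l', Int.dvd_antisymm (R'.loop_pos l').le hl.le h3 h4⟩

/-- As weights tell the loops of a reduced diagram apart, matching loops by weight is a bijection.
-/
theorem Realization.exists_loop_equiv (R : Realization B ζ T φ) (R' : Realization B' ζ' T φ')
    (hloc : LocalIn T φ φ') (hloc' : LocalIn T φ' φ) (hζ : Function.Injective ζ)
    (hζ' : Function.Injective ζ') : ∃ α : L ≃ L', ∀ l, ζ' (α l) = ζ l := by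
  choose α hα using R.exists_loop R' hloc
  choose β hβ using R'.exists_loop R hloc'
  exact ⟨⟨α, β, fun l => hζ (by rw [hβ, hα]), fun l => hζ' (by rw [hα, hβ])⟩, hα⟩

end BiForest

namespace StrandGraph

variable {G : StrandGraph Empty Empty} {z : G.Strands → ℤ}

/-! ### The forests of splits and of merges -/

/-- An edge that ends at a split has the two outputs of the split as children. -/
def splitForest (G : StrandGraph Empty Empty) (z : G.Strands → ℤ) : Forest G.Edge where
  dom := {e | ∃ s, G.head e = .split s}
  child e b := match G.head e with
    | .split s => G.tail.symm (.split s b)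
    | _ => e
  wt e _ := z (Sum.inl e)

/-- An edge that starts at a merge has the two inputs of the merge as children. -/
def mergeForest (G : StrandGraph Empty Empty) (z : G.Strands → ℤ) : Forest G.Edge where
  dom := {e | ∃ m, G.tail e = .merge m}
  child e b := match G.tail e with
    | .merge m => G.head.symm (.merge m b)
    | _ => e
  wt e b := - z (Sum.inl (match G.tail e with
    | .merge m => G.head.symm (.merge m b)
    | _ => e))

theorem splitForest_child {e : G.Edge} {s : G.Split} (h : G.head e = .split s) (b : Bool) :
    (G.splitForest z).child e b = G.tail.symm (.split s b) := by
  simp [splitForest, h]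

theorem splitForest_child_eq {e c : G.Edge} {s : G.Split} {b : Bool} (h : G.head e = .split s)
    (hc : G.tail c = .split s b) : (G.splitForest z).child e b = c := by
  rw [splitForest_child h, ← hc, Equiv.symm_apply_apply]

theorem mergeForest_child {e : G.Edge} {m : G.Merge} (h : G.tail e = .merge m) (b : Bool) :
    (G.mergeForest z).child e b = G.head.symm (.merge m b) := by
  simp [mergeForest, h]

theorem mergeForest_child_eq {e c : G.Edge} {m : G.Merge} {b : Bool} (h : G.tail e = .merge m)
    (hc : G.head c = .merge m b) : (G.mergeForest z).child e b = c := by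
  rw [mergeForest_child h, ← hc, Equiv.symm_apply_apply]

theorem mergeForest_wt (e : G.Edge) (b : Bool) :
    (G.mergeForest z).wt e b = - z (Sum.inl ((G.mergeForest z).child e b)) := rfl

/-! ### Equality of points of the flow space -/

theorem flow_step_cases {x y : G.Strands × Stream' Bool × ℤ} (h : (G.flow z).Step x y) :
    (∃ e c s b w n, G.head e = .split s ∧ G.tail c = .split s b ∧
      x = (Sum.inl e, Stream'.cons b w, n + z (Sum.inl e)) ∧ y = (Sum.inl c, w, n)) ∨
    (∃ e c m b w n, G.head e = .merge m b ∧ G.tail c = .merge m ∧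
      x = (Sum.inl e, w, n + z (Sum.inl e)) ∧ y = (Sum.inl c, Stream'.cons b w, n)) ∨
    ∃ l w n, x = (Sum.inr l, w, n + z (Sum.inr l)) ∧ y = (Sum.inr l, w, n) := by
  obtain ⟨x, u, k, y, v, h, w, n⟩ := h
  cases h with
  | split ha hc => exact Or.inl ⟨_, _, _, _, w, n, ha, hc, rfl, rfl⟩
  | merge ha hc => exact Or.inr (Or.inl ⟨_, _, _, _, w, n, ha, hc, rfl, rfl⟩)
  | loop l => exact Or.inr (Or.inr ⟨l, w, n, rfl, rfl⟩)

/-- The end of a strand, together with the first letter at a split, determines the next strand,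
because each starting place belongs to one edge. The backward statement is symmetric. -/
theorem flow_step_right_unique {x y y' : G.Strands × Stream' Bool × ℤ}
    (h : (G.flow z).Step x y) (h' : (G.flow z).Step x y') : y = y' := by
  rcases flow_step_cases h with ⟨e, c, s, b, w, n, h1, h2, rfl, rfl⟩ |
    ⟨e, c, m, b, w, n, h1, h2, rfl, rfl⟩ | ⟨l, w, n, rfl, rfl⟩ <;>
  rcases flow_step_cases h' with ⟨e', c', s', b', w', n', h1', h2', h3', rfl⟩ |
    ⟨e', c', m', b', w', n', h1', h2', h3', rfl⟩ | ⟨l', w', n', h3', rfl⟩ <;>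
  simp only [Prod.mk.injEq, Sum.inl.injEq, Sum.inr.injEq, reduceCtorEq, false_and] at h3'
  · obtain ⟨rfl, h4, h5⟩ := h3'
    obtain ⟨rfl, rfl⟩ := Stream'.cons_injective2 h4
    rw [h1] at h1'
    cases h1'
    rw [eq_of_tail h2 h2', add_right_cancel h5]
  · obtain ⟨rfl, -, -⟩ := h3'
    rw [h1] at h1'
    cases h1'
  · obtain ⟨rfl, -, -⟩ := h3'
    rw [h1] at h1'
    cases h1'
  · obtain ⟨rfl, rfl, h5⟩ := h3'
    rw [h1] at h1'
    cases h1'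
    rw [eq_of_tail h2 h2', add_right_cancel h5]
  · obtain ⟨rfl, rfl, h5⟩ := h3'
    rw [add_right_cancel h5]

theorem flow_step_left_unique {x x' y : G.Strands × Stream' Bool × ℤ}
    (h : (G.flow z).Step x y) (h' : (G.flow z).Step x' y) : x = x' := by
  rcases flow_step_cases h with ⟨e, c, s, b, w, n, h1, h2, rfl, rfl⟩ |
    ⟨e, c, m, b, w, n, h1, h2, rfl, rfl⟩ | ⟨l, w, n, rfl, rfl⟩ <;>
  rcases flow_step_cases h' with ⟨e', c', s', b', w', n', h1', h2', rfl, h3'⟩ |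
    ⟨e', c', m', b', w', n', h1', h2', rfl, h3'⟩ | ⟨l', w', n', rfl, h3'⟩ <;>
  simp only [Prod.mk.injEq, Sum.inl.injEq, Sum.inr.injEq, reduceCtorEq, false_and] at h3'
  · obtain ⟨rfl, rfl, rfl⟩ := h3'
    rw [h2] at h2'
    cases h2'
    rw [eq_of_head h1 h1']
  · obtain ⟨rfl, -, -⟩ := h3'
    rw [h2] at h2'
    cases h2'
  · obtain ⟨rfl, -, -⟩ := h3'
    rw [h2] at h2'
    cases h2'
  · obtain ⟨rfl, h4, rfl⟩ := h3'
    obtain ⟨rfl, rfl⟩ := Stream'.cons_injective2 h4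
    rw [h2] at h2'
    cases h2'
    rw [eq_of_head h1 h1']
  · obtain ⟨rfl, rfl, rfl⟩ := h3'
    rfl

/-- The quotient is by a partial injection, so equal points lie on one forward orbit. -/
theorem flow_eq_iff {x y : G.Strands} {w w' : Stream' Bool} {n : ℤ}
    (h : ((G.flow z).space.T ^ n) ((G.flow z).space.chart x w) = (G.flow z).space.chart y w') :
    Relation.ReflTransGen (G.flow z).Step (x, w, n) (y, w', 0) ∨
      Relation.ReflTransGen (G.flow z).Step (y, w', 0) (x, w, n) := by
  rw [← Presentation.point_eq_zpow_chart] at h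
  have h' : Relation.EqvGen (G.flow z).Step (x, w, n) (y, w', 0) := Quot.eqvGen_exact h
  exact (eqvGen_iff_reflTransGen (r := (G.flow z).Step)
    (fun _ _ _ h h' => flow_step_right_unique h h')
    (fun _ _ _ h h' => flow_step_left_unique h h')).1 h'

/-- When no merge feeds a split, a forward path passes first through splits and then through merges:
a descent in the split forest, followed by an ascent in the merge forest. -/
theorem conn_of_reflTransGen
    (hG : ∀ e ∈ (G.splitForest z).dom, e ∉ (G.mergeForest z).dom) {e : G.Edge} {w : Stream' Bool}
    {n : ℤ} {y : G.Strands × Stream' Bool × ℤ}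
    (h : Relation.ReflTransGen (G.flow z).Step (Sum.inl e, w, n) y) :
    ∃ e' w' n', y = (Sum.inl e', w', n') ∧
      BiForest.Conn (G.splitForest z) (G.mergeForest z) e w e' w' (n - n') := by
  generalize hx : ((Sum.inl e, w, n) : G.Strands × Stream' Bool × ℤ) = x at h
  induction h using Relation.ReflTransGen.head_induction_on generalizing e w n with
  | refl =>
    exact ⟨e, w, n, hx.symm, e, [], [], w, 0, 0, rfl, rfl, .nil _, .nil _, by simp⟩
  | head h0 _ ih =>
    subst hx
    rcases flow_step_cases h0 with ⟨d, c, s, b, w₁, n₁, h1, h2, h3, rfl⟩ |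
      ⟨d, c, m, b, w₁, n₁, h1, h2, h3, rfl⟩ | ⟨l, w₁, n₁, h3, rfl⟩ <;>
    simp only [Prod.mk.injEq, Sum.inl.injEq, reduceCtorEq, false_and] at h3
    · obtain ⟨rfl, rfl, rfl⟩ := h3
      obtain ⟨e', w', n', rfl, c', u, v, t, k, l, rfl, rfl, h4, h5, h6⟩ := ih rfl
      refine ⟨e', _, n', rfl, c', b :: u, v, t, _, l, rfl, rfl,
        .cons (k := k) ⟨s, h1⟩ ?_, h5, ?_⟩
      · rwa [splitForest_child_eq h1 h2]
      · change _ = z (Sum.inl e) + k - l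
        linarith
    · obtain ⟨rfl, rfl, rfl⟩ := h3
      obtain ⟨e', w', n', rfl, c', u, v, t, k, l, h7, rfl, h4, h5, h6⟩ := ih rfl
      -- The edge reached starts at a merge, so it does not end at a split and the rest of the path
      -- has no splits.
      have hu : u = [] := by
        by_contra hu
        exact hG _ (h4.mem_dom hu) ⟨m, h2⟩
      subst hu
      obtain ⟨rfl, rfl⟩ := h4.eq_of_nil
      rw [Stream'.nil_append_stream] at h7
      subst h7
      have h8 := h5.concat ⟨m, h2⟩ b
      rw [mergeForest_wt, mergeForest_child_eq h2 h1] at h8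
      refine ⟨e', _, n', rfl, e, [], v ++ [b], w, 0, _, rfl, ?_, .nil _, h8, ?_⟩
      · rw [Stream'.append_append_stream]
        rfl
      · linarith

theorem loop_of_reflTransGen {l : G.Loop} {w : Stream' Bool} {n : ℤ}
    {y : G.Strands × Stream' Bool × ℤ}
    (h : Relation.ReflTransGen (G.flow z).Step (Sum.inr l, w, n) y) :
    ∃ n', y = (Sum.inr l, w, n') ∧ z (Sum.inr l) ∣ n - n' := by
  induction h with
  | refl => exact ⟨n, rfl, by simp⟩
  | tail _ h ih =>
    obtain ⟨n', rfl, h2⟩ := ih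
    rcases flow_step_cases h with ⟨d, c, s, b, w₁, n₁, -, -, h3, rfl⟩ |
      ⟨d, c, m, b, w₁, n₁, -, -, h3, rfl⟩ | ⟨l, w₁, n₁, h3, rfl⟩ <;>
    simp only [Prod.mk.injEq, Sum.inr.injEq, reduceCtorEq, false_and] at h3
    obtain ⟨rfl, rfl, rfl⟩ := h3
    refine ⟨n₁, rfl, ?_⟩
    have : n - n₁ = n - (n₁ + z (Sum.inr l)) + z (Sum.inr l) := by ring
    rw [this]
    exact dvd_add h2 dvd_rfl

end StrandGraph

/-! ### The pair of forests of a reduced diagram -/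

namespace ClosedStrandDiagram

open StrandGraph

variable {D : ClosedStrandDiagram} {z : D.Strands → ℤ}

/-- Absence of move I makes the two domains disjoint, absence of move II gives `irred`, and
positivity of the cutting class gives the potential. -/
def biForest (hD : D.IsReduced) (hz : D.IsCutting z) {K : ℤ} {p : D.Edge → ℤ}
    (hp : ∀ a b, D.tgt a = D.src b → 1 ≤ K * z (Sum.inl a) + p b - p a) : BiForest D.Edge where
  F := D.splitForest z
  G := D.mergeForest z
  K := K
  p := p
  not_both := by
    rintro e ⟨s, hs⟩ ⟨m, hm⟩
    exact hD.not_merge_split hm hs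
  childF := by
    rintro e ⟨s, hs⟩ b ⟨m, hm⟩
    rw [splitForest_child hs, Equiv.apply_symm_apply] at hm
    cases hm
  childG := by
    rintro e ⟨m, hm⟩ b ⟨s, hs⟩
    rw [mergeForest_child hm, Equiv.apply_symm_apply] at hs
    cases hs
  parentF e he := by
    rcases h : D.tail e with i | ⟨s, b⟩ | m
    · exact i.elim
    · exact ⟨D.head.symm (.split s), ⟨s, by simp⟩, b, splitForest_child_eq (by simp) h⟩
    · exact absurd ⟨m, h⟩ he
  parentG e he := by
    rcases h : D.head e with i | s | ⟨m, b⟩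
    · exact i.elim
    · exact absurd ⟨s, h⟩ he
    · exact ⟨D.tail.symm (.merge m), ⟨m, by simp⟩, b, mergeForest_child_eq (by simp) h⟩
  potF := by
    rintro e ⟨s, hs⟩ b
    refine hp e _ (tgt_eq_src_split hs (b := b) ?_)
    rw [splitForest_child hs, Equiv.apply_symm_apply]
  potG := by
    rintro e ⟨m, hm⟩ b
    have := hp ((D.mergeForest z).child e b) e (tgt_eq_src_merge (m := m) (b := b)
      (by rw [mergeForest_child hm, Equiv.apply_symm_apply]) hm)
    rw [mergeForest_wt]
    linarith
  irred := by
    rintro d ⟨s, hs⟩ o ⟨m, hm⟩ h h'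
    have hb : ∀ b, D.tail ((D.splitForest z).child d b) = .split s b := fun b => by
      rw [splitForest_child hs, Equiv.apply_symm_apply]
    have hb' : ∀ b, D.head ((D.splitForest z).child d b) = .merge m b := fun b => by
      rw [h, mergeForest_child hm, Equiv.apply_symm_apply]
    refine hD.not_parallel (hb false) (hb' false) (hb true) (hb' true) hz ?_
    rw [mergeForest_wt, mergeForest_wt, ← h, ← h] at h'
    change z (Sum.inl d) - _ = z (Sum.inl d) - _ at h'
    linarith

theorem realization (hD : D.IsReduced) (hz : D.IsCutting z) {K : ℤ} {p : D.Edge → ℤ}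
    (hp : ∀ a b, D.tgt a = D.src b → 1 ≤ K * z (Sum.inl a) + p b - p a) :
    BiForest.Realization (biForest hD hz hp) (fun l : D.Loop => z (Sum.inr l))
      (D.flow z).space.T (D.flow z).space.chart where
  modF := by
    rintro e ⟨s, hs⟩ b t
    refine chart_split z hs ?_ t
    change D.tail ((D.splitForest z).child e b) = _
    rw [splitForest_child hs, Equiv.apply_symm_apply]
  modG := by
    rintro e ⟨m, hm⟩ b t
    change ((D.flow z).space.T ^ (- z (Sum.inl ((D.mergeForest z).child e b)))) _ =
      (D.flow z).space.chart (Sum.inl ((D.mergeForest z).child e b)) t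
    rw [← chart_merge z (a := (D.mergeForest z).child e b) (b := b) (m := m)
      (by rw [mergeForest_child hm, Equiv.apply_symm_apply]) hm, ← zpow_add_apply]
    simp
  loop l t := chart_loop z l t
  loop_pos := hz.positiveOnCycles.2
  exact_edge e e' w w' n h := by
    have hG : ∀ e ∈ (D.splitForest z).dom, e ∉ (D.mergeForest z).dom := (biForest hD hz hp).not_both
    rcases flow_eq_iff h with h | h
    · obtain ⟨e₁, w₁, n₁, h1, h2⟩ := conn_of_reflTransGen hG h
      cases h1
      rw [sub_zero] at h2
      exact Or.inl h2
    · obtain ⟨e₁, w₁, n₁, h1, h2⟩ := conn_of_reflTransGen hG h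
      cases h1
      rw [zero_sub] at h2
      exact Or.inr h2
  exact_loop l l' w w' n h := by
    rcases flow_eq_iff h with h | h
    · obtain ⟨n', h1, h2⟩ := loop_of_reflTransGen h
      cases h1
      rw [sub_zero] at h2
      exact ⟨rfl, h2⟩
    · obtain ⟨n', h1, h2⟩ := loop_of_reflTransGen h
      cases h1
      rw [zero_sub, dvd_neg] at h2
      exact ⟨rfl, h2⟩

end ClosedStrandDiagram

theorem BiForest.Realization.map {E L Y Z : Type} {B : BiForest E} {ζ : L → ℤ} {T : Equiv.Perm Y}
    {U : Equiv.Perm Z} {φ : E ⊕ L → Stream' Bool → Y} (R : BiForest.Realization B ζ T φ)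
    (f : Y → Z) (hf : Function.Injective f) (hT : ∀ y, f (T y) = U (f y)) :
    BiForest.Realization B ζ U (fun x w => f (φ x w)) where
  modF e he b t := by rw [← map_zpow_of_map T U f hT, R.modF e he]
  modG e he b t := by rw [← map_zpow_of_map T U f hT, R.modG e he]
  loop l t := by rw [← map_zpow_of_map T U f hT, R.loop]
  loop_pos := R.loop_pos
  exact_edge e e' w w' n h := by
    rw [← map_zpow_of_map T U f hT] at h
    exact R.exact_edge e e' w w' n (hf h)
  exact_loop l l' w w' n h := by
    rw [← map_zpow_of_map T U f hT] at h
    exact R.exact_loop l l' w w' n (hf h)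

/-! ### Reconstruction of a reduced diagram from its flow space -/

namespace ClosedStrandDiagram

open StrandGraph

variable {D D' : ClosedStrandDiagram}

theorem isCutting_iff {z : D.Strands → ℤ} (hz : D.IsCutting z) {y : D.Strands → ℤ} :
    D.IsCutting y ↔ ∃ χ, y = z + D.coboundary χ := by
  rw [IsCutting, ← hz, eq_comm, QuotientAddGroup.eq]
  constructor
  · rintro ⟨χ, h⟩
    exact ⟨χ, by rw [h]; abel⟩
  · rintro ⟨χ, rfl⟩
    exact ⟨χ, by abel⟩

/-- Reduced closed strand diagrams with isomorphic flow spaces are isomorphic. -/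
theorem nonempty_iso_of_isom (hD : D.IsReduced) (hD' : D'.IsReduced) {z : D.Strands → ℤ}
    {z' : D'.Strands → ℤ} (hz : D.IsCutting z) (hz' : D'.IsCutting z')
    (h : VSpace.Isom (D.flow z).space (D'.flow z').space) : Nonempty (Iso D D') := by
  have := D.toStrandGraph.finite_edge
  have := D'.toStrandGraph.finite_edge
  obtain ⟨f, g, hgf, hfg⟩ := h
  obtain ⟨K, p, hK, hp⟩ := exists_potential hz.positiveOnCycles
  obtain ⟨K', p', hK', hp'⟩ := exists_potential hz'.positiveOnCycles
  -- The charts of `D` are transported to the flow space of `D'`, so that both families of charts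
  -- live in the same space.
  have R := (realization hD hz hp).map f.toFun (Function.LeftInverse.injective hgf) f.map_T
  have R' := realization hD' hz' hp'
  have hloc : BiForest.LocalIn (E' := D'.Edge) (L' := D'.Loop) (D'.flow z').space.T
      (fun x w => f.toFun ((D.flow z).space.chart x w)) (D'.flow z').space.chart :=
    fun x α => (f.isLocal x).eventually α
  have hloc' : BiForest.LocalIn (E := D'.Edge) (L := D'.Loop) (E' := D.Edge) (L' := D.Loop)
      (D'.flow z').space.T (D'.flow z').space.chart
      (fun x w => f.toFun ((D.flow z).space.chart x w)) := by
    intro x α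
    obtain ⟨N, hN⟩ := (g.isLocal x).eventually α
    refine ⟨N, fun M hM => ?_⟩
    obtain ⟨n, i, v, h⟩ := hN M hM
    refine ⟨n, i, v, fun w => ?_⟩
    rw [← f.map_zpow, ← h, hfg]
  obtain ⟨lo, hlo⟩ := R.exists_loop_equiv R' hloc hloc' (hD.loop_injective hz)
    (hD'.loop_injective hz')
  obtain ⟨α, ψ, hF, hG, hcF, hcG⟩ := R.exists_equiv R' hloc hloc' (mul_pos hK hK')
  change ∀ e, (∃ s, D'.head (α e) = .split s) ↔ ∃ s, D.head e = .split s at hF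
  change ∀ e, (∃ m, D'.tail (α e) = .merge m) ↔ ∃ m, D.tail e = .merge m at hG
  change ∀ e, (∃ s, D.head e = .split s) → ∀ b,
    α ((D.splitForest z).child e b) = (D'.splitForest z').child (α e) b ∧
    ψ ((D.splitForest z).child e b) = z (Sum.inl e) + ψ e - z' (Sum.inl (α e)) at hcF
  change ∀ e, (∃ m, D.tail e = .merge m) → ∀ b,
    α ((D.mergeForest z).child e b) = (D'.mergeForest z').child (α e) b ∧
    ψ ((D.mergeForest z).child e b) = - z (Sum.inl ((D.mergeForest z).child e b)) + ψ e
      - - z' (Sum.inl ((D'.mergeForest z').child (α e) b)) at hcG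
  -- A split is identified by its input edge and a merge by its output edge, so the bijection of
  -- edges induces bijections of vertices.
  have hσ : ∀ s, ∃ s', D'.head (α (D.head.symm (.split s))) = .split s' := fun s =>
    (hF _).2 ⟨s, by simp⟩
  have hσ' : ∀ s', ∃ s, D.head (α.symm (D'.head.symm (.split s'))) = .split s := fun s' =>
    (hF _).1 ⟨s', by simp⟩
  have hμ : ∀ m, ∃ m', D'.tail (α (D.tail.symm (.merge m))) = .merge m' := fun m =>
    (hG _).2 ⟨m, by simp⟩
  have hμ' : ∀ m', ∃ m, D.tail (α.symm (D'.tail.symm (.merge m'))) = .merge m := fun m' =>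
    (hG _).1 ⟨m', by simp⟩
  choose σ hσ using hσ
  choose σ' hσ' using hσ'
  choose μ hμ using hμ
  choose μ' hμ' using hμ'
  let S' : D.Split ≃ D'.Split :=
    { toFun := σ
      invFun := σ'
      left_inv := fun s => by
        have := hσ' (σ s)
        rw [← hσ, Equiv.symm_apply_apply, Equiv.symm_apply_apply, Equiv.apply_symm_apply] at this
        exact (Head.split.inj this).symm
      right_inv := fun s => by
        have := hσ (σ' s)
        rw [← hσ', Equiv.symm_apply_apply, Equiv.apply_symm_apply, Equiv.apply_symm_apply] at this
        exact (Head.split.inj this).symm }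
  let M' : D.Merge ≃ D'.Merge :=
    { toFun := μ
      invFun := μ'
      left_inv := fun s => by
        have := hμ' (μ s)
        rw [← hμ, Equiv.symm_apply_apply, Equiv.symm_apply_apply, Equiv.apply_symm_apply] at this
        exact (Tail.merge.inj this).symm
      right_inv := fun s => by
        have := hμ (μ' s)
        rw [← hμ', Equiv.symm_apply_apply, Equiv.apply_symm_apply, Equiv.apply_symm_apply] at this
        exact (Tail.merge.inj this).symm }
  have hsplit : ∀ {e s}, D.head e = .split s → D'.head (α e) = .split (σ s) := by
    intro e s h
    rw [← hσ, ← h, Equiv.symm_apply_apply]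
  have hmerge : ∀ {e m}, D.tail e = .merge m → D'.tail (α e) = .merge (μ m) := by
    intro e m h
    rw [← hμ, ← h, Equiv.symm_apply_apply]
  have hsplit' : ∀ {e s b}, D.tail e = .split s b → D'.tail (α e) = .split (σ s) b ∧
      ψ e = z (Sum.inl (D.head.symm (.split s))) + ψ (D.head.symm (.split s))
        - z' (Sum.inl (α (D.head.symm (.split s)))) := by
    intro e s b h
    have hs : D.head (D.head.symm (.split s)) = .split s := by simp
    obtain ⟨h1, h2⟩ := hcF _ ⟨s, hs⟩ b
    rw [splitForest_child_eq hs h] at h1 h2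
    refine ⟨?_, h2⟩
    rw [h1, splitForest_child (hsplit hs), Equiv.apply_symm_apply]
  have hmerge' : ∀ {e m b}, D.head e = .merge m b → D'.head (α e) = .merge (μ m) b ∧
      ψ e = - z (Sum.inl e) + ψ (D.tail.symm (.merge m)) + z' (Sum.inl (α e)) := by
    intro e m b h
    have hm : D.tail (D.tail.symm (.merge m)) = .merge m := by simp
    obtain ⟨h1, h2⟩ := hcG _ ⟨m, hm⟩ b
    rw [mergeForest_child_eq hm h] at h1 h2
    rw [← h1, sub_neg_eq_add] at h2
    refine ⟨?_, h2⟩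
    rw [h1, mergeForest_child (hmerge hm), Equiv.apply_symm_apply]
  have htail : ∀ e, D'.tail (α e) = (D.tail e).map id S' M' := by
    intro e
    rcases h : D.tail e with i | ⟨s, b⟩ | m
    · exact i.elim
    · exact (hsplit' h).1
    · exact hmerge h
  have hhead : ∀ e, D'.head (α e) = (D.head e).map id S' M' := by
    intro e
    rcases h : D.head e with i | s | ⟨m, b⟩
    · exact i.elim
    · exact hsplit h
    · exact (hmerge' h).1
  refine ⟨⟨S', M', α, lo, htail, hhead, fun y hy => ?_⟩⟩
  obtain ⟨χ, rfl⟩ := (isCutting_iff hz').1 hy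
  rw [isCutting_iff hz]
  let vm : D.Vertices → D'.Vertices
    | .source i => .source i
    | .sink o => .sink o
    | .split s => .split (σ s)
    | .merge m => .merge (μ m)
  -- The translation `ψ` between matched charts descends to vertices: it is the same on both outputs
  -- of a split, so taking the left one is harmless. With the opposite sign it is the 0-cochain
  -- comparing the two cutting classes.
  let Φ : D.Vertices → ℤ
    | .source i => i.elim
    | .sink o => o.elim
    | .split s => - ψ (D.tail.symm (.split s false))
    | .merge m => - ψ (D.tail.symm (.merge m))
  have hsrc : ∀ e, D'.src (α e) = vm (D.src e) := by
    intro e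
    rw [src, htail, src]
    rcases h : D.tail e with i | ⟨s, b⟩ | m
    · exact i.elim
    · rfl
    · rfl
  have htgt : ∀ e, D'.tgt (α e) = vm (D.tgt e) := by
    intro e
    rw [tgt, hhead, tgt]
    rcases h : D.head e with i | s | ⟨m, b⟩
    · exact i.elim
    · rfl
    · rfl
  have hΦs : ∀ e, Φ (D.src e) = - ψ e := by
    intro e
    rw [src]
    rcases h : D.tail e with i | ⟨s, b⟩ | m
    · exact i.elim
    · change - ψ _ = _
      rw [(hsplit' h).2, (hsplit' (s := s) (b := false) (D.tail.apply_symm_apply _)).2]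
    · change - ψ _ = _
      rw [← h, Equiv.symm_apply_apply]
  have hΦt : ∀ e, Φ (D.tgt e) = - ψ e + z' (Sum.inl (α e)) - z (Sum.inl e) := by
    intro e
    rw [tgt]
    rcases h : D.head e with i | s | ⟨m, b⟩
    · exact i.elim
    · change - ψ _ = _
      rw [(hsplit' (s := s) (b := false) (D.tail.apply_symm_apply _)).2, ← h, Equiv.symm_apply_apply]
      ring
    · change - ψ _ = _
      rw [(hmerge' h).2]
      ring
  refine ⟨fun v => Φ v + χ (vm v), ?_⟩
  funext x
  rcases x with e | l
  · change z' (Sum.inl (α e)) + (χ (D'.tgt (α e)) - χ (D'.src (α e))) =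
      z (Sum.inl e) + ((Φ (D.tgt e) + χ (vm (D.tgt e))) - (Φ (D.src e) + χ (vm (D.src e))))
    rw [hsrc, htgt, hΦs, hΦt]
    ring
  · change z' (Sum.inr (lo l)) + 0 = z (Sum.inr l) + 0
    rw [add_zero, add_zero]
    exact hlo l

end ClosedStrandDiagram

/-! ### Existence of closures -/

open StrandGraph

theorem AbstractStrandDiagram.exists_isClosureOf (A : AbstractStrandDiagram) :
    ∃ C : ClosedStrandDiagram, IsClosureOf C A := by
  classical
  have := A.toStrandGraph.finite_edge
  have hpos : A.toStrandGraph.PositiveOnCycles 0 :=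
    ⟨fun n γ h => (A.acyclic n γ h).elim, fun l => (A.isEmpty_loop.false l).elim⟩
  obtain ⟨K₀, p, -, hp⟩ := exists_potential hpos
  -- On the acyclic diagram `p` increases along every path, with weight zero. The multiple `K` is
  -- chosen so large that the weight one of the cut outweighs the drop of `p` from the last edge
  -- back to the first.
  obtain ⟨K, hK⟩ := (Set.finite_range fun x : A.Edge × A.Edge => 1 + p x.1 - p x.2).bddAbove
  have hK' : ∀ a b, 1 + p a - p b ≤ K := fun a b => hK ⟨(a, b), rfl⟩
  let w : A.Strands → ℤ := fun x => if x = Sum.inl (A.head.symm (.sink ())) then 1 else 0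
  obtain ⟨C, P, hP⟩ : ∃ (C : ClosedStrandDiagram) (P : Splicing A.toStrandGraph C.toStrandGraph
      _ _ _ _), C.IsCutting (P.push w) := by
    have hK1 : (0 : ℤ) < K := by
      have := hK' (A.tail.symm (.source ())) (A.tail.symm (.source ()))
      linarith
    refine exists_closedStrandDiagram A.isGluing (K := K) (p := p) hK1 ?_ ?_
      fun l => (A.isEmpty_loop.false l).elim
    · intro a b _ hab
      have h1 := hp a b hab
      have h2 : 0 ≤ w (Sum.inl a) := by
        simp only [w]
        split_ifs <;> simp
      have h3 := mul_nonneg hK1.le h2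
      simp only [Pi.zero_apply, mul_zero, zero_add] at h1
      linarith
    · rintro a b ⟨ha, -⟩
      have h1 : w (Sum.inl a) = 1 := if_pos (by rw [← ha, Equiv.symm_apply_apply])
      have := hK' a b
      rw [h1]
      linarith
  refine ⟨C, P, ?_⟩
  convert hP

/-! ### The strand diagram of an element of Thompson's group -/

namespace TreeDiagram

variable (N : ℕ) (v : List Bool → List Bool)

/-- The internal vertices of the tree of all words of length at most `N`. -/
abbrev DomainVertex : Type := {u : List Bool // u.length < N}

/-- The internal vertices of the tree whose leaves are the words `v u` with `u` of length `N`. -/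
abbrev RangeVertex : Type :=
  {p : List Bool // ∃ u : List Bool, u.length = N ∧ p <+: v u ∧ p ≠ v u}

/-- Edges are named by their starting places, so that only the bijectivity of `head` has to be
proved. -/
abbrev Edge : Type := Tail Unit (DomainVertex N) (RangeVertex N v)

variable {N v}

/-- The edge enters the vertex `x` of the domain tree. -/
inductive Enters : Edge N v → List Bool → Prop
  | source : Enters (.source ()) []
  | split (s b) : Enters (.split s b) (s.1 ++ [b])

/-- The edge that leaves the vertex `p` of the range tree ends at `h`. -/
inductive Up : List Bool → Head Unit (DomainVertex N) (RangeVertex N v) → Prop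
  | sink : Up [] (.sink ())
  | merge (m b) : Up (m.1 ++ [b]) (.merge m b)

/-- The edge `e` ends at `h`. -/
inductive Ends : Edge N v → Head Unit (DomainVertex N) (RangeVertex N v) → Prop
  | split {e s} (h : Enters e s.1) : Ends e (.split s)
  | leaf {e x h} (he : Enters e x) (hx : x.length = N) (hh : Up (v x) h) : Ends e h
  | merge {m h} (hh : Up m.1 h) : Ends (.merge m) h

theorem Enters.length_le {e : Edge N v} {x : List Bool} (h : Enters e x) : x.length ≤ N := by
  cases h with
  | source => simp
  | split s b => simpa using s.2

theorem Enters.right_unique {e : Edge N v} {x y : List Bool} (h : Enters e x) (h' : Enters e y) :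
    x = y := by
  cases h <;> cases h' <;> rfl

theorem Enters.left_unique {e e' : Edge N v} {x : List Bool} (h : Enters e x)
    (h' : Enters e' x) : e = e' := by
  cases h with
  | source =>
    generalize hy : ([] : List Bool) = y at h'
    cases h' with
    | source => rfl
    | split s b => simp at hy
  | split s b =>
    generalize hy : s.1 ++ [b] = y at h'
    cases h' with
    | source => simp at hy
    | split s' b' =>
      obtain ⟨h1, h2⟩ := List.append_inj' hy rfl
      rw [Subtype.ext h1, List.singleton_injective h2]

theorem Enters.exists (x : List Bool) (hx : x.length ≤ N) : ∃ e : Edge N v, Enters e x := by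
  rcases List.eq_nil_or_concat' x with rfl | ⟨x, b, rfl⟩
  · exact ⟨_, .source⟩
  · exact ⟨_, .split ⟨x, by simpa using hx⟩ b⟩

theorem Up.right_unique {p : List Bool} {h h' : Head Unit (DomainVertex N) (RangeVertex N v)}
    (H : Up p h) (H' : Up p h') : h = h' := by
  cases H with
  | sink =>
    generalize hy : ([] : List Bool) = y at H'
    cases H' with
    | sink => rfl
    | merge s b => simp at hy
  | merge s b =>
    generalize hy : s.1 ++ [b] = y at H'
    cases H' with
    | sink => simp at hy
    | merge s' b' =>
      obtain ⟨h1, h2⟩ := List.append_inj' hy rfl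
      rw [Subtype.ext h1, List.singleton_injective h2]

theorem Up.left_unique {p q : List Bool} {h : Head Unit (DomainVertex N) (RangeVertex N v)}
    (H : Up p h) (H' : Up q h) : p = q := by
  cases H <;> cases H' <;> rfl

theorem not_up_split {p : List Bool} {s : DomainVertex N} :
    ¬ Up (v := v) p (.split s) := by
  rintro ⟨⟩

theorem Up.exists {p u : List Bool} (hu : u.length = N) (hp : p <+: v u) :
    ∃ h : Head Unit (DomainVertex N) (RangeVertex N v), Up p h := by
  rcases List.eq_nil_or_concat' p with rfl | ⟨p, b, rfl⟩
  · exact ⟨_, .sink⟩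
  · refine ⟨_, .merge ⟨p, u, hu, (List.prefix_append _ _).trans hp, ?_⟩ b⟩
    rintro rfl
    have := hp.length_le
    simp at this

variable {f : Stream' Bool → Stream' Bool}

theorem Ends.exists_right (e : Edge N v) : ∃ h, Ends e h := by
  have key : ∀ x, Enters e x → ∃ h, Ends e h := by
    intro x hx
    rcases hx.length_le.lt_or_eq with h | h
    · exact ⟨_, .split (s := ⟨x, h⟩) hx⟩
    · obtain ⟨h', hh⟩ := Up.exists (v := v) h (List.prefix_refl _)
      exact ⟨h', .leaf hx h hh⟩
  rcases e with ⟨⟩ | ⟨s, b⟩ | m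
  · exact key _ .source
  · exact key _ (.split s b)
  · obtain ⟨u, hu, hm, -⟩ := m.2
    obtain ⟨h, hh⟩ := Up.exists hu hm
    exact ⟨h, .merge hh⟩

theorem Ends.right_unique {e : Edge N v} {h h' : Head Unit (DomainVertex N) (RangeVertex N v)}
    (H : Ends e h) (H' : Ends e h') : h = h' := by
  cases H with
  | @split _ s H =>
    cases H' with
    | split H' => rw [Subtype.ext (H.right_unique H')]
    | leaf he hx hh => exact (s.2.ne (by rw [H.right_unique he, hx])).elim
    | merge hh => cases H
  | leaf he hx hh =>
    cases H' with
    | @split _ s H' => exact (s.2.ne (by rw [H'.right_unique he, hx])).elim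
    | leaf he' hx' hh' =>
      obtain rfl := he.right_unique he'
      exact hh.right_unique hh'
    | merge hh => cases he
  | merge hh =>
    cases H' with
    | split H' => cases H'
    | leaf he' hx' hh' => cases he'
    | merge hh' => exact hh.right_unique hh'

/-- Nested cones in the range have intersecting preimages, by injectivity; but cones of distinct
words of the same length are disjoint. -/
theorem eq_of_prefix (hv : ∀ u : List Bool, u.length = N → ∀ w, f (u ++ₛ w) = v u ++ₛ w)
    (hf : Function.Injective f) {u u' : List Bool} (hu : u.length = N) (hu' : u'.length = N)
    (h : v u <+: v u') : u = u' := by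
  obtain ⟨r, hr⟩ := h
  have h1 : f (u' ++ₛ oneWord) = f (u ++ₛ (r ++ₛ oneWord)) := by
    rw [hv u' hu', hv u hu, ← hr, Stream'.append_append_stream]
  exact Stream'.append_left_injective _ _ _ _ (hf h1.symm) (hu.trans hu'.symm)

/-- By surjectivity some image cone meets the cone of the child. It cannot contain the parent's
cone, since the parent is a proper prefix of another leaf; so both children of an internal vertex
lie in the range tree. -/
theorem exists_child (hv : ∀ u : List Bool, u.length = N → ∀ w, f (u ++ₛ w) = v u ++ₛ w)
    (hf : Function.Bijective f) (m : RangeVertex N v) (b : Bool) :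
    ∃ u : List Bool, u.length = N ∧ m.1 ++ [b] <+: v u := by
  obtain ⟨u', hu', hm, hm'⟩ := m.2
  obtain ⟨x, hx⟩ := hf.2 ((m.1 ++ [b]) ++ₛ oneWord)
  have hu : (x.take N).length = N := Stream'.length_take N x
  refine ⟨x.take N, hu, ?_⟩
  rw [← Stream'.append_take_drop N x, hv _ hu] at hx
  by_cases hl : (m.1 ++ [b]).length ≤ (v (x.take N)).length
  · obtain ⟨r, hr, -⟩ := eq_append_of_append_eq hx.symm hl
    exact ⟨r, hr.symm⟩
  · exfalso
    obtain ⟨r, hr, -⟩ := eq_append_of_append_eq hx (not_le.1 hl).le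
    have h1 : v (x.take N) <+: m.1 := by
      refine List.prefix_of_prefix_length_le ⟨r, hr.symm⟩ (List.prefix_append _ _) ?_
      simp only [List.length_append, List.length_singleton] at hl
      omega
    have h2 := eq_of_prefix hv hf.1 hu hu' (h1.trans hm)
    rw [h2] at h1
    exact hm' (hm.eq_of_length_le h1.length_le)

theorem Ends.left_unique (hv : ∀ u : List Bool, u.length = N → ∀ w, f (u ++ₛ w) = v u ++ₛ w)
    (hf : Function.Injective f) {e e' : Edge N v}
    {h : Head Unit (DomainVertex N) (RangeVertex N v)} (H : Ends e h) (H' : Ends e' h) :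
    e = e' := by
  have key : ∀ (x : List Bool) (m : RangeVertex N v), x.length = N → v x ≠ m.1 := by
    rintro x ⟨m, u, hu, hm, hm'⟩ hx rfl
    exact hm' (by rw [eq_of_prefix hv hf hx hu hm])
  cases H with
  | split H =>
    cases H' with
    | split H' => exact H.left_unique H'
    | leaf he hx hh => exact absurd hh not_up_split
    | merge hh => exact absurd hh not_up_split
  | leaf he hx hh =>
    cases H' with
    | split H' => exact absurd hh not_up_split
    | leaf he' hx' hh' =>
      have h1 := hh.left_unique hh'
      obtain rfl := eq_of_prefix hv hf hx hx' (by rw [h1])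
      exact he.left_unique he'
    | merge hh' => exact absurd (hh.left_unique hh') (key _ _ hx)
  | merge hh =>
    cases H' with
    | split H' => exact absurd hh not_up_split
    | leaf he' hx' hh' => exact absurd (hh'.left_unique hh) (key _ _ hx')
    | merge hh' => rw [Subtype.ext (hh.left_unique hh')]

theorem Ends.exists_left (hv : ∀ u : List Bool, u.length = N → ∀ w, f (u ++ₛ w) = v u ++ₛ w)
    (hf : Function.Bijective f) (h : Head Unit (DomainVertex N) (RangeVertex N v)) :
    ∃ e, Ends e h := by
  have key : ∀ (p u : List Bool), u.length = N → p <+: v u → Up p h → ∃ e, Ends e h := by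
    intro p u hu hp hh
    by_cases hpu : p = v u
    · subst hpu
      obtain ⟨e, he⟩ := Enters.exists (v := v) u hu.le
      exact ⟨e, .leaf he hu hh⟩
    · exact ⟨_, .merge (m := ⟨p, u, hu, hp, hpu⟩) hh⟩
  rcases h with ⟨⟩ | s | ⟨m, b⟩
  · exact key [] (List.replicate N false) (by simp) List.nil_prefix .sink
  · obtain ⟨e, he⟩ := Enters.exists (v := v) s.1 s.2.le
    exact ⟨e, .split he⟩
  · obtain ⟨u, hu, h⟩ := exists_child hv hf m b
    exact key _ u hu h (.merge m b)

/-- The words that arrive at the sink. -/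
def eval (f : Stream' Bool → Stream' Bool) : Edge N v → Stream' Bool → Stream' Bool
  | .source _, w => f w
  | .split s b, w => f ((s.1 ++ [b]) ++ₛ w)
  | .merge m, w => m.1 ++ₛ w

theorem Enters.eval_eq {e : Edge N v} {x : List Bool} (h : Enters e x) (w : Stream' Bool) :
    eval f e w = f (x ++ₛ w) := by
  cases h <;> rfl

theorem Ends.eval_eq (hv : ∀ u : List Bool, u.length = N → ∀ w, f (u ++ₛ w) = v u ++ₛ w)
    {e : Edge N v} {h : Head Unit (DomainVertex N) (RangeVertex N v)} {p : List Bool}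
    (H : Ends e h) (hp : Up p h) (w : Stream' Bool) : eval f e w = p ++ₛ w := by
  cases H with
  | split H => exact absurd hp not_up_split
  | leaf he hx hh => rw [he.eval_eq, hv _ hx, hh.left_unique hp]
  | merge hh => rw [← hh.left_unique hp]; rfl

end TreeDiagram

open TreeDiagram in
theorem exists_represents {f : Stream' Bool → Stream' Bool} (hf : Function.Bijective f)
    (h : IsPrefixReplacement f) : ∃ A : AbstractStrandDiagram, A.Represents f := by
  obtain ⟨N, h⟩ := h
  choose! v hv using h
  choose φ hφ using Ends.exists_right (N := N) (v := v)
  choose ψ hψ using Ends.exists_left hv hf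
  let head : Edge N v ≃ Head Unit (DomainVertex N) (RangeVertex N v) :=
    { toFun := φ
      invFun := ψ
      left_inv := fun e => (hψ _).left_unique hv hf.1 (hφ e)
      right_inv := fun h => (hφ _).right_unique (hψ h) }
  have hfin : {u : List Bool | u.length = N}.Finite := List.finite_length_eq Bool N
  obtain ⟨L, hL⟩ := (hfin.image fun u => (v u).length).bddAbove
  have hL' : ∀ m : RangeVertex N v, m.1.length ≤ L := by
    rintro ⟨m, u, hu, hm, -⟩
    exact hm.length_le.trans (hL ⟨u, hu, rfl⟩)
  let G : StrandGraph Unit Unit :=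
    { Split := DomainVertex N
      Merge := RangeVertex N v
      Edge := Edge N v
      Loop := Empty
      finite_split := (List.finite_length_lt Bool N).to_subtype
      finite_merge := ((List.finite_length_le Bool L).subset (by
        intro m hm
        exact hL' ⟨m, hm⟩)).to_subtype
      finite_loop := inferInstance
      tail := Equiv.refl _
      head := head }
  -- Depth on the way down the domain tree, continued by the height climbed in the range tree. The
  -- bound `L` on the lengths of leaves keeps every merge above all edges of the domain tree.
  let rank : Edge N v → ℤ
    | .source _ => 0
    | .split s _ => s.1.length + 1
    | .merge m => N + 1 + L - m.1.length
  have hrank : ∀ e x, Enters e x → rank e = x.length := by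
    intro e x h
    cases h <;> simp [rank]
  have hrank' : ∀ a b, G.tgt a = G.src b → rank a + 1 ≤ rank b := by
    intro a b hab
    have ha : Ends a (φ a) := hφ a
    change (φ a).vertex Unit = Tail.vertex Unit b at hab
    generalize φ a = h at ha hab
    rcases b with ⟨⟩ | ⟨s, b⟩ | m
    · rcases h with ⟨⟩ | s | ⟨m, b⟩ <;> cases hab
    · rcases h with ⟨⟩ | s' | ⟨m, b⟩ <;> cases hab
      cases ha with
      | split h => rw [hrank _ _ h]
      | leaf he hx hh => exact absurd hh not_up_split
      | merge hh => exact absurd hh not_up_split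
    · rcases h with ⟨⟩ | s' | ⟨m, b⟩ <;> cases hab
      have := hL' m
      cases ha with
      | leaf he hx hh =>
        rw [hrank _ _ he, hx]
        simp only [rank]
        omega
      | @merge m' _ hh =>
        have := hh.left_unique (.merge m b)
        simp only [rank, this, List.length_append, List.length_singleton]
        push_cast
        linarith
  let A : AbstractStrandDiagram :=
    { toStrandGraph := G
      isEmpty_loop := inferInstanceAs (IsEmpty Empty)
      acyclic := fun n γ hγ => by
        -- The increasing rank is a potential for the zero cochain, whose sum over a cycle would
        -- then be positive.
        have h1 : G.PositiveOnCycles 0 := by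
          refine positiveOnCycles_of_potential (K := 1) (p := rank) one_pos (fun a b h => ?_)
            fun l => l.elim
          have := hrank' a b h
          simp only [Pi.zero_apply]
          linarith
        simpa using h1.1 n γ hγ }
  refine ⟨A, eval f, rfl, ?_, ?_, ?_⟩
  · intro s b w
    change eval f (ψ (.split s)) _ = f _
    have : Enters (ψ (.split s)) s.1 := by
      have h1 := hψ (.split s)
      generalize ψ (.split s) = e at h1
      cases h1 with
      | split h => exact h
      | leaf he hx hh => exact absurd hh not_up_split
      | merge hh => exact absurd hh not_up_split
    rw [this.eval_eq, Stream'.append_append_stream]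
    rfl
  · intro m b w
    change eval f (ψ (.merge m b)) w = m.1 ++ₛ Stream'.cons b w
    rw [(hψ _).eval_eq hv (.merge m b), Stream'.append_append_stream]
    rfl
  · intro w
    exact (hψ _).eval_eq hv .sink w

/-! ### Existence of reduced diagrams, and the main theorem -/

theorem ClosedStrandDiagram.exists_isReducedDiagramOf (f : ThompsonV) :
    ∃ D : ClosedStrandDiagram, D.IsReducedDiagramOf f := by
  obtain ⟨A, hA⟩ := exists_represents f.1.bijective f.2
  obtain ⟨C, hC⟩ := A.exists_isClosureOf
  obtain ⟨D, hD, hCD⟩ := exists_isReduced C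
  exact ⟨D, hD, A, C, hA, hC, hCD⟩

end Strand

theorem mainTheorem3 :
    (∀ f : Strand.ThompsonV, ∃ D : Strand.ClosedStrandDiagram, D.IsReducedDiagramOf f) ∧
      ∀ (f g : Strand.ThompsonV) (D E : Strand.ClosedStrandDiagram),
        D.IsReducedDiagramOf f → E.IsReducedDiagramOf g →
          (IsConj f g ↔ Nonempty (Strand.ClosedStrandDiagram.Iso D E)) := by
  refine ⟨Strand.ClosedStrandDiagram.exists_isReducedDiagramOf, fun f g D E hD hE => ?_⟩
  obtain ⟨z, hz⟩ := Strand.ClosedStrandDiagram.exists_isCutting D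
  obtain ⟨z', hz'⟩ := Strand.ClosedStrandDiagram.exists_isCutting E
  rw [← Strand.isom_cantorSpace_iff]
  constructor
  · intro h
    exact Strand.ClosedStrandDiagram.nonempty_iso_of_isom hD.1 hE.1 hz hz'
      (((hD.isom hz).trans h).trans (hE.isom hz').symm)
  · rintro ⟨ι⟩
    exact ((hD.isom hz).symm.trans (Strand.ClosedStrandDiagram.isom_of_iso ι hz hz')).trans
      (hE.isom hz')
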